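/- **Fillings and statistics.** Let $\lambda$ be a partition, $n=\ell(\lambda)$, with Young diagram $\mathsf{dg}(\lambda)$ drawn with row $1$ at the bottom; $(r,i)$ is the box in row $r$ and column $i$. Let $\mathcal T(\lambda)$ be the set of fillings $\sigma:\mathsf{dg}(\lambda)\to\{1,2,\dots\}$, with the conventions $\sigma(\lambda'_i+1,i)=0$ and $\sigma(0,i)=\infty$. A pair of vertically adjacent entries, $a$ right above $b$, is a column $(a,b)$; it is a descent if $a>b$ and a non-descent if $a\le b$. Put $\mathrm{maj}(\sigma)=\sum(\mathrm{leg}(x)+1)$ over the boxes $x$ not in the bottom row whose entry is larger than the entry right below, $\mathrm{leg}(x)$ being the number of boxes above $x$ in its column. Put $\mathcal Q(a,b,c)=1$ if $a<b<c$, $b<c<a$, $c<a<b$ or $a=b\ne c$, and $\mathcal Q(a,b,c)=0$ otherwise. The columns of height $j$ form a rectangle; $\sigma_j$ is the restriction of $\sigma$ to it, and $\sigma=\sigma_n\sqcup\dots\sqcup\sigma_1$. A quinv-quadruple set is a set $\mathcal S$ of quadruples $(z,w,u,v)$ of non-negative integers, membership in which depends only on the relative order of $z,w,u,v$ (with $u$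 or $v$ counted as larger than $z$ or $w$ in case of equality), such that: (1) for $z\neq w$, $(z,w,u,v)\in\mathcal S\iff(w,z,v,u)\in\mathcal S$; (2) $u\ne v$ on $\mathcal S$, and for $u\neq v$ exactly one of $(z,w,u,v),(z,w,v,u)$ is in $\mathcal S$; (3) $(z,z,u,v)\in\mathcal S\iff\mathcal Q(z,u,v)=1$; (4) the orderings $(z>u>v\ge w)$ and $(v\ge z>w>u)$ are both in $\mathcal S$ or both not in $\mathcal S$; (5) the orderings $(z>v\ge w>u)$ and $(u\ge z>v\ge w)$ are in $\mathcal S$. Let $\eta_{\mathcal S}(\sigma)$ be the number of pairs of boxes $(r,i),(r,j)$, $i<j$, in columns of equal height with $(\sigma(r+1,i),\sigma(r+1,j),\sigma(r,i),\sigma(r,j))\in\mathcal S$, and let $$\eta(\sigma)=\eta_{\mathcal S}(\sigma)+\sum_{i<j,\ \lambda'_i>\lambda'_j}\ \sum_{r\le\lambda'_j}\mathcal Q(\sigma(r+1,i),\sigma(r,i),\sigma(r,j)).$$ If $N$ is the largest entry of $\sigma$, let $\sigma'$ be obtained by turning every $\sigma_j$ upside down and replacing each entry $x$ by $N+1-x$,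 and let $$\eta^*(\sigma')=\eta_{\mathcal S}(\sigma)+\sum_{i<j,\ \lambda'_i>\lambda'_j}\ \sum_{r\le\lambda'_j}\mathcal Q(\sigma'(r,i),\sigma'(r-1,i),\sigma'(r,j)).$$ **Canonical tableaux.** A rectangular filling is canonical if between any consecutive rows $r+1,r$ (including the row of zeros above the top row): (I) for columns $(a,b)$ and $(a,c)$, $b$ to the left of $c$, one has $a>b\ge c$, $c\ge a>b$ or $b\ge c\ge a$; (II) for non-descent columns $(a,c)$ and $(b,d)$, $a$ to the left of $b$, $a\ge b$ implies $c\ge d$ and $a<b$ implies $c\le d$. It is dual canonical if (I) holds and (II) holds with "non-descent" replaced by "descent". A filling $\sigma$ is (dual) canonical if all $\sigma_j$ are. Let $\mathcal C_\diamond(\lambda)$, $\mathcal C_\dagger(\lambda)$ be the sets of canonical and dual canonical fillings. **The families $\mathcal G(\sigma)$.** Let $\tau$ be a filling of a rectangle with $k$ columns. The operator $\delta_i^r$ interchanges columns $i,i+1$ in the rows $m,\dots,r$, where $m\le r$ is the highest row with $\tau(m,i)=\tau(m,i+1)$, and $m=1$ if there is none. For a permutation $w\in S_k$ with reduced expression $s_{i_\ell}\cdots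 s_{i_1}$ put $\Delta^r_w=\delta^r_{i_\ell}\circ\dots\circ\delta^r_{i_1}$ (independent of the reduced expression), and write $w(p)=(p_{w^{-1}(1)},\dots,p_{w^{-1}(k)})$. Let $p$, $a$ be rows $r$, $r+1$ of $\tau$. Let $\pi^\bullet$ be the permutation sorting $a$ stably into weakly decreasing order; $\pi^\diamond$ puts first the descent columns $(a_i,p_i)$ in their order and then the non-descent columns, stably sorted by weakly decreasing $a_i$; $\pi^\dagger$ puts first the descent columns, stably sorted by weakly decreasing $a_i$, and then the non-descent columns in their order. Fix $\varepsilon\in\{\diamond,\dagger\}$. For a permutation $u$ put $\delta^{r,\bullet}_u(\tau)=\Delta^{r+1}_{(\pi^\bullet)^{-1}}\Delta^r_u\Delta^{r+1}_{\pi^\bullet}(\tau)$, and for a permutation $v$ put $\delta^{r,\varepsilon}_v(\tau)=\Delta^{r+1}_{(\pi^\varepsilon)^{-1}}\Delta^r_v\Delta^{r+1}_{\pi^\varepsilon}(\tau)$, where $\pi^\bullet,\pi^\varepsilon$ are computed from the tableau operated on. Let $U(\tau)$ be the set of permutations $u$ which preserve each maximal set of positions with equal entries in row $r+1$ of $\Delta^{r+1}_{\pi^\bullet}(\tau)$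 and which are shortest among all such permutations producing the same rearrangement $u(\alpha)$; here $\alpha$ is row $r$ of $\Delta^{r+1}_{\pi^\bullet}(\tau)$ in which each entry $p_i$ with upper neighbour $a_i$ is replaced, for $\varepsilon=\diamond$, by $a_i$ if $p_i\ge a_i$, and, for $\varepsilon=\dagger$, by $a_i-1$ if $p_i<a_i$. Let $V(\tau)$ be the set of permutations that move only the positions of the non-descent columns ($\varepsilon=\diamond$), resp. descent columns ($\varepsilon=\dagger$), between rows $r+1$ and $r$ of $\Delta^{r+1}_{\pi^\varepsilon}(\tau)$ and that, applied to row $r$, leave these columns non-descents, resp. descents. For a rectangular $\sigma\in\mathcal C_\varepsilon$ with $m$ rows let $\mathcal G(\sigma;0)=\{\sigma\}$, $$\mathcal G(\sigma;r)=\{\delta^{r,\varepsilon}_v(\delta^{r,\bullet}_u(\tau)):\ \tau\in\mathcal G(\sigma;r-1),\ u\in U(\tau),\ v\in V(\delta^{r,\bullet}_u(\tau))\}\quad(1\le r\le m),$$ and $\mathcal G(\sigma)=\mathcal G(\sigma;m)$. For arbitrary $\sigma\in\mathcal C_\varepsilon(\lambda)$ let $\mathcal G(\sigma)=\{\tau\in\mathcal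 T(\lambda):\tau_j\in\mathcal G(\sigma_j)\text{ for all }j\}$. **The coefficients.** Let $\sigma\in\mathcal T(\lambda)$ have largest entry $N$. For $i\le j$ consider row $i$ of $\sigma_j$ and the columns $(a,b)$ between rows $i+1$ and $i$ of $\sigma_j$. For $\diamond$ let $\nu^k$ be the number of entries $\ge N+1-k$ in row $i$, let $s^h_h=\#\{(a,b):N+1-h=a\le b\}$ and $s^h_k-s^h_{k-1}=\#\{(a,b):N+1-h=a>b=N+1-k\}$ for $k>h$. For $\dagger$ let $\nu^k$ be the number of entries $\le k$ in row $i$, let $s_h^h=\#\{(a,b):h+1=a>b\}$ and $s^h_k-s^h_{k-1}=\#\{(a,b):h+1=a\le b=k\}$ for $k>h$. With $c=1$ for $\diamond$ and $c=0$ for $\dagger$, put $$d_\varepsilon(\sigma)=\prod_{j=1}^{n}\prod_{i\le j}\ \prod_{c\le k<N}\left(\begin{bmatrix}\nu^{k+1}-\sum_{h=c}^{k}s^h_{k+1}\\ \nu^{k}-\sum_{h=c}^{k}s^h_{k}\end{bmatrix}_t\ \prod_{c\le h\le k}\begin{bmatrix}s^h_{k+1}\\ s^h_k\end{bmatrix}_t\right).$$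 **Theorem.** For $\varepsilon\in\{\diamond,\dagger\}$, $\mathcal T(\lambda)$ is the disjoint union of the sets $\mathcal G(\sigma)$, $\sigma\in\mathcal C_\varepsilon(\lambda)$. Let $\mathcal S$ be a quinv-quadruple set with statistics $\eta,\eta^*$. If the ordering $(v>u\ge z>w)$ is in $\mathcal S$, then for every $\sigma\in\mathcal C_\diamond(\lambda)$ the set $\mathcal G(\sigma)$ is finite and, with $\varepsilon=\diamond$, $$\sum_{\tau\in\mathcal G(\sigma)}q^{\mathrm{maj}(\tau)}t^{\eta(\tau)}=q^{\mathrm{maj}(\sigma)}t^{\eta(\sigma)}d_\varepsilon(\sigma),\qquad \sum_{\tau\in\mathcal G(\sigma)}q^{\mathrm{maj}(\tau')}t^{\eta^*(\tau')}=q^{\mathrm{maj}(\sigma')}t^{\eta^*(\sigma')}d_\varepsilon(\sigma').$$ If the ordering $(z>w>v>u)$ is in $\mathcal S$, then for every $\sigma\in\mathcal C_\dagger(\lambda)$ the set $\mathcal G(\sigma)$ is finite and both identities hold with $\varepsilon=\dagger$. -/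

import Mathlib

noncomputable section

namespace MacTab

/-! ### Fillings of a Young diagram

A partition `λ` is a `YoungDiagram`. The cell `(i, j)` is the box in the `(i+1)`-st row from the
bottom and the `(j+1)`-st column from the left, so that `μ.rowLen i = λ_{i+1}` and
`μ.colLen j = λ'_{j+1}`. -/

/-- Fillings of a diagram by positive integers. -/
abbrev Filling (μ : YoungDiagram) : Type := {c : ℕ × ℕ // c ∈ μ} → ℕ+

/-- Entry of a filling; outside the diagram (in particular right above a column) it is `0`. -/
def entry {μ : YoungDiagram} (σ : Filling μ) (r c : ℕ) : ℕ :=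
  if h : (r, c) ∈ μ then (σ ⟨(r, c), h⟩ : ℕ) else 0

/-- The largest entry `N` (`0` for the empty filling). -/
def maxEntry {μ : YoungDiagram} (σ : Filling μ) : ℕ :=
  μ.cells.sup fun x => entry σ x.1 x.2

/-- The number of boxes strictly above a box in its column. -/
def leg (μ : YoungDiagram) (x : ℕ × ℕ) : ℕ := μ.colLen x.2 - (x.1 + 1)

/-- The major index: the sum of `leg + 1` over the descents (boxes whose entry exceeds the entry
right below; boxes of the bottom row are never descents). -/
def maj {μ : YoungDiagram} (σ : Filling μ) : ℕ :=
  ∑ x ∈ μ.cells with 1 ≤ x.1 ∧ entry σ (x.1 - 1) x.2 < entry σ x.1 x.2, (leg μ x + 1)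

/-- The order condition in the definition of (queue) inversion triples. -/
def IsInvTriple {α : Type*} [LinearOrder α] (a b c : α) : Prop :=
  (a < b ∧ b < c) ∨ (b < c ∧ c < a) ∨ (c < a ∧ a < b) ∨ (a = b ∧ b ≠ c)

/-- `quinv`-quadruple sets, as predicates on quadruples `(z, w, u, v)` (upper entries `z, w`, lower
entries `u, v`). Such a set is a set of order patterns: membership depends only on the relative
order of the entries, where a lower entry equal to an upper one counts as the larger of the two. -/
structure IsQuinvQuadrupleSet (S : ℕ → ℕ → ℕ → ℕ → Prop) : Prop where
  pattern : ∀ z w u v z' w' u' v' : ℕ,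
    (z < w ↔ z' < w') → (w < z ↔ w' < z') → (u < v ↔ u' < v') → (v < u ↔ v' < u') →
    (z ≤ u ↔ z' ≤ u') → (z ≤ v ↔ z' ≤ v') → (w ≤ u ↔ w' ≤ u') → (w ≤ v ↔ w' ≤ v') →
    (S z w u v ↔ S z' w' u' v')
  swap : ∀ z w u v : ℕ, z ≠ w → (S z w u v ↔ S w z v u)
  ne : ∀ z w u v : ℕ, S z w u v → u ≠ v
  exactlyOne : ∀ z w u v : ℕ, u ≠ v → Xor (S z w u v) (S z w v u)
  diag : ∀ z u v : ℕ, S z z u v ↔ IsInvTriple z u v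
  bothOrNeither :
    (∀ z w u v : ℕ, w ≤ v → v < u → u < z → S z w u v) ↔
      (∀ z w u v : ℕ, u < w → w < z → z ≤ v → S z w u v)
  mandatory₁ : ∀ z w u v : ℕ, u < w → w ≤ v → v < z → S z w u v
  mandatory₂ : ∀ z w u v : ℕ, w ≤ v → v < z → z ≤ u → S z w u v

/-- Pairs of boxes of the same row, the second one to the right of the first one. -/
def rowPairs (μ : YoungDiagram) : Finset ((ℕ × ℕ) × (ℕ × ℕ)) :=
  (μ.cells ×ˢ μ.cells).filter fun p => p.1.1 = p.2.1 ∧ p.1.2 < p.2.2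

open scoped Classical in
/-- `η_S`: the number of `S`-quadruples, taken over pairs of columns of equal height. -/
def etaS (S : ℕ → ℕ → ℕ → ℕ → Prop) {μ : YoungDiagram} (σ : Filling μ) : ℕ :=
  ((rowPairs μ).filter fun p => μ.colLen p.1.2 = μ.colLen p.2.2 ∧
    S (entry σ (p.1.1 + 1) p.1.2) (entry σ (p.2.1 + 1) p.2.2)
      (entry σ p.1.1 p.1.2) (entry σ p.2.1 p.2.2)).card

open scoped Classical in
/-- The number of queue inversion triples `(a, b, c)`, `a` right above `b` and `c` in the row of `b`
to the right, such that the column of `(a, b)` is longer than the column of `c`. -/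
def quinvTriples {μ : YoungDiagram} (σ : Filling μ) : ℕ :=
  ((rowPairs μ).filter fun p => μ.colLen p.2.2 < μ.colLen p.1.2 ∧
    IsInvTriple (entry σ (p.1.1 + 1) p.1.2) (entry σ p.1.1 p.1.2) (entry σ p.2.1 p.2.2)).card

/-- The entry right below a box, `∞` for a box of the bottom row. -/
def below {μ : YoungDiagram} (σ : Filling μ) (x : ℕ × ℕ) : ℕ∞ :=
  if x.1 = 0 then ⊤ else (entry σ (x.1 - 1) x.2 : ℕ∞)

open scoped Classical in
/-- The number of inversion triples `(a, b, c)`, `b` right below `a` and `c` in the row of `a` to the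
right, such that the column of `(a, b)` is longer than the column of `c`. -/
def invTriples {μ : YoungDiagram} (σ : Filling μ) : ℕ :=
  ((rowPairs μ).filter fun p => μ.colLen p.2.2 < μ.colLen p.1.2 ∧
    IsInvTriple (entry σ p.1.1 p.1.2 : ℕ∞) (below σ p.1) (entry σ p.2.1 p.2.2 : ℕ∞)).card

/-- The statistic `η` attached to `S`. -/
def eta (S : ℕ → ℕ → ℕ → ℕ → Prop) {μ : YoungDiagram} (σ : Filling μ) : ℕ :=
  etaS S σ + quinvTriples σ

theorem flip_mem {μ : YoungDiagram} {x : ℕ × ℕ} (h : x ∈ μ) :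
    (μ.colLen x.2 - 1 - x.1, x.2) ∈ μ := by
  have h1 : x.1 < μ.colLen x.2 := YoungDiagram.mem_iff_lt_colLen.1 h
  exact YoungDiagram.mem_iff_lt_colLen.2 (by omega)

/-- The filling `σ'`: every maximal rectangle is flipped upside down (i.e. every column is reversed)
and every entry `x` is replaced by `N + 1 - x`, where `N` is the largest entry of `σ`. -/
def prime {μ : YoungDiagram} (σ : Filling μ) : Filling μ := fun x =>
  (maxEntry σ).succPNat - σ ⟨(μ.colLen x.1.2 - 1 - x.1.1, x.1.2), flip_mem x.2⟩

/-- The value `η*(σ') = η_S(σ) + #{inversion triples of σ' between columns of different heights}`,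
as a function of `σ`. -/
def etaStarPrime (S : ℕ → ℕ → ℕ → ℕ → Prop) {μ : YoungDiagram} (σ : Filling μ) : ℕ :=
  etaS S σ + invTriples (prime σ)

/-! ### Rectangular fillings and the decomposition into rectangles -/

/-- Fillings of the rectangle with `n` rows (row `0` at the bottom) and `k` columns. -/
abbrev Rect (n k : ℕ) : Type := Fin n → Fin k → ℕ+

/-- Row `y` of a rectangular filling; above the top row all entries are `0`. -/
def row {n k : ℕ} (τ : Rect n k) (y : ℕ) (c : Fin k) : ℕ :=
  if h : y < n then (τ ⟨y, h⟩ c : ℕ) else 0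

/-- The number of columns of height `h`. -/
def width (μ : YoungDiagram) (h : ℕ) : ℕ := μ.rowLen (h - 1) - μ.rowLen h

theorem block_mem {μ : YoungDiagram} {h : ℕ} (i : Fin h) (j : Fin (width μ h)) :
    ((i : ℕ), μ.rowLen h + (j : ℕ)) ∈ μ := by
  have hj : (j : ℕ) < μ.rowLen (h - 1) - μ.rowLen h := j.2
  have hi := i.2
  have := μ.rowLen_anti i (h - 1) (by omega)
  exact YoungDiagram.mem_iff_lt_rowLen.2 (by omega)

/-- The part `σ_h` of a filling in the rectangle formed by the columns of height `h`. -/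
def block {μ : YoungDiagram} (σ : Filling μ) (h : ℕ) : Rect h (width μ h) :=
  fun i j => σ ⟨((i : ℕ), μ.rowLen h + (j : ℕ)), block_mem i j⟩

/-! ### Canonical and dual canonical fillings -/

/-- The two kinds: `diamond` (canonical) and `dagger` (dual canonical). -/
inductive Kind : Type
  | diamond
  | dagger

/-- The column with upper entry `a` and lower entry `p` is a non-descent (for `diamond`),
resp. a descent (for `dagger`). -/
def InBlock : Kind → ℕ → ℕ → Prop
  | .diamond, a, p => a ≤ p
  | .dagger, a, p => p < a

instance (ε : Kind) (a p : ℕ) : Decidable (InBlock ε a p) :=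
  match ε with
  | .diamond => inferInstanceAs (Decidable (a ≤ p))
  | .dagger => inferInstanceAs (Decidable (p < a))

/-- Canonical (`diamond`) and dual canonical (`dagger`) rectangular fillings. -/
def IsCanonicalRect (ε : Kind) {n k : ℕ} (σ : Rect n k) : Prop :=
  ∀ r : Fin n, ∀ i j : Fin k, i < j →
    (row σ (r + 1) i = row σ (r + 1) j →
      (row σ r i < row σ (r + 1) i ∧ row σ r j ≤ row σ r i) ∨
      (row σ r i < row σ (r + 1) i ∧ row σ (r + 1) i ≤ row σ r j) ∨
      (row σ (r + 1) i ≤ row σ r j ∧ row σ r j ≤ row σ r i)) ∧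
    (InBlock ε (row σ (r + 1) i) (row σ r i) → InBlock ε (row σ (r + 1) j) (row σ r j) →
      (row σ (r + 1) j ≤ row σ (r + 1) i → row σ r j ≤ row σ r i) ∧
      (row σ (r + 1) i < row σ (r + 1) j → row σ r i ≤ row σ r j))

/-- A filling is (dual) canonical if all its rectangles are. -/
def IsCanonical (ε : Kind) {μ : YoungDiagram} (σ : Filling μ) : Prop :=
  ∀ h : ℕ, IsCanonicalRect ε (block σ h)

/-! ### Flip operators -/

/-- Indices of simple transpositions of `k` letters. -/
abbrev SimpleIdx (k : ℕ) : Type := {i : ℕ // i + 1 < k}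

/-- The first of the two neighbouring positions. -/
def posL {k : ℕ} (i : SimpleIdx k) : Fin k := ⟨i.1, by have := i.2; omega⟩

/-- The second of the two neighbouring positions. -/
def posR {k : ℕ} (i : SimpleIdx k) : Fin k := ⟨i.1 + 1, i.2⟩

/-- The simple transposition `s_i`. -/
def simple {k : ℕ} (i : SimpleIdx k) : Equiv.Perm (Fin k) := Equiv.swap (posL i) (posR i)

/-- The flip operator `δ_i^r`: the neighbouring columns are interchanged in all rows from `m`
to `r`, where `m ≤ r` is the highest row in which the two columns have equal entries, and `m` is the
bottom row `0` if there is no such row. -/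
def flip {n k : ℕ} (r : ℕ) (i : SimpleIdx k) (τ : Rect n k) : Rect n k := fun x =>
  if Nat.findGreatest (fun y => row τ y (posL i) = row τ y (posR i)) r ≤ (x : ℕ) ∧ (x : ℕ) ≤ r then
    τ x ∘ simple i
  else τ x

theorem exists_word {k : ℕ} (w : Equiv.Perm (Fin k)) :
    ∃ l : List (SimpleIdx k), (l.map simple).prod = w := by
  cases k with
  | zero => exact ⟨[], Subsingleton.elim _ _⟩
  | succ m =>
    have hw : w ∈ Submonoid.closure
        (Set.range fun i : Fin m => Equiv.swap i.castSucc i.succ) := by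
      rw [Equiv.Perm.mclosure_swap_castSucc_succ]; trivial
    induction hw using Submonoid.closure_induction with
    | mem x hx =>
      obtain ⟨i, rfl⟩ := hx
      refine ⟨[⟨i, by omega⟩], ?_⟩
      simp [simple, posL, posR, Fin.castSucc, Fin.succ, Fin.castAdd, Fin.castLE]
    | one => exact ⟨[], rfl⟩
    | mul x y _ _ hx hy =>
      obtain ⟨l, rfl⟩ := hx
      obtain ⟨l', rfl⟩ := hy
      exact ⟨l ++ l', by simp⟩

theorem exists_reducedWord {k : ℕ} (w : Equiv.Perm (Fin k)) :
    ∃ l : List (SimpleIdx k), (l.map simple).prod = w ∧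
      ∀ l' : List (SimpleIdx k), (l'.map simple).prod = w → l.length ≤ l'.length := by
  obtain ⟨l, hl, hmin⟩ := WellFounded.has_min
    (InvImage.wf (fun l : List (SimpleIdx k) => l.length) Nat.lt_wfRel.wf)
    {l | (l.map simple).prod = w} (exists_word w)
  exact ⟨l, hl, fun l' hl' => not_lt.1 (hmin l' hl')⟩

/-- A reduced expression `s_{i_ℓ} ⋯ s_{i_1}` of a permutation, listed as `[i_ℓ, …, i_1]`. -/
def reducedWord {k : ℕ} (w : Equiv.Perm (Fin k)) : List (SimpleIdx k) :=
  (exists_reducedWord w).choose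

/-- The length of a permutation. -/
def len {k : ℕ} (w : Equiv.Perm (Fin k)) : ℕ := (reducedWord w).length

/-- The operator `Δ_w^r = δ_{i_ℓ}^r ∘ ⋯ ∘ δ_{i_1}^r` for a reduced expression
`w = s_{i_ℓ} ⋯ s_{i_1}` (it does not depend on the expression, by the braid relation). -/
def flips {n k : ℕ} (r : ℕ) (w : Equiv.Perm (Fin k)) (τ : Rect n k) : Rect n k :=
  (reducedWord w).foldr (flip r) τ

/-- `w(p) = (p_{w⁻¹(1)}, …, p_{w⁻¹(k)})`. -/
def act {k : ℕ} (w : Equiv.Perm (Fin k)) (p : Fin k → ℕ) : Fin k → ℕ := fun i => p (w⁻¹ i)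

/-- The permutation sending each position to its new position when the positions are sorted by
increasing key, positions with the same key keeping their relative order. -/
def sortPerm {α : Type*} [LinearOrder α] {k : ℕ} (key : Fin k → α) : Equiv.Perm (Fin k) :=
  (Tuple.sort key)⁻¹

/-- The permutation `π^•`, which sorts `a` into weakly decreasing order, stably. -/
def piBullet {k : ℕ} (a : Fin k → ℕ) : Equiv.Perm (Fin k) :=
  sortPerm fun i => OrderDual.toDual (a i)

/-- The permutations `π^⋄` and `π^†` of the columns with upper entries `a` and lower entries `p`.
`π^⋄`: first the descent columns from left to right, then the non-descent columns with weakly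
decreasing `a`, stably. `π^†`: first the descent columns with weakly decreasing `a`, stably, then
the non-descent columns from left to right. -/
def piBlock : Kind → {k : ℕ} → (Fin k → ℕ) → (Fin k → ℕ) → Equiv.Perm (Fin k)
  | .diamond, _, a, p => sortPerm fun i =>
      if p i < a i then (⊥ : WithBot ℕᵒᵈ) else ((OrderDual.toDual (a i) : ℕᵒᵈ) : WithBot ℕᵒᵈ)
  | .dagger, _, a, p => sortPerm fun i =>
      if p i < a i then ((OrderDual.toDual (a i) : ℕᵒᵈ) : WithTop ℕᵒᵈ) else (⊤ : WithTop ℕᵒᵈ)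

/-- `Δ_{π⁻¹} ∘ Δ_w^r ∘ Δ_π` on the rows up to row `r + 1`. -/
def conjFlips {n k : ℕ} (r : ℕ) (π w : Equiv.Perm (Fin k)) (τ : Rect n k) : Rect n k :=
  flips (r + 1) π⁻¹ (flips r w (flips (r + 1) π τ))

/-- The operator `δ_u^r` for a permutation of neutral blocks. -/
def deltaNeutral {n k : ℕ} (r : ℕ) (u : Equiv.Perm (Fin k)) (τ : Rect n k) : Rect n k :=
  conjFlips r (piBullet (row τ (r + 1))) u τ

/-- The operator `δ_v^r` for a permutation of the non-descent (resp. descent) block. -/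
def deltaBlock (ε : Kind) {n k : ℕ} (r : ℕ) (v : Equiv.Perm (Fin k)) (τ : Rect n k) : Rect n k :=
  conjFlips r (piBlock ε (row τ (r + 1)) (row τ r)) v τ

/-! ### The family `G(σ)` -/

/-- The map identifying the entries `p` below `a` that form non-descents (`diamond`), resp. descents
(`dagger`), and keeping the other entries: these entries are replaced by `a`, resp. `a - 1`. -/
def alpha : Kind → ℕ → ℕ → ℕ
  | .diamond, a, p => if a ≤ p then a else p
  | .dagger, a, p => if p < a then a - 1 else p

/-- Let `a`, `p` be rows `r + 1`, `r` of `Δ_{π^•}(τ)`; the neutral blocks are the sets of positions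
on which `a` is constant. The set consists of the permutations `u` that preserve each neutral block
and are the shortest ones producing the rearrangement `u(α(p))`. -/
def symNeutral (ε : Kind) {n k : ℕ} (r : ℕ) (τ : Rect n k) : Set (Equiv.Perm (Fin k)) :=
  let τ₁ := flips (r + 1) (piBullet (row τ (r + 1))) τ
  let a := row τ₁ (r + 1)
  let q : Fin k → ℕ := fun j => alpha ε (a j) (row τ₁ r j)
  {u | (∀ j, a (u j) = a j) ∧
    ∀ x : Equiv.Perm (Fin k), (∀ j, a (x j) = a j) → act x q = act u q → len u ≤ len x}

/-- The permutations that move only positions of the non-descent (resp. descent) block `Q` in row `r`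
of `Δ_{π^⋄}(τ)` (resp. `Δ_{π^†}(τ)`) and after which `Q` is still a non-descent (resp. descent)
block. -/
def symBlock (ε : Kind) {n k : ℕ} (r : ℕ) (τ : Rect n k) : Set (Equiv.Perm (Fin k)) :=
  let τ₂ := flips (r + 1) (piBlock ε (row τ (r + 1)) (row τ r)) τ
  let a := row τ₂ (r + 1)
  let p := row τ₂ r
  {v | (∀ j, ¬ InBlock ε (a j) (p j) → v j = j) ∧
    ∀ j, InBlock ε (a j) (p j) → InBlock ε (a j) (act v p j)}

/-- All `δ_v^r(δ_u^r(τ))`, for `u` permuting the neutral blocks and `v` permuting the non-descent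
(resp. descent) block of row `r`. -/
def familyStep (ε : Kind) {n k : ℕ} (r : ℕ) (τ : Rect n k) : Set (Rect n k) :=
  {ρ | ∃ u ∈ symNeutral ε r τ, ∃ v ∈ symBlock ε r (deltaNeutral r u τ),
    ρ = deltaBlock ε r v (deltaNeutral r u τ)}

/-- `G(σ; m)`: the rows `0, …, m - 1` have been processed, from bottom to top. -/
def familyUpTo (ε : Kind) {n k : ℕ} (σ : Rect n k) : ℕ → Set (Rect n k)
  | 0 => {σ}
  | m + 1 => ⋃ τ ∈ familyUpTo ε σ m, familyStep ε m τ

/-- `G(σ)` for a rectangular filling. -/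
def familyRect (ε : Kind) {n k : ℕ} (σ : Rect n k) : Set (Rect n k) := familyUpTo ε σ n

/-- `G(σ)` for any filling, rectangle by rectangle. -/
def family (ε : Kind) {μ : YoungDiagram} (σ : Filling μ) : Set (Filling μ) :=
  {τ | ∀ h : ℕ, block τ h ∈ familyRect ε (block σ h)}

/-! ### The coefficients `d_⋄` and `d_†` -/

/-- The field `ℚ(q, t)`. -/
abbrev Kqt : Type := FractionRing (MvPolynomial (Fin 2) ℚ)

/-- The indeterminate `q`. -/
def qv : Kqt := algebraMap (MvPolynomial (Fin 2) ℚ) Kqt (MvPolynomial.X 0)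

/-- The indeterminate `t`. -/
def tv : Kqt := algebraMap (MvPolynomial (Fin 2) ℚ) Kqt (MvPolynomial.X 1)

/-- `[n]_t! = [1]_t ⋯ [n]_t` with `[m]_t = 1 + t + ⋯ + t^{m-1}`. -/
def tFactorial (n : ℕ) : Kqt := ∏ m ∈ Finset.Icc 1 n, ∑ i ∈ Finset.range m, tv ^ i

/-- The `t`-binomial coefficient. -/
def tBinom (n k : ℕ) : Kqt :=
  if k ≤ n then tFactorial n / (tFactorial k * tFactorial (n - k)) else 0

/-- The number of columns `(a, b)` between rows `i + 1` and `i` with a given property. -/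
def numCols {n k : ℕ} (τ : Rect n k) (i : ℕ) (P : ℕ → ℕ → Prop) [∀ a b, Decidable (P a b)] : ℕ :=
  (Finset.univ.filter fun c : Fin k => P (row τ (i + 1) c) (row τ i c)).card

/-- The number `ν_i^m` of entries `N, N - 1, …, N + 1 - m` in row `i` (for `diamond`), resp. of
entries `1, 2, …, m` (for `dagger`). -/
def nu : Kind → ℕ → {n k : ℕ} → Rect n k → ℕ → ℕ → ℕ
  | .diamond, N, _, _, τ, i, m => ∑ l ∈ Finset.Icc 1 m, numCols τ i fun _ b => b = N + 1 - l
  | .dagger, _, _, _, τ, i, m => ∑ l ∈ Finset.Icc 1 m, numCols τ i fun _ b => b = l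

/-- The number `s_m^h`, for `h ≤ m`, of the columns between rows `i + 1` and `i`. -/
def sNum : Kind → ℕ → {n k : ℕ} → Rect n k → ℕ → ℕ → ℕ → ℕ
  | .diamond, N, _, _, τ, i, h, m =>
      (numCols τ i fun a b => a = N + 1 - h ∧ a ≤ b) +
        ∑ l ∈ Finset.Ioc h m, numCols τ i fun a b => a = N + 1 - h ∧ b < a ∧ b = N + 1 - l
  | .dagger, _, _, _, τ, i, h, m =>
      (numCols τ i fun a b => a = h + 1 ∧ b < a) +
        ∑ l ∈ Finset.Ioc h m, numCols τ i fun a b => a = h + 1 ∧ a ≤ b ∧ b = l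

/-- The lower end of the ranges of the indices `h` and `m`: `1` for `⋄`, `0` for `†`. -/
def lowIdx : Kind → ℕ
  | .diamond => 1
  | .dagger => 0

/-- `d_ε` of a rectangular filling with entries at most `N`. -/
def dRect (ε : Kind) (N : ℕ) {n k : ℕ} (τ : Rect n k) : Kqt :=
  ∏ i ∈ Finset.range n, ∏ m ∈ Finset.Ico (lowIdx ε) N,
    (tBinom (nu ε N τ i (m + 1) - ∑ h ∈ Finset.Icc (lowIdx ε) m, sNum ε N τ i h (m + 1))
        (nu ε N τ i m - ∑ h ∈ Finset.Icc (lowIdx ε) m, sNum ε N τ i h m) *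
      ∏ h ∈ Finset.Icc (lowIdx ε) m, tBinom (sNum ε N τ i h (m + 1)) (sNum ε N τ i h m))

/-- `d_ε(σ) = d_ε(σ_n) ⋯ d_ε(σ_1)` with `n = ℓ(λ)`, where `N` is the largest entry of `σ`. -/
def dCoeff (ε : Kind) {μ : YoungDiagram} (σ : Filling μ) : Kqt :=
  ∏ h ∈ Finset.Icc 1 (μ.colLen 0), dRect ε (maxEntry σ) (block σ h)

end MacTab

end

/-! The proof reduces the construction of the families to a statement about two adjacent rows.

Flips are an action. Let `w` act on row `r`, and let every row further down be moved by the
permutation that rearranges the row above it in the same way while keeping the order of equal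
entries (`std`, `drag`). Standardization satisfies a cocycle identity, so dragging is an action of
the symmetric group; a flip is the drag of a simple transposition, and Δ_w^r is the drag of `w`
(`flips_eq_drag`). Conjugation by operators of row `r + 1` gives again a drag of row `r`. One step
of the construction therefore replaces row `r` by an arbitrary row of its class: the rows with the
same entries and the same multiset of columns, where the lower entries of the non-descents (for
`diamond`) or of the descents (for `dagger`) are forgotten (`mem_familyStep`).

Two rows. The upper row may be sorted stably, since this changes neither the number of
`S`-quadruples (`pairInv_act`) nor the property of being canonical. Below a weakly decreasing row, a
member of a class is given by an arrangement of the labels inside the neutral blocks, followed by an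
arrangement of the forgotten entries subject to the bounds given by the upper row. Counting ascents
in both arrangements defines `excess`. Rearrangements with a monotone bound have a product of
Gaussian binomials as generating function (`sum_rearr`), hence so do the classes (`sum_rowClass`).
Excess zero means canonical, so the value at `t = 0` shows that each class has exactly one canonical
row. Finally, `pairInv - excess` is constant on a class (`pairInv_add_excess`): apart from the
ascents, a pair of columns contributes a symmetric function of two labels plus functions of a label
and an entry, and the total of these depends only on the multisets of labels and entries. The axioms
on orderings and the extra ordering enter here.

All rows. A drag acts on two adjacent rows below row `r` by a single permutation that is stable for
the upper one, so quadruples there are not affected. Moving row after row back to the canonical row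
of its class gives the partition of the fillings, and the generating function of a family is the
product of those of the classes. Row contents and numbers of descents are preserved, which makes
`maj` and the triples between rectangles constant on a family.

Coefficients. The binomials in `d` telescope to the same quotients of `t`-factorials as those of the
classes (`classProd_tv`, `dRect_eq`). For the second identity `d(σ') = d(σ)` is needed as well:
apart from the multiplicities of entries in interior rows, the coefficient is a product of terms
that are symmetric under turning two rows upside down and complementing (`dRect_dual`). -/

noncomputable section

namespace MacTab

/-! ### Gaussian binomial coefficients -/

section Gauss

variable {K : Type*} [CommSemiring K]

/-- Gaussian binomial coefficients, by the Pascal recursion. -/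
def gaussBinom (t : K) : ℕ → ℕ → K
  | _, 0 => 1
  | 0, _ + 1 => 0
  | n + 1, c + 1 => gaussBinom t n c + t ^ (c + 1) * gaussBinom t n (c + 1)

@[simp] theorem gaussBinom_zero_right (t : K) (n : ℕ) : gaussBinom t n 0 = 1 := by
  cases n <;> rfl

@[simp] theorem gaussBinom_zero_succ (t : K) (c : ℕ) : gaussBinom t 0 (c + 1) = 0 := rfl

theorem gaussBinom_succ_succ (t : K) (n c : ℕ) :
    gaussBinom t (n + 1) (c + 1) = gaussBinom t n c + t ^ (c + 1) * gaussBinom t n (c + 1) := rfl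

/-- Setting `t = 0` counts the objects without inversions; this value is what later gives existence
and uniqueness of canonical rows. -/
theorem gaussBinom_zero_of_le {n c : ℕ} (h : c ≤ n) : gaussBinom (0 : K) n c = 1 := by
  induction n generalizing c with
  | zero => obtain rfl : c = 0 := by omega
            simp
  | succ n ih =>
    cases c with
    | zero => simp
    | succ c => rw [gaussBinom_succ_succ, ih (by omega)]; simp

/-- Pascal recursion on the largest element `m`: if `m ∈ C` it lies in no counted pair, and if `m ∉
C` it forms a pair with each element of `C`. -/
theorem sum_powersetCard_pow {ι : Type*} [LinearOrder ι] (t : K) (D : Finset ι) (c : ℕ) :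
    ∑ C ∈ D.powersetCard c, t ^ ((C ×ˢ (D \ C)).filter fun x => x.1 < x.2).card =
      gaussBinom t D.card c := by
  induction D using Finset.induction_on_max generalizing c with
  | empty =>
    cases c with
    | zero => simp
    | succ c => simp
  | insert m D hm ih =>
    have hmD : m ∉ D := fun h => lt_irrefl _ (hm m h)
    cases c with
    | zero => simp
    | succ c =>
      rw [Finset.powersetCard_succ_insert hmD, Finset.sum_union, Finset.sum_image,
        Finset.card_insert_of_notMem hmD, gaussBinom_succ_succ, add_comm, ← ih c, ← ih (c + 1),
        Finset.mul_sum]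
      · congr 1
        · refine Finset.sum_congr rfl fun C hC => ?_
          rw [Finset.mem_powersetCard] at hC
          congr 2
          ext ⟨i, j⟩
          simp only [Finset.mem_filter, Finset.mem_product, Finset.mem_insert, Finset.mem_sdiff]
          constructor
          · rintro ⟨⟨rfl | hi, rfl | hj, hj'⟩, hlt⟩
            · exact absurd hlt (lt_irrefl _)
            · exact absurd (hm j hj) (not_lt.2 hlt.le)
            · exact absurd (Or.inl rfl) hj'
            · exact ⟨⟨hi, hj, fun h => hj' (Or.inr h)⟩, hlt⟩
          · rintro ⟨⟨hi, hj, hj'⟩, hlt⟩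
            refine ⟨⟨Or.inr hi, Or.inr hj, ?_⟩, hlt⟩
            rintro (rfl | h)
            · exact hmD hj
            · exact hj' h
        · refine Finset.sum_congr rfl fun C hC => ?_
          rw [Finset.mem_powersetCard] at hC
          have hmC : m ∉ C := fun h => hmD (hC.1 h)
          rw [← pow_add]
          congr 1
          have : (C ×ˢ (insert m D \ C)).filter (fun x => x.1 < x.2) =
              (C.image fun i => (i, m)) ∪ (C ×ˢ (D \ C)).filter (fun x => x.1 < x.2) := by
            ext ⟨i, j⟩
            simp only [Finset.mem_filter, Finset.mem_product, Finset.mem_insert, Finset.mem_sdiff,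
              Finset.mem_union, Finset.mem_image, Prod.mk.injEq]
            constructor
            · rintro ⟨⟨hi, rfl | hj, hj'⟩, hlt⟩
              · exact Or.inl ⟨i, hi, rfl, rfl⟩
              · exact Or.inr ⟨⟨hi, hj, hj'⟩, hlt⟩
            · rintro (⟨i', hi, rfl, rfl⟩ | ⟨⟨hi, hj, hj'⟩, hlt⟩)
              · exact ⟨⟨hi, Or.inl rfl, hmC⟩, hm _ (hC.1 hi)⟩
              · exact ⟨⟨hi, Or.inr hj, hj'⟩, hlt⟩
          rw [this, Finset.card_union_of_disjoint, Finset.card_image_of_injective, hC.2]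
          · intro i j h; exact (Prod.mk.inj h).1
          · rw [Finset.disjoint_left]
            rintro ⟨i, j⟩ h1 h2
            simp only [Finset.mem_filter, Finset.mem_product, Finset.mem_sdiff,
              Finset.mem_image, Prod.mk.injEq] at h1 h2
            obtain ⟨_, _, _, rfl⟩ := h1
            exact hmD h2.1.2.1
      · intro C hC C' hC' h
        rw [Finset.mem_coe, Finset.mem_powersetCard] at hC hC'
        have h1 : m ∉ C := fun h => hmD (hC.1 h)
        have h2 : m ∉ C' := fun h => hmD (hC'.1 h)
        rw [← Finset.erase_insert h1, h, Finset.erase_insert h2]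
      · rw [Finset.disjoint_left]
        intro C h1 h2
        rw [Finset.mem_image] at h2
        obtain ⟨C', _, rfl⟩ := h2
        rw [Finset.mem_powersetCard] at h1
        exact hmD (h1.1 (Finset.mem_insert_self _ _))

/-! ### Rearrangements subject to a bound -/

variable {ι : Type*}

/-- The number of pairs of positions in `P` with increasing values. -/
def ascents [LinearOrder ι] (P : Finset ι) (p : ι → ℕ) : ℕ :=
  ((P ×ˢ P).filter fun x => x.1 < x.2 ∧ p x.1 < p x.2).card

open scoped Classical in
/-- The rearrangements of `p₀` on `P` bounded below by `a` on `P`. -/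
def rearr [Fintype ι] (P : Finset ι) (N : ℕ) (a p₀ : ι → ℕ) : Finset (ι → ℕ) :=
  (Fintype.piFinset fun _ => Finset.range (N + 1)).filter fun p =>
    (∀ i ∉ P, p i = p₀ i) ∧ (∀ i ∈ P, a i ≤ p i) ∧
      ∀ x, (P.filter fun i => p i = x).card = (P.filter fun i => p₀ i = x).card

theorem mem_rearr [Fintype ι] {P : Finset ι} {N : ℕ} {a p₀ p : ι → ℕ} :
    p ∈ rearr P N a p₀ ↔ (∀ i, p i ≤ N) ∧ (∀ i ∉ P, p i = p₀ i) ∧ (∀ i ∈ P, a i ≤ p i) ∧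
      ∀ x, (P.filter fun i => p i = x).card = (P.filter fun i => p₀ i = x).card := by
  simp [rearr]

/-- Truncation at `N` only identifies the values `N` and `N + 1`, so the ascents it destroys are
those from `N` to `N + 1`. -/
theorem ascents_truncate [LinearOrder ι] (P : Finset ι) (N : ℕ) (p : ι → ℕ) (hp : ∀ i ∈ P, p i ≤ N + 1) :
    ascents P p = ascents P (fun i => min (p i) N) +
      ((P ×ˢ P).filter fun x => x.1 < x.2 ∧ p x.1 = N ∧ p x.2 = N + 1).card := by
  rw [ascents, ascents, ← Finset.card_union_of_disjoint]
  · congr 1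
    ext ⟨i, j⟩
    simp only [Finset.mem_filter, Finset.mem_product, Finset.mem_union]
    constructor
    · rintro ⟨⟨hi, hj⟩, hlt, h⟩
      have := hp i hi; have := hp j hj
      by_cases hN : p i < N
      · exact Or.inl ⟨⟨hi, hj⟩, hlt, by omega⟩
      · exact Or.inr ⟨⟨hi, hj⟩, hlt, by omega, by omega⟩
    · rintro (⟨⟨hi, hj⟩, hlt, h⟩ | ⟨⟨hi, hj⟩, hlt, h, h'⟩)
      · exact ⟨⟨hi, hj⟩, hlt, by omega⟩
      · exact ⟨⟨hi, hj⟩, hlt, by omega⟩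
  · rw [Finset.disjoint_left]
    rintro ⟨i, j⟩ h1 h2
    simp only [Finset.mem_filter, Finset.mem_product] at h1 h2
    omega

theorem card_filter_truncate_top [LinearOrder ι] {P : Finset ι} {N : ℕ} (p : ι → ℕ) (hp : ∀ i ∈ P, p i ≤ N + 1) :
    (P.filter fun i => min (p i) N = N).card =
      (P.filter fun i => p i = N).card + (P.filter fun i => p i = N + 1).card := by
  rw [← Finset.card_union_of_disjoint]
  · congr 1
    ext i
    simp only [Finset.mem_filter, Finset.mem_union]
    constructor
    · rintro ⟨hi, h⟩
      have := hp i hi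
      rcases Nat.lt_or_ge N (p i) with h' | h'
      · exact Or.inr ⟨hi, by omega⟩
      · exact Or.inl ⟨hi, by omega⟩
    · rintro (⟨hi, h⟩ | ⟨hi, h⟩)
      · exact ⟨hi, by omega⟩
      · exact ⟨hi, by omega⟩
  · rw [Finset.disjoint_left]
    intro i h1 h2
    simp only [Finset.mem_filter] at h1 h2
    omega

theorem card_filter_truncate [LinearOrder ι] {P : Finset ι} {N : ℕ} {p p₀ : ι → ℕ} (hp : ∀ i ∈ P, p i ≤ N + 1)
    (hp₀ : ∀ i ∈ P, p₀ i ≤ N + 1)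
    (h : ∀ x, (P.filter fun i => p i = x).card = (P.filter fun i => p₀ i = x).card) (x : ℕ) :
    (P.filter fun i => min (p i) N = x).card = (P.filter fun i => min (p₀ i) N = x).card := by
  rcases lt_trichotomy x N with hx | rfl | hx
  · convert h x using 3
    · omega
    · omega
  · rw [card_filter_truncate_top p hp, card_filter_truncate_top p₀ hp₀, h, h]
  · rw [Finset.filter_false_of_mem, Finset.filter_false_of_mem]
    · intro i _; omega
    · intro i _; omega

/-- The rearrangement which refines the truncation `q`: among the positions with value `N`, those in
`C` keep the value `N`, and the other ones get the value `N + 1`. -/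
def refineAt [LinearOrder ι] (P : Finset ι) (N : ℕ) (p₀ q : ι → ℕ) (C : Finset ι) (i : ι) : ℕ :=
  if i ∈ P then (if q i < N then q i else if i ∈ C then N else N + 1) else p₀ i

/-- Inverse of the map sending `p` to its truncation and the set of positions with value `N`. The
set `C` must avoid the positions with `a i = N + 1`, where only the value `N + 1` is allowed. -/
theorem refineAt_mem_rearr [Fintype ι] [LinearOrder ι] {P : Finset ι} {N : ℕ} {a p₀ q : ι → ℕ} {C : Finset ι}
    (hp₀ : ∀ i, p₀ i ≤ N + 1) (ha : ∀ i ∈ P, a i ≤ p₀ i)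
    (hq : q ∈ rearr P N (fun i => min (a i) N) fun i => min (p₀ i) N)
    (hC : C ∈ (P.filter fun i => q i = N ∧ a i ≤ N).powersetCard (P.filter fun i => p₀ i = N).card) :
    refineAt P N p₀ q C ∈ rearr P (N + 1) a p₀ ∧ (fun i => min (refineAt P N p₀ q C i) N) = q ∧
      (P.filter fun i => refineAt P N p₀ q C i = N) = C := by
  rw [mem_rearr] at hq
  obtain ⟨hq1, hq2, hq3, hq4⟩ := hq
  rw [Finset.mem_powersetCard] at hC
  obtain ⟨hC1, hC2⟩ := hC
  have hCm : ∀ i ∈ C, i ∈ P ∧ q i = N ∧ a i ≤ N := fun i hi => by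
    simpa using hC1 hi
  have hb : ∀ i, refineAt P N p₀ q C i ≤ N + 1 := fun i => by
    have := hq1 i; have := hp₀ i
    unfold refineAt; split_ifs <;> omega
  have hmin : (fun i => min (refineAt P N p₀ q C i) N) = q := by
    ext i
    have := hq1 i
    by_cases hi : i ∈ P
    · simp only [refineAt, hi, if_true]
      split_ifs <;> omega
    · simp only [refineAt, hi, if_false]
      exact (hq2 i hi).symm
  have hfil : (P.filter fun i => refineAt P N p₀ q C i = N) = C := by
    ext i
    simp only [Finset.mem_filter]
    constructor
    · rintro ⟨hi, h⟩
      simp only [refineAt, hi, if_true] at h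
      split_ifs at h with h1 h2
      · omega
      · exact h2
      · omega
    · intro hi
      obtain ⟨h1, h2, h3⟩ := hCm i hi
      refine ⟨h1, ?_⟩
      simp [refineAt, h1, h2, hi]
  refine ⟨mem_rearr.2 ⟨hb, ?_, ?_, ?_⟩, hmin, hfil⟩
  · intro i hi
    simp [refineAt, hi]
  · intro i hi
    have h1 := hq3 i hi
    have h2 := ha i hi
    have h3 := hp₀ i
    simp only [refineAt, hi, if_true]
    split_ifs with h4 h5
    · omega
    · exact (hCm i h5).2.2
    · omega
  · have hlow : ∀ r : ι → ℕ, ∀ x < N, (P.filter fun i => min (r i) N = x) = P.filter fun i => r i = x := by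
      intro r x hx
      ext i
      simp only [Finset.mem_filter, and_congr_right_iff]
      omega
    intro x
    rcases lt_trichotomy x N with hx | rfl | hx
    · have := hq4 x
      rw [← hmin] at this
      rwa [hlow _ x hx, hlow _ x hx] at this
    · rw [hfil, hC2]
    · rcases (Nat.succ_le_of_lt hx).eq_or_lt with rfl | hx'
      · have := hq4 N
        rw [← hmin, card_filter_truncate_top _ (fun i _ => hb i),
          card_filter_truncate_top _ (fun i _ => hp₀ i), hfil, hC2] at this
        simpa using this
      · rw [Finset.filter_false_of_mem, Finset.filter_false_of_mem]
        · intro i _; have := hp₀ i; omega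
        · intro i _; have := hb i; omega

/-- The number of positions at which a truncation `q` leaves a choice does not depend on `q`: all
positions with `a i > N` are forced to have `q i = N`, and the multiplicity of `N` in `q` is fixed.
-/
theorem card_filter_top [Fintype ι] [LinearOrder ι] {P : Finset ι} {N : ℕ} {a p₀ q : ι → ℕ}
    (ha : ∀ i ∈ P, a i ≤ p₀ i)
    (hq : q ∈ rearr P N (fun i => min (a i) N) fun i => min (p₀ i) N) :
    (P.filter fun i => q i = N ∧ a i ≤ N).card = (P.filter fun i => a i ≤ N ∧ N ≤ p₀ i).card := by
  rw [mem_rearr] at hq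
  obtain ⟨hq1, hq2, hq3, hq4⟩ := hq
  have h1 : (P.filter fun i => q i = N).card =
      (P.filter fun i => q i = N ∧ a i ≤ N).card + (P.filter fun i => ¬ a i ≤ N).card := by
    rw [← Finset.card_filter_add_card_filter_not (s := P.filter fun i => q i = N) (fun i => a i ≤ N),
      Finset.filter_filter, Finset.filter_filter]
    congr 2
    ext i
    simp only [Finset.mem_filter, and_congr_right_iff]
    intro hi
    have := hq3 i hi; have := hq1 i
    omega
  have h2 : (P.filter fun i => min (p₀ i) N = N).card =
      (P.filter fun i => a i ≤ N ∧ N ≤ p₀ i).card + (P.filter fun i => ¬ a i ≤ N).card := by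
    rw [← Finset.card_filter_add_card_filter_not (s := P.filter fun i => min (p₀ i) N = N)
      (fun i => a i ≤ N), Finset.filter_filter, Finset.filter_filter]
    congr 2
    · ext i
      simp only [Finset.mem_filter, and_congr_right_iff]
      omega
    · ext i
      simp only [Finset.mem_filter, and_congr_right_iff]
      intro hi
      have := ha i hi
      omega
  have := hq4 N
  omega

/-- The generating function of the rearrangements bounded below by an antitone function. -/
theorem sum_rearr [Fintype ι] [LinearOrder ι] (t : K) (P : Finset ι) (N : ℕ) : ∀ (a p₀ : ι → ℕ), AntitoneOn a P →
    (∀ i, p₀ i ≤ N) → (∀ i ∈ P, a i ≤ p₀ i) →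
    ∑ p ∈ rearr P N a p₀, t ^ ascents P p =
      ∏ x ∈ Finset.range N, gaussBinom t (P.filter fun i => a i ≤ x ∧ x ≤ p₀ i).card
        (P.filter fun i => p₀ i = x).card := by
  -- Induction on the bound on the values. A rearrangement with values up to `N + 1` is its
  -- truncation at `N` together with the set of positions that keep the value `N`; the lost ascents
  -- are the pairs counted by `sum_powersetCard_pow`.
  induction N with
  | zero =>
    intro a p₀ _ hp ha
    have h0 : ∀ i, p₀ i = 0 := fun i => Nat.le_zero.1 (hp i)
    have : rearr P 0 a p₀ = {p₀} := by
      ext p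
      rw [mem_rearr, Finset.mem_singleton]
      constructor
      · intro h; ext i; rw [h0]; exact Nat.le_zero.1 (h.1 i)
      · rintro rfl; exact ⟨hp, fun _ _ => rfl, ha, fun _ => rfl⟩
    rw [this, Finset.sum_singleton]
    simp [ascents, h0]
  | succ N ih =>
    intro a p₀ haa hp ha
    have ha' : AntitoneOn (fun i => min (a i) N) P := fun i hi j hj hij =>
      min_le_min_right _ (haa hi hj hij)
    rw [Finset.prod_range_succ]
    have hIH := ih (fun i => min (a i) N) (fun i => min (p₀ i) N) ha' (fun i => min_le_right _ _)
      (fun i hi => min_le_min_right _ (ha i hi))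
    have hprod : ∏ x ∈ Finset.range N, gaussBinom t (P.filter fun i => a i ≤ x ∧ x ≤ p₀ i).card
        (P.filter fun i => p₀ i = x).card = ∏ x ∈ Finset.range N, gaussBinom t
          (P.filter fun i => min (a i) N ≤ x ∧ x ≤ min (p₀ i) N).card
          (P.filter fun i => min (p₀ i) N = x).card := by
      refine Finset.prod_congr rfl fun x hx => ?_
      have hx := Finset.mem_range.1 hx
      congr 2 <;> (ext i; simp only [Finset.mem_filter, and_congr_right_iff]; omega)
    rw [hprod, ← hIH, Finset.sum_mul]
    have hinner : ∀ q ∈ rearr P N (fun i => min (a i) N) fun i => min (p₀ i) N,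
        t ^ ascents P q * gaussBinom t (P.filter fun i => a i ≤ N ∧ N ≤ p₀ i).card
          (P.filter fun i => p₀ i = N).card =
        ∑ C ∈ (P.filter fun i => q i = N ∧ a i ≤ N).powersetCard (P.filter fun i => p₀ i = N).card,
          t ^ ascents P q * t ^ ((C ×ˢ ((P.filter fun i => q i = N ∧ a i ≤ N) \ C)).filter
            fun x => x.1 < x.2).card := by
      intro q hq
      rw [← card_filter_top ha hq, ← sum_powersetCard_pow, Finset.mul_sum]
    rw [Finset.sum_congr rfl hinner, Finset.sum_sigma']
    refine Finset.sum_nbij' (fun p => ⟨fun i => min (p i) N, P.filter fun i => p i = N⟩)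
      (fun y => refineAt P N p₀ y.1 y.2) ?_ ?_ ?_ ?_ ?_
    · intro p hp'
      rw [mem_rearr] at hp'
      obtain ⟨h1, h2, h3, h4⟩ := hp'
      rw [Finset.mem_sigma, mem_rearr, Finset.mem_powersetCard]
      refine ⟨⟨fun i => min_le_right _ _, fun i hi => by simp only [h2 i hi],
        fun i hi => min_le_min_right _ (h3 i hi),
        card_filter_truncate (fun i _ => h1 i) (fun i _ => hp i) h4⟩, ?_, h4 N⟩
      intro i hi
      simp only [Finset.mem_filter] at hi ⊢
      have := h3 i hi.1
      exact ⟨hi.1, by omega, by omega⟩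
    · rintro ⟨q, C⟩ hy
      rw [Finset.mem_sigma] at hy
      exact (refineAt_mem_rearr hp ha hy.1 hy.2).1
    · intro p hp'
      rw [mem_rearr] at hp'
      obtain ⟨h1, h2, h3, h4⟩ := hp'
      ext i
      have := h1 i
      by_cases hi : i ∈ P
      · simp only [refineAt, hi, if_true, Finset.mem_filter, true_and]
        split_ifs <;> omega
      · simp only [refineAt, hi, if_false, h2 i hi]
    · rintro ⟨q, C⟩ hy
      rw [Finset.mem_sigma] at hy
      obtain ⟨-, h1, h2⟩ := refineAt_mem_rearr hp ha hy.1 hy.2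
      simp only [h1, h2]
    · intro p hp'
      rw [mem_rearr] at hp'
      obtain ⟨h1, h2, h3, h4⟩ := hp'
      rw [ascents_truncate P N p (fun i _ => h1 i), pow_add]
      congr 3
      ext ⟨i, j⟩
      simp only [Finset.mem_filter, Finset.mem_product, Finset.mem_sdiff]
      constructor
      · rintro ⟨⟨hi, hj⟩, hlt, e1, e2⟩
        have := h3 i hi
        -- Monotonicity of the bound is needed here: `a j ≤ a i ≤ N`, so the later position `j` of
        -- value `N + 1` could also have received `N`.
        have := haa hi hj hlt.le
        exact ⟨⟨⟨hi, e1⟩, ⟨hj, by omega, by omega⟩, fun h => by omega⟩, hlt⟩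
      · rintro ⟨⟨⟨hi, e1⟩, ⟨hj, e2, e3⟩, e4⟩, hlt⟩
        have := h1 j
        have : p j ≠ N := fun h => e4 ⟨hj, h⟩
        exact ⟨⟨hi, hj⟩, hlt, e1, by omega⟩

end Gauss

/-! ### Rearrangements of a non-descent or descent block -/

section Gauss

variable {K : Type*} [CommSemiring K]

theorem gaussBinom_eq_zero_of_lt (t : K) {n c : ℕ} (h : n < c) : gaussBinom t n c = 0 := by
  induction n generalizing c with
  | zero => obtain ⟨c, rfl⟩ : ∃ d, c = d + 1 := ⟨c - 1, by omega⟩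
            simp
  | succ n ih =>
    obtain ⟨c, rfl⟩ : ∃ d, c = d + 1 := ⟨c - 1, by omega⟩
    rw [gaussBinom_succ_succ, ih (by omega), ih (by omega)]
    simp

@[simp] theorem gaussBinom_self (t : K) (n : ℕ) : gaussBinom t n n = 1 := by
  induction n with
  | zero => simp
  | succ n ih => rw [gaussBinom_succ_succ, ih, gaussBinom_eq_zero_of_lt t (Nat.lt_succ_self n)]; simp

variable {ι : Type*}

theorem ascents_eq_zero_iff [LinearOrder ι] {P : Finset ι} {p : ι → ℕ} :
    ascents P p = 0 ↔ ∀ i ∈ P, ∀ j ∈ P, i < j → p j ≤ p i := by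
  rw [ascents, Finset.card_eq_zero, Finset.filter_eq_empty_iff]
  constructor
  · intro h i hi j hj hij
    have := h (Finset.mk_mem_product hi hj)
    simp only [hij, true_and, not_lt] at this
    exact this
  · rintro h ⟨i, j⟩ hx ⟨h1, h2⟩
    rw [Finset.mem_product] at hx
    exact absurd (h i hx.1 j hx.2 h1) (not_le.2 h2)

/-- The value `x` may stand below `a`, and comes after (`diamond`), resp. before (`dagger`) the
values beyond `p`. -/
def Between : Kind → ℕ → ℕ → ℕ → Prop
  | .diamond, a, x, p => a ≤ x ∧ x ≤ p
  | .dagger, a, x, p => p ≤ x ∧ x < a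

instance (ε : Kind) (a x p : ℕ) : Decidable (Between ε a x p) :=
  match ε with
  | .diamond => inferInstanceAs (Decidable (a ≤ x ∧ x ≤ p))
  | .dagger => inferInstanceAs (Decidable (p ≤ x ∧ x < a))

open scoped Classical in
/-- The rearrangements of `p₀` on `P` which are non-descents (`diamond`), resp. descents (`dagger`)
below `a` on `P`. -/
def rearrBlock [Fintype ι] (ε : Kind) (P : Finset ι) (N : ℕ) (a p₀ : ι → ℕ) : Finset (ι → ℕ) :=
  (Fintype.piFinset fun _ => Finset.range (N + 1)).filter fun p =>
    (∀ i ∉ P, p i = p₀ i) ∧ (∀ i ∈ P, InBlock ε (a i) (p i)) ∧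
      ∀ x, (P.filter fun i => p i = x).card = (P.filter fun i => p₀ i = x).card

theorem mem_rearrBlock [Fintype ι] {ε : Kind} {P : Finset ι} {N : ℕ} {a p₀ p : ι → ℕ} :
    p ∈ rearrBlock ε P N a p₀ ↔ (∀ i, p i ≤ N) ∧ (∀ i ∉ P, p i = p₀ i) ∧
      (∀ i ∈ P, InBlock ε (a i) (p i)) ∧
      ∀ x, (P.filter fun i => p i = x).card = (P.filter fun i => p₀ i = x).card := by
  simp [rearrBlock]

theorem mem_ascents_filter [LinearOrder ι] {P : Finset ι} {p : ι → ℕ} {x : ι × ι} :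
    x ∈ ((P ×ˢ P).filter fun x => x.1 < x.2 ∧ p x.1 < p x.2) ↔
      (x.1 ∈ P ∧ x.2 ∈ P) ∧ x.1 < x.2 ∧ p x.1 < p x.2 := by
  rw [Finset.mem_filter, Finset.mem_product]

/-- The reverse of a linear order. -/
abbrev reverseOrder (ι : Type*) [LinearOrder ι] : LinearOrder ι :=
  inferInstanceAs (LinearOrder ιᵒᵈ)

/-- Reversing both the positions and the values preserves ascents. It exchanges upper and lower
bounds and thus deduces `dagger` from `diamond`. -/
theorem ascents_reverseOrder [LinearOrder ι] {P : Finset ι} {N : ℕ} {p : ι → ℕ}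
    (hp : ∀ i, p i ≤ N) :
    @ascents ι (reverseOrder ι) P (fun i => N - p i) = ascents P p := by
  refine Finset.card_nbij' Prod.swap Prod.swap ?_ ?_ (fun _ _ => rfl) fun _ _ => rfl
  · rintro ⟨i, j⟩ h
    have h := (@mem_ascents_filter ι (reverseOrder ι) P (fun i => N - p i) (i, j)).1 h
    have h1 := hp i; have h2 := hp j
    have h3 : N - p i < N - p j := h.2.2
    exact mem_ascents_filter.2 ⟨⟨h.1.2, h.1.1⟩, h.2.1, show p j < p i by omega⟩
  · rintro ⟨i, j⟩ h
    have h := mem_ascents_filter.1 h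
    have h1 := hp i; have h2 := hp j
    have h3 : p i < p j := h.2.2
    exact (@mem_ascents_filter ι (reverseOrder ι) P (fun i => N - p i) (j, i)).2
      ⟨⟨h.1.2, h.1.1⟩, h.2.1, show N - p j < N - p i by omega⟩

theorem card_filter_reverse {P : Finset ι} {N : ℕ} {p p₀ : ι → ℕ} (hp : ∀ i, p i ≤ N)
    (hp₀ : ∀ i, p₀ i ≤ N)
    (h : ∀ x, (P.filter fun i => p i = x).card = (P.filter fun i => p₀ i = x).card) (x : ℕ) :
    (P.filter fun i => N - p i = x).card = (P.filter fun i => N - p₀ i = x).card := by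
  by_cases hx : x ≤ N
  · convert h (N - x) using 3
    · rename_i i _
      have := hp i
      omega
    · rename_i i _
      have := hp₀ i
      omega
  · rw [Finset.filter_false_of_mem, Finset.filter_false_of_mem]
    · intro i _; omega
    · intro i _; omega

/-- Non-descents are the case of a lower bound. For descents, the strict upper bound `p i < a i`
becomes the lower bound `N + 1 - a i ≤ N - p i` after complementing the values, and reversing the
positions restores monotonicity. -/
theorem sum_rearrBlock [Fintype ι] [LinearOrder ι] (t : K) (ε : Kind) (P : Finset ι) (N : ℕ)
    (a p₀ : ι → ℕ)
    (haa : AntitoneOn a P) (hp : ∀ i, p₀ i ≤ N) (ha : ∀ i ∈ P, InBlock ε (a i) (p₀ i)) :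
    ∑ p ∈ rearrBlock ε P N a p₀, t ^ ascents P p =
      ∏ x ∈ Finset.range (N + 1), gaussBinom t (P.filter fun i => Between ε (a i) x (p₀ i)).card
        (P.filter fun i => p₀ i = x).card := by
  cases ε with
  | diamond =>
    have h1 : rearrBlock .diamond P N a p₀ = rearr P N a p₀ := by
      ext p; rw [mem_rearrBlock, mem_rearr]; rfl
    -- The product over `x ≤ N` has one factor more than `sum_rearr`; the factor of the extreme
    -- value (`N` here, `0` for `dagger`) is trivial.
    have h2 : (P.filter fun i => Between .diamond (a i) N (p₀ i)) = P.filter fun i => p₀ i = N := by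
      refine Finset.filter_congr fun i hi => ?_
      have := hp i; have : a i ≤ p₀ i := ha i hi
      simp only [Between]
      omega
    rw [h1, sum_rearr t P N a p₀ haa hp ha, Finset.prod_range_succ, h2, gaussBinom_self, mul_one]
    rfl
  | dagger =>
    have key := @sum_rearr K _ ι _ (reverseOrder ι) t P N (fun i => N + 1 - a i) (fun i => N - p₀ i)
      (fun i hi j hj hij => by
        have : a i ≤ a j := haa hj hi hij
        change N + 1 - a j ≤ N + 1 - a i
        omega)
      (fun i => Nat.sub_le _ _)
      (fun i hi => by
        have : p₀ i < a i := ha _ hi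
        omega)
    have h0 : (P.filter fun i => Between .dagger (a i) 0 (p₀ i)) = P.filter fun i => p₀ i = 0 := by
      refine Finset.filter_congr fun i hi => ?_
      have := hp i; have : p₀ i < a i := ha i hi
      simp only [Between]
      omega
    rw [Finset.prod_range_succ', h0, gaussBinom_self, mul_one, ← Finset.prod_range_reflect]
    refine Eq.trans ?_ (key.trans ?_)
    · refine Finset.sum_nbij' (fun p i => N - p i) (fun p i => N - p i) ?_ ?_ ?_ ?_ ?_
      · intro p hp'
        rw [mem_rearrBlock] at hp'
        obtain ⟨h1, h2, h3, h4⟩ := hp'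
        rw [mem_rearr]
        refine ⟨fun i => Nat.sub_le _ _, fun i hi => by rw [h2 _ hi], fun i hi => ?_,
          card_filter_reverse h1 hp h4⟩
        have : p i < a i := h3 _ hi
        omega
      · intro p hp'
        rw [mem_rearr] at hp'
        obtain ⟨h1, h2, h3, h4⟩ := hp'
        rw [mem_rearrBlock]
        refine ⟨fun i => Nat.sub_le _ _, fun i hi => ?_, fun i hi => ?_, fun x => ?_⟩
        · have := hp i
          rw [h2 i hi]
          omega
        · have := h3 i hi
          have h5 : p₀ i < a i := ha i hi
          change N - p i < a i
          omega
        · rw [card_filter_reverse h1 (fun i => Nat.sub_le _ _) h4]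
          congr 1
          refine Finset.filter_congr fun i _ => ?_
          have := hp i
          omega
      · intro p hp'
        rw [mem_rearrBlock] at hp'
        ext i
        have := hp'.1 i
        beta_reduce
        omega
      · intro p hp'
        rw [mem_rearr] at hp'
        ext i
        have := hp'.1 i
        beta_reduce
        omega
      · intro p hp'
        rw [mem_rearrBlock] at hp'
        rw [ascents_reverseOrder hp'.1]
    · refine Finset.prod_congr rfl fun x hx => ?_
      have hx := Finset.mem_range.1 hx
      congr 2
      · refine Finset.filter_congr fun i hi => ?_
        have := hp i; have h5 : p₀ i < a i := ha i hi
        simp only [Between]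
        omega
      · refine Finset.filter_congr fun i hi => ?_
        have := hp i
        omega

end Gauss

/-! ### Contents and labels -/

section Content

/-- `g` is a rearrangement of `f`. -/
def SameContent {ι β : Type*} (f g : ι → β) : Prop := ∃ w : Equiv.Perm ι, ∀ i, g i = f (w i)

variable {ι β : Type*}

theorem SameContent.refl (f : ι → β) : SameContent f f := ⟨1, fun _ => rfl⟩

theorem SameContent.symm {f g : ι → β} (h : SameContent f g) : SameContent g f := by
  obtain ⟨w, hw⟩ := h
  exact ⟨w⁻¹, fun i => by rw [hw]; simp⟩

theorem SameContent.trans {f g h : ι → β} (h₁ : SameContent f g) (h₂ : SameContent g h) :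
    SameContent f h := by
  obtain ⟨w, hw⟩ := h₁
  obtain ⟨v, hv⟩ := h₂
  exact ⟨w * v, fun i => by rw [hv, hw]; rfl⟩

theorem SameContent.comp {γ : Type*} {f g : ι → β} (h : SameContent f g) (φ : β → γ) :
    SameContent (fun i => φ (f i)) fun i => φ (g i) := by
  obtain ⟨w, hw⟩ := h
  exact ⟨w, fun i => by simp only [hw]⟩

theorem SameContent.sum_eq [Fintype ι] {M : Type*} [AddCommMonoid M] {f g : ι → β}
    (h : SameContent f g) (φ : β → M) : ∑ i, φ (g i) = ∑ i, φ (f i) := by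
  obtain ⟨w, hw⟩ := h
  simp only [hw]
  exact Equiv.sum_comp w fun i => φ (f i)

theorem SameContent.card_eq [Fintype ι] {f g : ι → β} (h : SameContent f g) (P : β → Prop)
    [DecidablePred P] : (Finset.univ.filter fun i => P (g i)).card =
      (Finset.univ.filter fun i => P (f i)).card := by
  rw [Finset.card_filter, Finset.card_filter]
  exact h.sum_eq fun x => if P x then 1 else 0

/-- Equal multiplicities give bijections between the fibres, which are glued to a permutation. -/
theorem sameContent_of_card [Fintype ι] [DecidableEq β] {f g : ι → β}
    (h : ∀ x, (Finset.univ.filter fun i => g i = x).card =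
      (Finset.univ.filter fun i => f i = x).card) : SameContent f g := by
  have e : ∀ x, Nonempty ({i // g i = x} ≃ {i // f i = x}) := fun x => by
    refine Fintype.card_eq.1 ?_
    rw [Fintype.card_subtype, Fintype.card_subtype, h]
  have e := fun x => (e x).some
  exact ⟨Equiv.ofFiberEquiv e, fun i => (Equiv.ofFiberEquiv_map e i).symm⟩

/-- The column in position `i`, with the lower entry forgotten if it is a non-descent (`diamond`),
resp. a descent (`dagger`). -/
def label (ε : Kind) (a p : ι → ℕ) (i : ι) : ℕ × Option ℕ :=
  (a i, if InBlock ε (a i) (p i) then none else some (p i))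

/-- The rows `p` and `p'` below `a` have the same entries and the same columns outside of the
non-descent (`diamond`), resp. descent (`dagger`) block. -/
def SameClass (ε : Kind) (a p p' : ι → ℕ) : Prop :=
  SameContent p p' ∧ SameContent (label ε a p) (label ε a p')

theorem SameClass.symm {ε : Kind} {a p p' : ι → ℕ} (h : SameClass ε a p p') :
    SameClass ε a p' p := ⟨h.1.symm, h.2.symm⟩

theorem SameClass.trans {ε : Kind} {a p p' p'' : ι → ℕ} (h : SameClass ε a p p')
    (h' : SameClass ε a p' p'') : SameClass ε a p p'' := ⟨h.1.trans h'.1, h.2.trans h'.2⟩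

theorem label_eq_iff {ε : Kind} {a p p' : ι → ℕ} {i : ι} :
    label ε a p i = label ε a p' i ↔ (InBlock ε (a i) (p i) ↔ InBlock ε (a i) (p' i)) ∧
      (¬ InBlock ε (a i) (p i) → p i = p' i) := by
  unfold label
  by_cases h1 : InBlock ε (a i) (p i) <;> by_cases h2 : InBlock ε (a i) (p' i) <;> simp [h1, h2]

theorem label_comp {ε : Kind} {a p : ι → ℕ} {w : Equiv.Perm ι} (hw : ∀ i, a (w i) = a i) (i : ι) :
    label ε a (fun j => p (w j)) i = label ε a p (w i) := by
  simp only [label, hw]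

end Content

/-! ### Two consecutive rows -/

section TwoRows

variable {K : Type*} [CommSemiring K] {ι : Type*}

/-- The rank of a lower entry among the lower entries in a neutral block; the entries of the
non-descent (`diamond`), resp. descent (`dagger`) block are identified. -/
def offset : Kind → ℕ → Option ℕ → ℕ
  | .diamond, _, none => 0
  | .diamond, _, some b => b + 1
  | .dagger, N, none => N + 1
  | .dagger, _, some b => b

/-- A numbering of the labels, neutral block by neutral block. -/
def code (ε : Kind) (N : ℕ) (c : ℕ × Option ℕ) : ℕ := c.1 * (N + 2) + offset ε N c.2

theorem offset_lt {ε : Kind} {N : ℕ} {o : Option ℕ} (h : ∀ b ∈ o, b ≤ N) : offset ε N o < N + 2 := by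
  cases o with
  | none => cases ε <;> simp [offset]
  | some b => have := h b rfl; cases ε <;> simp only [offset] <;> omega

theorem offset_inj {ε : Kind} {N : ℕ} {o o' : Option ℕ} (h : ∀ b ∈ o, b ≤ N) (h' : ∀ b ∈ o', b ≤ N)
    (he : offset ε N o = offset ε N o') : o = o' := by
  cases o with
  | none =>
    cases o' with
    | none => rfl
    | some b => have := h' b rfl; cases ε <;> simp only [offset] at he <;> omega
  | some b =>
    have := h b rfl
    cases o' with
    | none => cases ε <;> simp only [offset] at he <;> omega
    | some b' =>
      have := h' b' rfl
      cases ε <;> simp only [offset] at he <;> congr 1; omega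

theorem code_div {ε : Kind} {N : ℕ} {c : ℕ × Option ℕ} (h : ∀ b ∈ c.2, b ≤ N) :
    code ε N c / (N + 2) = c.1 := by
  rw [code, mul_comm, Nat.mul_add_div (by omega), Nat.div_eq_of_lt (offset_lt h), add_zero]

theorem code_inj {ε : Kind} {N : ℕ} {c c' : ℕ × Option ℕ} (h : ∀ b ∈ c.2, b ≤ N)
    (h' : ∀ b ∈ c'.2, b ≤ N) (he : code ε N c = code ε N c') : c = c' := by
  have h1 : c.1 = c'.1 := by rw [← code_div (ε := ε) h, he, code_div h']
  refine Prod.ext h1 (offset_inj (ε := ε) h h' ?_)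
  rw [code, code, h1] at he
  omega

/-- A code is an expansion in base `N + 2` whose leading part is the upper entry, so neutral blocks
occupy disjoint intervals. -/
theorem code_lt_code {ε : Kind} {N : ℕ} {c c' : ℕ × Option ℕ} (h : ∀ b ∈ c.2, b ≤ N)
    (hlt : c.1 < c'.1) : code ε N c < code ε N c' := by
  have := offset_lt (ε := ε) h
  have := Nat.mul_le_mul_right (N + 2) (Nat.succ_le_of_lt hlt)
  rw [Nat.succ_mul] at this
  rw [code, code]
  omega

theorem label_le {ε : Kind} {N : ℕ} {a p : ι → ℕ} {i : ι} (h : p i ≤ N) :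
    ∀ b ∈ (label ε a p i).2, b ≤ N := by
  intro b hb
  unfold label at hb
  split_ifs at hb
  · simp at hb
  · simp at hb; omega

theorem offset_label_diamond (N : ℕ) (a p : ι → ℕ) (i : ι) :
    offset .diamond N (label .diamond a p i).2 = if a i ≤ p i then 0 else p i + 1 := by
  by_cases h : InBlock .diamond (a i) (p i)
  · have h' : a i ≤ p i := h
    simp [label, h, h', offset]
  · have h' : ¬ a i ≤ p i := h
    simp [label, h, h', offset]

theorem offset_label_dagger (N : ℕ) (a p : ι → ℕ) (i : ι) :
    offset .dagger N (label .dagger a p i).2 = if p i < a i then N + 1 else p i := by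
  by_cases h : InBlock .dagger (a i) (p i)
  · have h' : p i < a i := h
    simp [label, h, h', offset]
  · have h' : ¬ p i < a i := h
    simp [label, h, h', offset]

theorem label_fst (ε : Kind) (a p : ι → ℕ) (i : ι) : (label ε a p i).1 = a i := rfl

variable [Fintype ι]

/-- The positions of the non-descents (`diamond`), resp. descents (`dagger`). -/
def blockPos (ε : Kind) (a p : ι → ℕ) : Finset ι := Finset.univ.filter fun i => InBlock ε (a i) (p i)

theorem mem_blockPos {ε : Kind} {a p : ι → ℕ} {i : ι} :
    i ∈ blockPos ε a p ↔ InBlock ε (a i) (p i) := by simp [blockPos]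

open scoped Classical in
/-- The rows with entries at most `N` in the class of `p₀`. -/
def rowClass (ε : Kind) (N : ℕ) (a p₀ : ι → ℕ) : Finset (ι → ℕ) :=
  (Fintype.piFinset fun _ => Finset.range (N + 1)).filter fun p => SameClass ε a p₀ p

theorem mem_rowClass {ε : Kind} {N : ℕ} {a p₀ p : ι → ℕ} (hp₀ : ∀ i, p₀ i ≤ N) :
    p ∈ rowClass ε N a p₀ ↔ SameClass ε a p₀ p := by
  simp only [rowClass, Finset.mem_filter, Fintype.mem_piFinset, Finset.mem_range,
    and_iff_right_iff_imp]
  rintro ⟨⟨w, hw⟩, -⟩ i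
  rw [hw]
  exact Nat.lt_succ_of_le (hp₀ _)

/-- The product of Gaussian binomial coefficients enumerating a class of rows. -/
def classProd (t : K) (ε : Kind) (N : ℕ) (a p₀ : ι → ℕ) : K :=
  (∏ x ∈ Finset.range ((N + 1) * (N + 2)), gaussBinom t
    (Finset.univ.filter fun i => a i * (N + 2) ≤ x ∧ x ≤ code ε N (label ε a p₀ i)).card
    (Finset.univ.filter fun i => code ε N (label ε a p₀ i) = x).card) *
  ∏ x ∈ Finset.range (N + 1), gaussBinom t
    ((blockPos ε a p₀).filter fun i => Between ε (a i) x (p₀ i)).card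
    ((blockPos ε a p₀).filter fun i => p₀ i = x).card

/-- The sums of `a` and of `a ∘ w` agree, so a termwise inequality is an equality. -/
theorem comp_perm_eq_of_le {a : ι → ℕ} {w : Equiv.Perm ι} (h : ∀ i, a i ≤ a (w i)) (i : ι) :
    a (w i) = a i := by
  have := (Finset.sum_eq_sum_iff_of_le (s := Finset.univ) fun i _ => h i).1
    (Equiv.sum_comp w a).symm
  exact (this i (Finset.mem_univ i)).symm

/-- The sequence of codes determines the labels, hence all entries outside the block; what remains
free is the order of the entries inside the block. -/
theorem filter_fiber_eq_rearrBlock {ε : Kind} {N : ℕ} {a p₀ p₁ : ι → ℕ} (hp₀ : ∀ i, p₀ i ≤ N)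
    (h₁ : SameClass ε a p₀ p₁) :
    ((rowClass ε N a p₀).filter fun p => (fun i => code ε N (label ε a p i)) =
      fun i => code ε N (label ε a p₁ i)) = rearrBlock ε (blockPos ε a p₁) N a p₁ := by
  have hp₁ : ∀ i, p₁ i ≤ N := fun i => by
    obtain ⟨⟨w, hw⟩, -⟩ := h₁
    rw [hw]; exact hp₀ _
  classical
  have split : ∀ (f : ι → ℕ) (x : ℕ), (Finset.univ.filter fun i => f i = x).card =
      ((blockPos ε a p₁).filter fun i => f i = x).card +
        ((Finset.univ.filter fun i => i ∉ blockPos ε a p₁).filter fun i => f i = x).card := by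
    intro f x
    rw [← Finset.card_union_of_disjoint, ← Finset.filter_union]
    · congr 2
      ext i
      simp [em]
    · rw [Finset.disjoint_left]
      intro i hi hi'
      simp only [Finset.mem_filter] at hi hi'
      exact hi'.1.2 hi.1
  ext p
  rw [Finset.mem_filter, mem_rowClass hp₀, mem_rearrBlock]
  constructor
  · rintro ⟨hcl, hcode⟩
    have hpN : ∀ i, p i ≤ N := fun i => by
      obtain ⟨⟨w, hw⟩, -⟩ := hcl
      rw [hw]; exact hp₀ _
    have hlab : ∀ i, label ε a p i = label ε a p₁ i := fun i =>
      code_inj (label_le (hpN i)) (label_le (hp₁ i)) (congrFun hcode i)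
    have hoff : ∀ i ∉ blockPos ε a p₁, p i = p₁ i := fun i hi => by
      rw [mem_blockPos] at hi
      have := label_eq_iff.1 (hlab i)
      exact this.2 fun h => hi (this.1.1 h)
    refine ⟨hpN, hoff, fun i hi => ?_, fun x => ?_⟩
    · rw [mem_blockPos] at hi
      exact (label_eq_iff.1 (hlab i)).1.2 hi
    · have h2 := (h₁.symm.trans hcl).1.card_eq fun y => y = x
      rw [split p, split p₁] at h2
      have h3 : ((Finset.univ.filter fun i => i ∉ blockPos ε a p₁).filter fun i => p i = x) =
          (Finset.univ.filter fun i => i ∉ blockPos ε a p₁).filter fun i => p₁ i = x := by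
        refine Finset.filter_congr fun i hi => ?_
        rw [hoff i (Finset.mem_filter.1 hi).2]
      rw [h3] at h2
      omega
  · rintro ⟨hpN, hoff, hin, hcount⟩
    have hlab : label ε a p = label ε a p₁ := by
      ext1 i
      rw [label_eq_iff]
      by_cases hi : i ∈ blockPos ε a p₁
      · have h1 := hin i hi
        exact ⟨⟨fun _ => mem_blockPos.1 hi, fun _ => h1⟩, fun h => absurd h1 h⟩
      · rw [hoff i hi]
        exact ⟨Iff.rfl, fun _ => rfl⟩
    refine ⟨h₁.trans ⟨?_, ?_⟩, by rw [hlab]⟩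
    · refine sameContent_of_card fun x => ?_
      rw [split p, split p₁, hcount]
      congr 2
      refine Finset.filter_congr fun i hi => ?_
      rw [hoff i (Finset.mem_filter.1 hi).2]
    · rw [hlab]
      exact SameContent.refl _

variable [LinearOrder ι]

/-- The number of inversions of a row relative to the canonical row of its class. -/
def excess (ε : Kind) (N : ℕ) (a p : ι → ℕ) : ℕ :=
  ascents Finset.univ (fun i => code ε N (label ε a p i)) + ascents (blockPos ε a p) p

/-- Summing first over the sequences of codes, which are the rearrangements bounded below by `a i *
(N + 2)`, and then over the block rearrangements in each fibre. The inner sum is the same for all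
fibres, so the double sum is a product. -/
theorem sum_rowClass (t : K) (ε : Kind) (N : ℕ) (a p₀ : ι → ℕ) (haa : Antitone a)
    (ha : ∀ i, a i ≤ N) (hp : ∀ i, p₀ i ≤ N) :
    ∑ p ∈ rowClass ε N a p₀, t ^ excess ε N a p = classProd t ε N a p₀ := by
  have hb : ∀ p : ι → ℕ, (∀ i, p i ≤ N) → ∀ i, code ε N (label ε a p i) ≤ (N + 1) * (N + 2) := by
    intro p hp i
    have h1 := offset_lt (ε := ε) (label_le (ε := ε) (a := a) (hp i))
    have h2 := Nat.mul_le_mul_right (N + 2) (ha i)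
    rw [code, label_fst, Nat.add_mul]
    omega
  have hlow : ∀ (p : ι → ℕ) i, a i * (N + 2) ≤ code ε N (label ε a p i) := fun p i => by
    rw [code, label_fst]; omega
  have hmaps : ∀ p ∈ rowClass ε N a p₀, (fun i => code ε N (label ε a p i)) ∈
      rearr Finset.univ ((N + 1) * (N + 2)) (fun i => a i * (N + 2))
        fun i => code ε N (label ε a p₀ i) := by
    intro p hp'
    rw [mem_rowClass hp] at hp'
    rw [mem_rearr]
    refine ⟨hb p fun i => ?_, fun i hi => absurd (Finset.mem_univ i) hi, fun i _ => hlow p i,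
      fun x => (hp'.2.comp (code ε N)).card_eq fun y => y = x⟩
    obtain ⟨⟨w, hw⟩, -⟩ := hp'
    rw [hw]; exact hp _
  rw [← Finset.sum_fiberwise_of_maps_to hmaps, classProd, ← sum_rearr t Finset.univ _ _ _
    (fun i _ j _ hij => Nat.mul_le_mul_right _ (haa hij)) (hb p₀ hp) (fun i _ => hlow p₀ i),
    Finset.sum_mul]
  refine Finset.sum_congr rfl fun β hβ => ?_
  rw [mem_rearr] at hβ
  obtain ⟨-, -, hβ3, hβ4⟩ := hβ
  obtain ⟨w, hw⟩ := sameContent_of_card (g := β) hβ4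
  -- Dividing by `N + 2` recovers the upper entry: the lower bound on the codes keeps every label in
  -- its neutral block.
  have haw : ∀ i, a (w i) = a i := comp_perm_eq_of_le fun i => by
    have h1 := hβ3 i (Finset.mem_univ i)
    rw [hw] at h1
    have h2 := Nat.div_le_div_right (c := N + 2) h1
    rwa [code_div (label_le (hp _)), Nat.mul_div_cancel _ (by omega)] at h2
  have hlab : label ε a (fun j => p₀ (w j)) = fun i => label ε a p₀ (w i) := by
    ext1 i; exact label_comp haw i
  have hβ : β = fun i => code ε N (label ε a (fun j => p₀ (w j)) i) := by
    ext1 i; rw [hw, hlab]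
  have hcl : SameClass ε a p₀ fun j => p₀ (w j) :=
    ⟨⟨w, fun _ => rfl⟩, by rw [hlab]; exact ⟨w, fun _ => rfl⟩⟩
  have hpos : ∀ i, i ∈ blockPos ε a (fun j => p₀ (w j)) ↔ w i ∈ blockPos ε a p₀ := fun i => by
    rw [mem_blockPos, mem_blockPos, haw]
  have hprod := sum_rearrBlock t ε (blockPos ε a fun j => p₀ (w j)) N a (fun j => p₀ (w j))
    (fun i _ j _ hij => haa hij) (fun i => hp _) (fun i hi => mem_blockPos.1 hi)
  -- The factors of the inner sum count columns of a given shape, and `w` permutes the columns;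
  -- hence they do not depend on the fibre.
  have hcard : ∀ Q : ℕ → ℕ → Prop, ∀ [∀ x y, Decidable (Q x y)],
      ((blockPos ε a fun j => p₀ (w j)).filter fun i => Q (a i) (p₀ (w i))).card =
      ((blockPos ε a p₀).filter fun i => Q (a i) (p₀ i)).card := by
    intro Q _
    refine Finset.card_nbij' w w.symm ?_ ?_ (fun i _ => by simp) fun i _ => by simp
    · intro i hi
      rw [Finset.mem_coe, Finset.mem_filter] at hi ⊢
      rw [haw]
      exact ⟨(hpos i).1 hi.1, hi.2⟩
    · intro i hi
      rw [Finset.mem_coe, Finset.mem_filter] at hi ⊢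
      rw [hpos, ← haw]
      simpa using hi
  have hfib := filter_fiber_eq_rearrBlock (N := N) hp hcl
  rw [← hβ] at hfib
  rw [hfib]
  have hgoal : ∏ x ∈ Finset.range (N + 1), gaussBinom t
      ((blockPos ε a p₀).filter fun i => Between ε (a i) x (p₀ i)).card
      ((blockPos ε a p₀).filter fun i => p₀ i = x).card =
      ∑ p ∈ rearrBlock ε (blockPos ε a fun j => p₀ (w j)) N a (fun j => p₀ (w j)),
        t ^ ascents (blockPos ε a fun j => p₀ (w j)) p := by
    rw [hprod]
    refine Finset.prod_congr rfl fun x _ => ?_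
    rw [hcard fun y z => Between ε y x z, hcard fun _ z => z = x]
  rw [hgoal, Finset.mul_sum]
  refine Finset.sum_congr rfl fun p hp' => ?_
  have hp'' := hp'
  rw [← hfib, Finset.mem_filter] at hp''
  rw [mem_rearrBlock] at hp'
  rw [excess, hp''.2, pow_add]
  have : blockPos ε a p = blockPos ε a fun j => p₀ (w j) := by
    ext i
    by_cases hi : i ∈ blockPos ε a fun j => p₀ (w j)
    · simp only [hi, iff_true]
      exact mem_blockPos.2 (hp'.2.2.1 i hi)
    · have h2 := hp'.2.1 i hi
      rw [mem_blockPos, h2, ← mem_blockPos (p := fun j => p₀ (w j))]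
  rw [this]

/-- A row `p` below `a` is (dual) canonical. -/
def CanonPair (ε : Kind) (a p : ι → ℕ) : Prop :=
  ∀ i j : ι, i < j →
    (a i = a j → (p i < a i ∧ p j ≤ p i) ∨ (p i < a i ∧ a i ≤ p j) ∨ (a i ≤ p j ∧ p j ≤ p i)) ∧
    (InBlock ε (a i) (p i) → InBlock ε (a j) (p j) →
      (a j ≤ a i → p j ≤ p i) ∧ (a i < a j → p i ≤ p j))

/-- Codes of different neutral blocks never ascend below a weakly decreasing row. Inside a neutral
block, `offset` places the descents before the non-descents for both kinds and orders the columns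
outside the block `blockPos`; the ascents in `blockPos` take care of the remaining ones. -/
theorem excess_eq_zero_iff {ε : Kind} {N : ℕ} {a p : ι → ℕ} (haa : Antitone a)
    (hp : ∀ i, p i ≤ N) : excess ε N a p = 0 ↔ CanonPair ε a p := by
  rw [excess, Nat.add_eq_zero_iff, ascents_eq_zero_iff, ascents_eq_zero_iff]
  constructor
  · rintro ⟨h1, h2⟩ i j hij
    have h3 := h1 i (Finset.mem_univ _) j (Finset.mem_univ _) hij
    have h4 : InBlock ε (a i) (p i) → InBlock ε (a j) (p j) → p j ≤ p i := fun hi hj =>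
      h2 i (mem_blockPos.2 hi) j (mem_blockPos.2 hj) hij
    have h5 := haa hij.le
    refine ⟨fun ha => ?_, fun hi hj => ⟨fun _ => h4 hi hj, fun h => by omega⟩⟩
    have := hp i; have := hp j
    rw [code, code, label_fst, label_fst, ha] at h3
    have h3 := Nat.add_le_add_iff_left.1 h3
    cases ε
    · rw [offset_label_diamond, offset_label_diamond] at h3
      simp only [InBlock] at h4
      split_ifs at h3 <;> omega
    · rw [offset_label_dagger, offset_label_dagger] at h3
      simp only [InBlock] at h4
      split_ifs at h3 <;> omega
  · intro h
    refine ⟨fun i _ j _ hij => ?_, fun i hi j hj hij => ?_⟩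
    · have h5 := haa hij.le
      rcases h5.eq_or_lt with h6 | h6
      · obtain ⟨h1, h2⟩ := h i j hij
        have h1 := h1 h6.symm
        have := hp i; have := hp j
        rw [code, code, label_fst, label_fst, h6]
        refine Nat.add_le_add_left ?_ _
        cases ε
        · rw [offset_label_diamond, offset_label_diamond]
          split_ifs <;> omega
        · rw [offset_label_dagger, offset_label_dagger]
          split_ifs <;> omega
      · exact (code_lt_code (c := label ε a p j) (c' := label ε a p i) (label_le (hp j)) h6).le
    · exact ((h i j hij).2 (mem_blockPos.1 hi) (mem_blockPos.1 hj)).1 (haa hij.le)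

theorem card_filter_mono {ι : Type*} {P : Finset ι} {q r : ι → Prop} [DecidablePred q] [DecidablePred r]
    (h : ∀ i ∈ P, q i → r i) : (P.filter q).card ≤ (P.filter r).card :=
  Finset.card_le_card fun i hi => by
    rw [Finset.mem_filter] at hi ⊢
    exact ⟨hi.1, h i hi.1 hi.2⟩

/-- In each binomial the lower number counts a subset of what the upper one counts, so its value at
`t = 0` is `1`. -/
theorem classProd_zero {ι : Type*} [Fintype ι] (ε : Kind) (N : ℕ) (a p₀ : ι → ℕ) : classProd (0 : ℕ) ε N a p₀ = 1 := by
  rw [classProd, Finset.prod_eq_one, Finset.prod_eq_one, mul_one]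
  · intro x _
    refine gaussBinom_zero_of_le (card_filter_mono fun i hi h => ?_)
    have := mem_blockPos.1 hi
    rw [← h]
    cases ε
    · exact ⟨this, le_rfl⟩
    · exact ⟨le_rfl, this⟩
  · intro x _
    refine gaussBinom_zero_of_le (card_filter_mono fun i _ h => ?_)
    rw [← h, code, label_fst]
    exact ⟨by omega, le_rfl⟩

/-- Each class of rows below a weakly decreasing row contains exactly one canonical row. -/
theorem existsUnique_canonPair_of_antitone (ε : Kind) {a : ι → ℕ} (haa : Antitone a) (p₀ : ι → ℕ) :
    ∃! p, SameClass ε a p₀ p ∧ CanonPair ε a p := by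
  obtain ⟨N, hN⟩ : ∃ N, ∀ i, a i ≤ N ∧ p₀ i ≤ N :=
    ⟨Finset.univ.sup fun i => a i + p₀ i, fun i => by
      have := Finset.le_sup (f := fun i => a i + p₀ i) (Finset.mem_univ i)
      beta_reduce at this
      omega⟩
  -- At `t = 0` in `ℕ` the left side is the number of rows of excess zero and the right side is `1`.
  have h := sum_rowClass (0 : ℕ) ε N a p₀ haa (fun i => (hN i).1) fun i => (hN i).2
  rw [classProd_zero] at h
  simp only [zero_pow_eq] at h
  rw [← Finset.card_filter, Finset.card_eq_one] at h
  obtain ⟨p, hp⟩ := h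
  have key : ∀ q, q = p ↔ SameClass ε a p₀ q ∧ CanonPair ε a q := fun q => by
    rw [← Finset.mem_singleton, ← hp, Finset.mem_filter, mem_rowClass fun i => (hN i).2]
    refine and_congr_right fun hq => excess_eq_zero_iff haa fun i => ?_
    obtain ⟨⟨w, hw⟩, -⟩ := hq
    rw [hw]; exact (hN _).2
  exact ⟨p, (key p).1 rfl, fun q hq => (key q).2 hq⟩

end TwoRows

/-! ### Quadruple statistics of two consecutive rows -/

section Quadruples

open scoped Classical in
/-- The indicator of a proposition. -/
def ind (P : Prop) : ℤ := if P then 1 else 0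

theorem ind_pos {P : Prop} (h : P) : ind P = 1 := if_pos h

theorem ind_neg {P : Prop} (h : ¬ P) : ind P = 0 := if_neg h

theorem ind_congr {P Q : Prop} (h : P ↔ Q) : ind P = ind Q := by rw [propext h]

open scoped Classical in
/-- The number of pairs of columns forming an `S`-quadruple. -/
def pairInv {ι : Type*} [Fintype ι] [LinearOrder ι] (S : ℕ → ℕ → ℕ → ℕ → Prop) (a p : ι → ℕ) : ℕ :=
  (Finset.univ.filter fun x : ι × ι => x.1 < x.2 ∧ S (a x.1) (a x.2) (p x.1) (p x.2)).card

/-- The additional orderings in a quadruple set. -/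
def ExtraOrder (S : ℕ → ℕ → ℕ → ℕ → Prop) : Kind → Prop
  | .diamond => ∀ z w u v : ℕ, w < z → z ≤ u → u < v → S z w u v
  | .dagger => ∀ z w u v : ℕ, u < v → v < w → w < z → S z w u v

namespace IsQuinvQuadrupleSet

variable {S : ℕ → ℕ → ℕ → ℕ → Prop}

theorem not_self (hS : IsQuinvQuadrupleSet S) (z w u : ℕ) : ¬ S z w u u := fun h => hS.ne _ _ _ _ h rfl

theorem not_of_flip (hS : IsQuinvQuadrupleSet S) {z w u v : ℕ} (h : S z w v u) : ¬ S z w u v := by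
  rcases hS.exactlyOne z w u v (hS.ne _ _ _ _ h).symm with ⟨_, h'⟩ | ⟨_, h'⟩
  · exact absurd h h'
  · exact h'

theorem of_not_flip (hS : IsQuinvQuadrupleSet S) {z w u v : ℕ} (huv : u ≠ v) (h : ¬ S z w v u) : S z w u v := by
  rcases hS.exactlyOne z w u v huv with ⟨hs, _⟩ | ⟨hs, _⟩
  · exact hs
  · exact absurd hs h

/-- The first of the two orderings which belong to the set both or not at all. -/
theorem middle_iff (hS : IsQuinvQuadrupleSet S) {z w u v : ℕ} (h1 : w ≤ v) (h2 : v < u) (h3 : u < z) :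
    S z w u v ↔ ∀ z w u v : ℕ, w ≤ v → v < u → u < z → S z w u v := by
  refine ⟨fun h z' w' u' v' h1' h2' h3' => ?_, fun h => h _ _ _ _ h1 h2 h3⟩
  refine (hS.pattern z w u v z' w' u' v' ?_ ?_ ?_ ?_ ?_ ?_ ?_ ?_).1 h <;> omega

/-- The second of the two orderings which belong to the set both or not at all. -/
theorem outer_iff (hS : IsQuinvQuadrupleSet S) {z w u v : ℕ} (h1 : u < w) (h2 : w < z) (h3 : z ≤ v) :
    S z w u v ↔ ∀ z w u v : ℕ, w ≤ v → v < u → u < z → S z w u v := by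
  rw [hS.bothOrNeither]
  refine ⟨fun h z' w' u' v' h1' h2' h3' => ?_, fun h => h _ _ _ _ h1 h2 h3⟩
  refine (hS.pattern z w u v z' w' u' v' ?_ ?_ ?_ ?_ ?_ ?_ ?_ ?_).1 h <;> omega

/-- The value of a descent column `(z, u)` to the left of a non-descent column `(w, v)`. -/
theorem descent_nonDescent (hS : IsQuinvQuadrupleSet S) {z w u v : ℕ} (hwz : w < z) (hu : u < z) (hv : w ≤ v) :
    ((∀ z w u v : ℕ, w ≤ v → v < u → u < z → S z w u v) →
      ind (S z w u v) = ind (u < w) - ind (z ≤ w) + ind (v < u)) ∧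
    (¬ (∀ z w u v : ℕ, w ≤ v → v < u → u < z → S z w u v) →
      ind (S z w u v) = 1 + ind (z < w) - ind (z ≤ v) - ind (v ≤ u)) := by
  -- The orderings of axiom (4) are the only undetermined ones; each of the two choices has its own
  -- formula, a sum of terms that involve only three of the four entries.
  rcases lt_or_ge v z with h1 | h1
  · rcases lt_or_ge u w with h2 | h2
    · have h := hS.mandatory₁ z w u v h2 hv h1
      rw [ind_pos h, ind_pos h2, ind_neg (show ¬ z ≤ w by omega), ind_neg (show ¬ v < u by omega),
        ind_neg (show ¬ z < w by omega), ind_neg (show ¬ z ≤ v by omega),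
        ind_neg (show ¬ v ≤ u by omega)]
      constructor <;> intro _ <;> rfl
    · rw [ind_neg (show ¬ u < w by omega), ind_neg (show ¬ z ≤ w by omega),
        ind_neg (show ¬ z < w by omega), ind_neg (show ¬ z ≤ v by omega)]
      rcases lt_trichotomy u v with h3 | rfl | h3
      · have h := hS.middle_iff h2 h3 h1
        rw [ind_neg (show ¬ v < u by omega), ind_neg (show ¬ v ≤ u by omega)]
        constructor
        · intro hB
          rw [ind_neg (hS.not_of_flip (h.2 hB))]; rfl
        · intro hB
          rw [ind_pos (hS.of_not_flip (by omega) fun h' => hB (h.1 h'))]; rfl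
      · rw [ind_neg (hS.not_self z w u), ind_neg (lt_irrefl u), ind_pos le_rfl]
        constructor <;> intro _ <;> rfl
      · have h := hS.middle_iff hv h3 hu
        rw [ind_pos h3, ind_pos h3.le]
        constructor
        · intro hB
          rw [ind_pos (h.2 hB)]; rfl
        · intro hB
          rw [ind_neg fun h' => hB (h.1 h')]; rfl
  · rw [ind_neg (show ¬ z ≤ w by omega), ind_neg (show ¬ z < w by omega), ind_pos h1,
      ind_neg (show ¬ v < u by omega), ind_neg (show ¬ v ≤ u by omega)]
    rcases lt_or_ge u w with h2 | h2
    · have h := hS.outer_iff h2 hwz h1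
      rw [ind_pos h2]
      constructor
      · intro hB
        rw [ind_pos (h.2 hB)]; rfl
      · intro hB
        rw [ind_neg fun h' => hB (h.1 h')]; rfl
    · rw [ind_neg (hS.not_of_flip (hS.mandatory₂ z w v u h2 hu h1)), ind_neg (show ¬ u < w by omega)]
      constructor <;> intro _ <;> rfl

/-- The value of a non-descent column `(z, u)` to the left of a descent column `(w, v)`. -/
theorem nonDescent_descent (hS : IsQuinvQuadrupleSet S) {z w u v : ℕ} (hwz : w < z) (hu : z ≤ u) (hv : v < w) :
    ((∀ z w u v : ℕ, w ≤ v → v < u → u < z → S z w u v) →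
      ind (S z w u v) = ind (v < z) - ind (w ≤ z) + ind (u < v)) ∧
    (¬ (∀ z w u v : ℕ, w ≤ v → v < u → u < z → S z w u v) →
      ind (S z w u v) = 1 + ind (w < z) - ind (w ≤ u) - ind (u ≤ v)) := by
  have h := hS.outer_iff hv hwz hu
  rw [ind_pos (show v < z by omega), ind_pos hwz.le, ind_neg (show ¬ u < v by omega), ind_pos hwz,
    ind_pos (show w ≤ u by omega), ind_neg (show ¬ u ≤ v by omega)]
  constructor
  · intro hB
    rw [ind_neg (hS.not_of_flip (h.2 hB))]; rfl
  · intro hB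
    rw [ind_pos (hS.of_not_flip (by omega) fun h' => hB (h.1 h'))]; rfl

theorem diag_of_le (hS : IsQuinvQuadrupleSet S) {z u v : ℕ} (h : (u < z ∧ v < z) ∨ (z ≤ u ∧ z ≤ v)) :
    ind (S z z u v) = ind (u < v) := by
  refine ind_congr ?_
  rw [hS.diag, IsInvTriple]
  omega

theorem diag_descent (hS : IsQuinvQuadrupleSet S) {z u v : ℕ} (hu : u < z) (hv : z ≤ v) : ind (S z z u v) = 0 := by
  refine ind_neg ?_
  rw [hS.diag, IsInvTriple]
  omega

theorem diag_nonDescent (hS : IsQuinvQuadrupleSet S) {z u v : ℕ} (hu : z ≤ u) (hv : v < z) : ind (S z z u v) = 1 := by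
  refine ind_pos ?_
  rw [hS.diag, IsInvTriple]
  omega

/-- If both lower entries may stand below `z`, the extra ordering makes their order decide. If `v <
z`, membership is forced by the second mandatory ordering; the correction involves one upper and one
lower entry only, as a potential requires. -/
theorem nonDescent_nonDescent (hS : IsQuinvQuadrupleSet S) (hE : ExtraOrder S .diamond) {z w u v : ℕ} (hwz : w < z)
    (hu : z ≤ u) (hv : w ≤ v) : ind (S z w u v) = ind (u < v) + ind (v < z) := by
  rcases lt_or_ge v z with h1 | h1
  · rw [ind_pos (hS.mandatory₂ z w u v hv h1 hu), ind_neg (show ¬ u < v by omega), ind_pos h1]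
    rfl
  · rw [ind_neg (show ¬ v < z by omega), add_zero]
    refine ind_congr ⟨fun h => ?_, fun h => hE z w u v hwz hu h⟩
    by_contra hlt
    rcases (not_lt.1 hlt).eq_or_lt with rfl | h2
    · exact hS.not_self _ _ _ h
    · exact hS.not_of_flip (hE z w v u hwz h1 h2) h

/-- The extra ordering decides if both lower entries are smaller than `w`, and the first mandatory
ordering if `u ≥ w`; no correction term is left. -/
theorem descent_descent (hS : IsQuinvQuadrupleSet S) (hE : ExtraOrder S .dagger) {z w u v : ℕ} (hwz : w < z)
    (hu : u < z) (hv : v < w) : ind (S z w u v) = ind (u < v) := by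
  refine ind_congr ⟨fun h => ?_, fun h => hE z w u v h hv hwz⟩
  by_contra hlt
  rcases (not_lt.1 hlt).eq_or_lt with rfl | h2
  · exact hS.not_self _ _ _ h
  · rcases lt_or_ge u w with h3 | h3
    · exact hS.not_of_flip (hE z w v u h2 h3 hwz) h
    · exact hS.not_of_flip (hS.mandatory₁ z w v u hv h3 hu) h

end IsQuinvQuadrupleSet

/-- The label of the column with upper entry `z` and lower entry `u`. -/
def colLabel (ε : Kind) (z u : ℕ) : ℕ × Option ℕ := (z, if InBlock ε z u then none else some u)

theorem colLabel_pos {ε : Kind} {z u : ℕ} (h : InBlock ε z u) : colLabel ε z u = (z, none) := by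
  rw [colLabel, if_pos h]

theorem colLabel_neg {ε : Kind} {z u : ℕ} (h : ¬ InBlock ε z u) : colLabel ε z u = (z, some u) := by
  rw [colLabel, if_neg h]

/-- The contribution of a pair of columns to the statistic is, up to the inversions counted by
`excess`, a sum of terms depending on two labels or on a label and an entry. -/
def HasPotential (ε : Kind) (N : ℕ) (S : ℕ → ℕ → ℕ → ℕ → Prop) : Prop :=
  ∃ (Φ : ℕ × Option ℕ → ℕ × Option ℕ → ℤ) (Ψ : ℕ × Option ℕ → ℕ → ℤ),
    (∀ z u w v, Φ (colLabel ε z u) (colLabel ε w v) = Φ (colLabel ε w v) (colLabel ε z u)) ∧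
    (∀ z u, Φ (colLabel ε z u) (colLabel ε z u) + 2 * Ψ (colLabel ε z u) u = 0) ∧
    ∀ z w u v, w ≤ z → u ≤ N → v ≤ N → ind (S z w u v) =
      ind (code ε N (colLabel ε z u) < code ε N (colLabel ε w v)) +
      ind (InBlock ε z u ∧ InBlock ε w v ∧ u < v) + Φ (colLabel ε z u) (colLabel ε w v) +
      Ψ (colLabel ε z u) v + Ψ (colLabel ε w v) u

/-- Only the lower entry of a block column is missing from its label. So pairs of non-block columns
need no formula, and it suffices to treat pairs with one or two block columns: `g` is the correction
for two, `m₁ + m₂` the contribution of a mixed pair. -/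
theorem hasPotential_of {ε : Kind} {N : ℕ} {S : ℕ → ℕ → ℕ → ℕ → Prop} (hS : IsQuinvQuadrupleSet S)
    (m₁ m₂ : ℕ → ℕ → ℕ → ℤ) (g : ℕ → ℕ → ℤ)
    (hg : ∀ z u, InBlock ε z u → g z u = 0)
    (hin : ∀ z w u v, w ≤ z → InBlock ε z u → InBlock ε w v →
      ind (S z w u v) = ind (u < v) + g z v + g w u)
    (hout : ∀ z w u v, w ≤ z → u ≤ N → ¬ InBlock ε z u → InBlock ε w v →
      ind (S z w u v) = ind (z = w ∧ offset ε N (some u) < offset ε N none) + m₁ z u w + m₂ z u v)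
    (hout' : ∀ z w u v, w ≤ z → v ≤ N → InBlock ε z u → ¬ InBlock ε w v →
      ind (S z w u v) = ind (z = w ∧ offset ε N none < offset ε N (some v)) + m₁ w v z + m₂ w v u) :
    HasPotential ε N S := by
  have hcode : ∀ z w o o', w ≤ z → (∀ b ∈ o', b ≤ N) →
      ind (code ε N (z, o) < code ε N (w, o')) = ind (z = w ∧ offset ε N o < offset ε N o') := by
    intro z w o o' hwz ho
    refine ind_congr ?_
    rcases hwz.eq_or_lt with rfl | h
    · simp [code]
    · have := code_lt_code (ε := ε) (N := N) (c := (w, o')) (c' := (z, o)) ho h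
      constructor
      · intro h'; omega
      · rintro ⟨rfl, _⟩; omega
  -- `Ψ` is `g` or `m₂` and is added for every pair; `Φ` removes it where it is not wanted. The
  -- terms with `z = w` are left out of the last case because the comparison of codes accounts for
  -- them.
  refine ⟨fun L L' => match L, L' with
      | (_, none), (_, none) => 0
      | (z, some u), (w, none) => m₁ z u w - g w u
      | (w, none), (z, some u) => m₁ z u w - g w u
      | (z, some u), (w, some v) => ind (z ≠ w ∧ S z w u v) - m₂ z u v - m₂ w v u,
    fun L p => match L with
      | (z, none) => g z p
      | (z, some u) => m₂ z u p, ?_, ?_, ?_⟩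
  · intro z u w v
    by_cases h1 : InBlock ε z u <;> by_cases h2 : InBlock ε w v <;>
      simp only [colLabel, h1, h2, if_true, if_false]
    have : ind (z ≠ w ∧ S z w u v) = ind (w ≠ z ∧ S w z v u) := ind_congr
      ⟨fun h => ⟨h.1.symm, (hS.swap _ _ _ _ h.1).1 h.2⟩,
        fun h => ⟨h.1.symm, (hS.swap _ _ _ _ h.1).1 h.2⟩⟩
    rw [this]; ring
  · intro z u
    by_cases h1 : InBlock ε z u <;> simp only [colLabel, h1, if_true, if_false]
    · rw [hg z u h1]; rfl
    · rw [ind_neg (by simp)]; ring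
  · intro z w u v hwz hu hv
    by_cases h1 : InBlock ε z u <;> by_cases h2 : InBlock ε w v
    · rw [colLabel_pos h1, colLabel_pos h2, hcode _ _ _ _ hwz (by simp),
        ind_neg (P := z = w ∧ _) (fun h => lt_irrefl _ h.2), hin z w u v hwz h1 h2,
        ind_congr (show (InBlock ε z u ∧ InBlock ε w v ∧ u < v) ↔ u < v from
          ⟨fun h => h.2.2, fun h => ⟨h1, h2, h⟩⟩)]
      ring
    · rw [colLabel_pos h1, colLabel_neg h2, hcode _ _ _ _ hwz (by simpa using hv),
        ind_neg (P := InBlock ε z u ∧ InBlock ε w v ∧ u < v) (fun h => h2 h.2.1),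
        hout' z w u v hwz hv h1 h2]
      ring
    · rw [colLabel_neg h1, colLabel_pos h2, hcode _ _ _ _ hwz (by simp),
        ind_neg (P := InBlock ε z u ∧ InBlock ε w v ∧ u < v) (fun h => h1 h.1),
        hout z w u v hwz hu h1 h2]
      ring
    · rw [colLabel_neg h1, colLabel_neg h2, hcode _ _ _ _ hwz (by simpa using hv),
        ind_neg (P := InBlock ε z u ∧ InBlock ε w v ∧ u < v) (fun h => h1 h.1)]
      dsimp only
      rcases hwz.eq_or_lt with rfl | h
      · rw [ind_neg (P := w ≠ w ∧ S w w u v) (fun h => h.1 rfl), hS.diag_of_le,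
          ind_congr (show (w = w ∧ offset ε N (some u) < offset ε N (some v)) ↔ u < v from ?_)]
        · ring
        · cases ε <;> simp [offset]
        · cases ε <;> simp only [InBlock] at h1 h2 <;> omega
      · rw [ind_neg (P := z = w ∧ offset ε N (some u) < offset ε N (some v)) (fun h' => by omega),
          ind_congr (show (z ≠ w ∧ S z w u v) ↔ S z w u v from
            ⟨fun h => h.2, fun h' => ⟨by omega, h'⟩⟩)]
        ring

/-- There are four cases: the kind, and whether the two orderings of axiom (4) belong to `S`. The
functions `m₁`, `m₂` are read off from `descent_nonDescent` and `nonDescent_descent`; their values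
at equal upper entries match `diag` and the comparison of codes. -/
theorem IsQuinvQuadrupleSet.hasPotential {S : ℕ → ℕ → ℕ → ℕ → Prop} (hS : IsQuinvQuadrupleSet S)
    {ε : Kind} (hE : ExtraOrder S ε) (N : ℕ) : HasPotential ε N S := by
  by_cases hB : ∀ z w u v : ℕ, w ≤ v → v < u → u < z → S z w u v
  · cases ε with
    | diamond =>
      refine hasPotential_of hS (fun z u w => ind (u < w) - ind (z ≤ w)) (fun z u v => ind (v < u))
        (fun z v => ind (v < z)) ?_ ?_ ?_ ?_
      · intro z u h
        exact ind_neg (not_lt.2 h)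
      · intro z w u v hwz h1 h2
        simp only [InBlock] at h1 h2
        rw [ind_neg (P := u < w) (by omega), add_zero]
        rcases hwz.eq_or_lt with rfl | h
        · rw [hS.diag_of_le (Or.inr ⟨h1, h2⟩), ind_neg (P := v < w) (by omega), add_zero]
        · exact hS.nonDescent_nonDescent hE h h1 h2
      · intro z w u v hwz _ h1 h2
        simp only [InBlock, not_le] at h1 h2
        rw [ind_neg (P := z = w ∧ _) (by simp [offset]), zero_add]
        rcases hwz.eq_or_lt with rfl | h
        · rw [hS.diag_descent h1 h2, ind_pos h1, ind_pos le_rfl, ind_neg (by omega)]; rfl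
        · exact (hS.descent_nonDescent h h1 h2).1 hB
      · intro z w u v hwz _ h1 h2
        simp only [InBlock, not_le] at h1 h2
        rcases hwz.eq_or_lt with rfl | h
        · rw [hS.diag_nonDescent h1 h2, ind_pos (by simp [offset]), ind_pos h2, ind_pos le_rfl,
            ind_neg (by omega)]
          rfl
        · rw [ind_neg (P := z = w ∧ _) (fun h' => by omega), zero_add]
          exact (hS.nonDescent_descent h h1 h2).1 hB
    | dagger =>
      refine hasPotential_of hS (fun w v z => - ind (z ≤ w)) (fun w v u => ind (u < w) + ind (v < u))
        (fun _ _ => 0) (fun _ _ _ => rfl) ?_ ?_ ?_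
      · intro z w u v hwz h1 h2
        simp only [InBlock] at h1 h2
        rw [add_zero, add_zero]
        rcases hwz.eq_or_lt with rfl | h
        · exact hS.diag_of_le (Or.inl ⟨h1, h2⟩)
        · exact hS.descent_descent hE h h1 h2
      · intro z w u v hwz hu h1 h2
        simp only [InBlock, not_lt] at h1 h2
        rcases hwz.eq_or_lt with rfl | h
        · rw [hS.diag_nonDescent h1 h2, ind_pos ⟨rfl, by simp only [offset]; omega⟩, ind_pos h2,
            ind_pos le_rfl, ind_neg (by omega)]
          rfl
        · rw [ind_neg (P := z = w ∧ _) (fun h' => by omega), (hS.nonDescent_descent h h1 h2).1 hB]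
          ring
      · intro z w u v hwz hv h1 h2
        simp only [InBlock, not_lt] at h1 h2
        rw [ind_neg (P := z = w ∧ _) (fun h' => by have := h'.2; simp only [offset] at this; omega)]
        rcases hwz.eq_or_lt with rfl | h
        · rw [hS.diag_descent h1 h2, ind_pos h1, ind_pos le_rfl, ind_neg (by omega)]; rfl
        · rw [(hS.descent_nonDescent h h1 h2).1 hB]
          ring
  · cases ε with
    | diamond =>
      refine hasPotential_of hS (fun z u w => 1 + ind (z < w))
        (fun z u v => - ind (z ≤ v) - ind (v ≤ u)) (fun z v => ind (v < z)) ?_ ?_ ?_ ?_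
      · intro z u h
        exact ind_neg (not_lt.2 h)
      · intro z w u v hwz h1 h2
        simp only [InBlock] at h1 h2
        rw [ind_neg (P := u < w) (by omega), add_zero]
        rcases hwz.eq_or_lt with rfl | h
        · rw [hS.diag_of_le (Or.inr ⟨h1, h2⟩), ind_neg (P := v < w) (by omega), add_zero]
        · exact hS.nonDescent_nonDescent hE h h1 h2
      · intro z w u v hwz _ h1 h2
        simp only [InBlock, not_le] at h1 h2
        rw [ind_neg (P := z = w ∧ _) (by simp [offset]), zero_add]
        rcases hwz.eq_or_lt with rfl | h
        · rw [hS.diag_descent h1 h2, ind_neg (lt_irrefl w), ind_pos h2, ind_neg (by omega)]; rfl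
        · rw [(hS.descent_nonDescent h h1 h2).2 hB]
          ring
      · intro z w u v hwz _ h1 h2
        simp only [InBlock, not_le] at h1 h2
        rcases hwz.eq_or_lt with rfl | h
        · rw [hS.diag_nonDescent h1 h2, ind_pos (by simp [offset]), ind_neg (lt_irrefl w),
            ind_pos h1, ind_neg (by omega)]
          rfl
        · rw [ind_neg (P := z = w ∧ _) (fun h' => by omega), (hS.nonDescent_descent h h1 h2).2 hB]
          ring
    | dagger =>
      refine hasPotential_of hS (fun w v z => 1 + ind (z < w) - ind (z ≤ v))
        (fun w v u => - ind (v ≤ u)) (fun _ _ => 0) (fun _ _ _ => rfl) ?_ ?_ ?_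
      · intro z w u v hwz h1 h2
        simp only [InBlock] at h1 h2
        rw [add_zero, add_zero]
        rcases hwz.eq_or_lt with rfl | h
        · exact hS.diag_of_le (Or.inl ⟨h1, h2⟩)
        · exact hS.descent_descent hE h h1 h2
      · intro z w u v hwz hu h1 h2
        simp only [InBlock, not_lt] at h1 h2
        rcases hwz.eq_or_lt with rfl | h
        · rw [hS.diag_nonDescent h1 h2, ind_pos ⟨rfl, by simp only [offset]; omega⟩,
            ind_neg (lt_irrefl w), ind_pos h1, ind_neg (by omega)]
          rfl
        · rw [ind_neg (P := z = w ∧ _) (fun h' => by omega), (hS.nonDescent_descent h h1 h2).2 hB]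
          ring
      · intro z w u v hwz hv h1 h2
        simp only [InBlock, not_lt] at h1 h2
        rw [ind_neg (P := z = w ∧ _) (fun h' => by have := h'.2; simp only [offset] at this; omega)]
        rcases hwz.eq_or_lt with rfl | h
        · rw [hS.diag_descent h1 h2, ind_neg (lt_irrefl w), ind_pos h2, ind_neg (by omega)]; rfl
        · rw [(hS.descent_nonDescent h h1 h2).2 hB]
          ring

variable {ι : Type*} [Fintype ι] [LinearOrder ι]

/-- A symmetric function on pairs summed over the increasing pairs. -/
theorem two_mul_sum_lt (f : ι → ι → ℤ) (hsymm : ∀ i j, f i j = f j i) (hdiag : ∀ i, f i i = 0) :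
    2 * ∑ i, ∑ j, (if i < j then f i j else 0) = ∑ i, ∑ j, f i j := by
  have h1 : ∑ i, ∑ j, (if i < j then f i j else 0) = ∑ i, ∑ j, (if j < i then f i j else 0) := by
    rw [Finset.sum_comm]
    refine Finset.sum_congr rfl fun i _ => Finset.sum_congr rfl fun j _ => ?_
    rw [hsymm]
  have h2 : ∑ i, ∑ j, f i j =
      ∑ i, ∑ j, (if i < j then f i j else 0) + ∑ i, ∑ j, (if j < i then f i j else 0) := by
    rw [← Finset.sum_add_distrib]
    refine Finset.sum_congr rfl fun i _ => ?_
    rw [← Finset.sum_add_distrib]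
    refine Finset.sum_congr rfl fun j _ => ?_
    rcases lt_trichotomy i j with h | rfl | h
    · rw [if_pos h, if_neg (not_lt.2 h.le), add_zero]
    · simp [hdiag]
    · rw [if_neg (not_lt.2 h.le), if_pos h, zero_add]
  rw [h2, ← h1]; ring

theorem card_filter_lt (Q : ι → ι → Prop)
    [DecidablePred fun x : ι × ι => x.1 < x.2 ∧ Q x.1 x.2] :
    (((Finset.univ.filter fun x : ι × ι => x.1 < x.2 ∧ Q x.1 x.2).card : ℕ) : ℤ) =
      ∑ i, ∑ j, (if i < j then ind (Q i j) else 0) := by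
  rw [Finset.card_filter, Nat.cast_sum, Fintype.sum_prod_type]
  refine Finset.sum_congr rfl fun i _ => Finset.sum_congr rfl fun j _ => ?_
  by_cases h1 : i < j <;> by_cases h2 : Q i j <;> simp [h1, h2, ind]

theorem pairInv_eq_sum (S : ℕ → ℕ → ℕ → ℕ → Prop) (a p : ι → ℕ) :
    (pairInv S a p : ℤ) = ∑ i, ∑ j, (if i < j then ind (S (a i) (a j) (p i) (p j)) else 0) := by
  classical
  rw [pairInv]
  convert card_filter_lt fun i j => S (a i) (a j) (p i) (p j)

theorem ascents_eq_sum (P : Finset ι) (p : ι → ℕ) :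
    (ascents P p : ℤ) = ∑ i, ∑ j, (if i < j then ind (i ∈ P ∧ j ∈ P ∧ p i < p j) else 0) := by
  classical
  rw [← card_filter_lt fun i j => i ∈ P ∧ j ∈ P ∧ p i < p j, ascents]
  congr 2
  ext x
  simp only [Finset.mem_filter, Finset.mem_product, Finset.mem_univ, true_and]
  tauto

/-- On a class of rows, `S`-quadruples and `excess` differ by a constant. -/
theorem pairInv_add_excess {S : ℕ → ℕ → ℕ → ℕ → Prop} (hS : IsQuinvQuadrupleSet S) {ε : Kind}
    (hE : ExtraOrder S ε) {N : ℕ} {a p p' : ι → ℕ} (haa : Antitone a) (hp : ∀ i, p i ≤ N)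
    (h : SameClass ε a p p') :
    pairInv S a p + excess ε N a p' = pairInv S a p' + excess ε N a p := by
  have hp' : ∀ i, p' i ≤ N := fun i => by
    obtain ⟨⟨w, hw⟩, -⟩ := h
    rw [hw]; exact hp _
  obtain ⟨Φ, Ψ, hsymm, hdiag, hpair⟩ := hS.hasPotential hE N
  -- By symmetry, and since the diagonal terms vanish, the sum over increasing pairs is half of the
  -- sum over all pairs, in which positions no longer play a role.
  have key : ∀ p : ι → ℕ, (∀ i, p i ≤ N) → 2 * ((pairInv S a p : ℤ) - excess ε N a p) =
      (∑ i, ∑ j, Φ (label ε a p i) (label ε a p j)) +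
        2 * ∑ i, ∑ j, Ψ (label ε a p i) (p j) := by
    intro p hp
    have e : (pairInv S a p : ℤ) - excess ε N a p = ∑ i, ∑ j, (if i < j then
        (Φ (label ε a p i) (label ε a p j) + Ψ (label ε a p i) (p j) + Ψ (label ε a p j) (p i))
        else 0) := by
      rw [pairInv_eq_sum, excess, Nat.cast_add, ascents_eq_sum, ascents_eq_sum,
        ← Finset.sum_add_distrib, ← Finset.sum_sub_distrib]
      refine Finset.sum_congr rfl fun i _ => ?_
      rw [← Finset.sum_add_distrib, ← Finset.sum_sub_distrib]
      refine Finset.sum_congr rfl fun j _ => ?_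
      by_cases hij : i < j
      · simp only [hij, if_true, Finset.mem_univ, true_and, mem_blockPos]
        rw [hpair _ _ _ _ (haa hij.le) (hp i) (hp j)]
        change _ = Φ (colLabel ε (a i) (p i)) (colLabel ε (a j) (p j)) +
          Ψ (colLabel ε (a i) (p i)) (p j) + Ψ (colLabel ε (a j) (p j)) (p i)
        change _ - (ind (code ε N (colLabel ε (a i) (p i)) < code ε N (colLabel ε (a j) (p j))) + _)
          = _
        ring
      · simp [hij]
    rw [e, two_mul_sum_lt (fun i j => Φ (label ε a p i) (label ε a p j) +
      Ψ (label ε a p i) (p j) + Ψ (label ε a p j) (p i))]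
    · simp only [Finset.sum_add_distrib]
      rw [Finset.sum_comm (f := fun i j => Ψ (label ε a p j) (p i))]
      ring
    · intro i j
      change Φ (colLabel ε (a i) (p i)) (colLabel ε (a j) (p j)) + _ + _ =
        Φ (colLabel ε (a j) (p j)) (colLabel ε (a i) (p i)) + _ + _
      rw [hsymm]; ring
    · intro i
      have := hdiag (a i) (p i)
      change Φ (colLabel ε (a i) (p i)) (colLabel ε (a i) (p i)) +
          Ψ (colLabel ε (a i) (p i)) (p i) + Ψ (colLabel ε (a i) (p i)) (p i) = 0
      linarith
  have h1 := key p hp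
  have h2 := key p' hp'
  have e1 : ∑ i, ∑ j, Φ (label ε a p' i) (label ε a p' j) =
      ∑ i, ∑ j, Φ (label ε a p i) (label ε a p j) := by
    rw [h.2.sum_eq fun L => ∑ j, Φ L (label ε a p' j)]
    exact Finset.sum_congr rfl fun i _ => h.2.sum_eq fun L => Φ (label ε a p i) L
  have e2 : ∑ i, ∑ j, Ψ (label ε a p' i) (p' j) = ∑ i, ∑ j, Ψ (label ε a p i) (p j) := by
    rw [h.2.sum_eq fun L => ∑ j, Ψ L (p' j)]
    exact Finset.sum_congr rfl fun i _ => h.1.sum_eq fun x => Ψ (label ε a p i) x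
  rw [e1, e2] at h2
  omega

end Quadruples

/-! ### The action of permutations on rectangular fillings -/

section Drag

variable {n k : ℕ}

theorem act_mul (w v : Equiv.Perm (Fin k)) (p : Fin k → ℕ) : act (w * v) p = act w (act v p) := by
  ext i; simp [act]

@[simp] theorem act_one (p : Fin k → ℕ) : act 1 p = p := by
  ext i; simp [act]

theorem act_apply_apply (w : Equiv.Perm (Fin k)) (p : Fin k → ℕ) (i : Fin k) :
    act w p (w i) = p i := by simp [act]

theorem sameContent_act (w : Equiv.Perm (Fin k)) (p : Fin k → ℕ) : SameContent p (act w p) :=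
  ⟨w⁻¹, fun _ => rfl⟩

theorem exists_act_of_sameContent {p p' : Fin k → ℕ} (h : SameContent p p') : ∃ w, act w p = p' := by
  obtain ⟨w, hw⟩ := h
  exact ⟨w⁻¹, funext fun i => by rw [hw]; simp [act]⟩

/-- The permutation which rearranges `p` in the same way as `w` and keeps the order of equal
entries. -/
def std (w : Equiv.Perm (Fin k)) (p : Fin k → ℕ) : Equiv.Perm (Fin k) :=
  Tuple.sort (act w p) * (Tuple.sort p)⁻¹

/-- The sorting permutation of the intermediate row cancels. This cocycle identity makes `drag` an
action. -/
theorem std_mul (w v : Equiv.Perm (Fin k)) (p : Fin k → ℕ) :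
    std (w * v) p = std w (act v p) * std v p := by
  simp [std, act_mul, mul_assoc]

@[simp] theorem std_one (p : Fin k → ℕ) : std 1 p = 1 := by simp [std]

theorem std_congr {w v : Equiv.Perm (Fin k)} {p : Fin k → ℕ} (h : act w p = act v p) :
    std w p = std v p := by rw [std, std, h]

theorem act_sort (w : Equiv.Perm (Fin k)) (p : Fin k → ℕ) (j : Fin k) :
    act w p (Tuple.sort (act w p) j) = p (Tuple.sort p j) :=
  congrFun (Tuple.comp_perm_comp_sort_eq_comp_sort (f := p) (σ := w⁻¹)) j

theorem act_std (w : Equiv.Perm (Fin k)) (p : Fin k → ℕ) : act (std w p) p = act w p := by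
  ext i
  have h := act_sort w p ((Tuple.sort (act w p))⁻¹ i)
  rw [show Tuple.sort (act w p) ((Tuple.sort (act w p))⁻¹ i) = i by simp] at h
  rw [h]
  simp [act, std]

theorem std_lt_std (w : Equiv.Perm (Fin k)) {p : Fin k → ℕ} {i j : Fin k} (hp : p i = p j)
    (hij : i < j) : std w p i < std w p j := by
  obtain ⟨i', rfl⟩ := (Tuple.sort p).surjective i
  obtain ⟨j', rfl⟩ := (Tuple.sort p).surjective j
  have h1 := (Tuple.eq_sort_iff.1 (rfl : Tuple.sort p = Tuple.sort p)).2
  have h2 := (Tuple.eq_sort_iff.1 (rfl : Tuple.sort (act w p) = Tuple.sort (act w p))).2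
  have h3 : i' < j' := by
    rcases lt_trichotomy i' j' with h | rfl | h
    · exact h
    · exact absurd hij (lt_irrefl _)
    · exact absurd (h1 j' i' h hp.symm) (not_lt.2 hij.le)
  rw [show std w p (Tuple.sort p i') = Tuple.sort (act w p) i' by simp [std],
    show std w p (Tuple.sort p j') = Tuple.sort (act w p) j' by simp [std]]
  refine h2 i' j' h3 ?_
  rw [act_sort, act_sort, hp]

theorem simple_lt_simple (s : SimpleIdx k) {x y : Fin k} (hxy : x < y)
    (h : ¬ (x = posL s ∧ y = posR s)) : simple s x < simple s y := by
  have hL : ((posL s : Fin k) : ℕ) = s.1 := rfl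
  have hR : ((posR s : Fin k) : ℕ) = s.1 + 1 := rfl
  unfold simple
  rw [Equiv.swap_apply_def, Equiv.swap_apply_def]
  rw [Fin.lt_def] at *
  simp only [Fin.ext_iff] at *
  split_ifs <;> omega

/-- A simple transposition reverses the order of a single pair of positions; if their entries
differ, it already keeps the order of equal entries. -/
theorem std_simple_of_ne {s : SimpleIdx k} {p : Fin k → ℕ} (h : p (posL s) ≠ p (posR s)) :
    std (simple s) p = simple s := by
  have : simple s * Tuple.sort p = Tuple.sort (act (simple s) p) := by
    rw [Tuple.eq_sort_iff]
    constructor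
    · have : act (simple s) p ∘ ⇑(simple s * Tuple.sort p) = p ∘ Tuple.sort p := by
        ext j
        simp [act]
      rw [this]
      exact Tuple.monotone_sort p
    · intro i j hij hp
      simp only [Equiv.Perm.mul_apply, act_apply_apply] at hp ⊢
      have h1 := (Tuple.eq_sort_iff.1 (rfl : Tuple.sort p = Tuple.sort p)).2 i j hij hp
      refine simple_lt_simple s h1 fun h2 => ?_
      rw [h2.1, h2.2] at hp
      exact h hp
  rw [std, ← this]
  simp

theorem act_simple_of_eq {s : SimpleIdx k} {p : Fin k → ℕ} (h : p (posL s) = p (posR s)) :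
    act (simple s) p = p := by
  ext i
  simp only [act, simple, Equiv.swap_inv]
  rw [Equiv.swap_apply_def]
  split_ifs with h1 h2
  · rw [h1, h]
  · rw [h2, h]
  · rfl

theorem std_simple_of_eq {s : SimpleIdx k} {p : Fin k → ℕ} (h : p (posL s) = p (posR s)) :
    std (simple s) p = 1 := by
  rw [std, act_simple_of_eq h]; simp

/-- The permutation acting on row `r - d` if `w` acts on row `r`. -/
def dragPerm (τ : Rect n k) (r : ℕ) (w : Equiv.Perm (Fin k)) : ℕ → Equiv.Perm (Fin k)
  | 0 => w
  | d + 1 => std (dragPerm τ r w d) (row τ (r - d))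

/-- The permutation `w` acts on row `r`, and the rows below are dragged along. -/
def drag (r : ℕ) (w : Equiv.Perm (Fin k)) (τ : Rect n k) : Rect n k := fun x =>
  if (x : ℕ) ≤ r then τ x ∘ ⇑(dragPerm τ r w (r - x))⁻¹ else τ x

theorem row_of_lt {τ : Rect n k} {y : ℕ} (h : y < n) (c : Fin k) : row τ y c = τ ⟨y, h⟩ c := dif_pos h

theorem row_of_ge {τ : Rect n k} {y : ℕ} (h : n ≤ y) (c : Fin k) : row τ y c = 0 :=
  dif_neg (not_lt.2 h)

theorem rect_ext {τ τ' : Rect n k} (h : ∀ y, row τ y = row τ' y) : τ = τ' := by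
  funext x c
  have := congrFun (h x) c
  rw [row_of_lt x.2, row_of_lt x.2] at this
  exact PNat.eq this

theorem row_drag_of_le {r y : ℕ} (w : Equiv.Perm (Fin k)) (τ : Rect n k) (h : y ≤ r) :
    row (drag r w τ) y = act (dragPerm τ r w (r - y)) (row τ y) := by
  ext c
  by_cases hy : y < n
  · simp only [row_of_lt hy, act, drag]
    rw [if_pos h]; rfl
  · simp only [row_of_ge (not_lt.1 hy), act]

theorem row_drag_of_lt {r y : ℕ} (w : Equiv.Perm (Fin k)) (τ : Rect n k) (h : r < y) :
    row (drag r w τ) y = row τ y := by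
  ext c
  by_cases hy : y < n
  · simp only [row_of_lt hy, drag]
    rw [if_neg (not_le.2 h)]
  · simp only [row_of_ge (not_lt.1 hy)]

theorem row_drag_self {r : ℕ} (w : Equiv.Perm (Fin k)) (τ : Rect n k) :
    row (drag r w τ) r = act w (row τ r) := by
  rw [row_drag_of_le w τ le_rfl, Nat.sub_self]; rfl

theorem dragPerm_congr {r : ℕ} {τ τ' : Rect n k} (h : ∀ y ≤ r, row τ y = row τ' y)
    (w : Equiv.Perm (Fin k)) (d : ℕ) : dragPerm τ r w d = dragPerm τ' r w d := by
  induction d with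
  | zero => rfl
  | succ d ih => rw [dragPerm, dragPerm, ih, h _ (Nat.sub_le _ _)]

theorem dragPerm_congr_act {r : ℕ} {τ : Rect n k} {w v : Equiv.Perm (Fin k)}
    (h : act w (row τ r) = act v (row τ r)) (d : ℕ) :
    dragPerm τ r w (d + 1) = dragPerm τ r v (d + 1) := by
  induction d with
  | zero => exact std_congr h
  | succ d ih => rw [dragPerm, ih]; rfl

/-- `std` depends only on the rearranged row, so the result is determined by the new row `r`. This
is why the choice of shortest representatives in the definition of the family is immaterial. -/
theorem drag_congr {r : ℕ} {τ : Rect n k} {w v : Equiv.Perm (Fin k)}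
    (h : act w (row τ r) = act v (row τ r)) : drag r w τ = drag r v τ := by
  refine rect_ext fun y => ?_
  rcases lt_trichotomy y r with hy | rfl | hy
  · rw [row_drag_of_le _ _ hy.le, row_drag_of_le _ _ hy.le]
    obtain ⟨d, hd⟩ : ∃ d, r - y = d + 1 := ⟨r - y - 1, by omega⟩
    rw [hd, dragPerm_congr_act h]
  · rw [row_drag_self, row_drag_self, h]
  · rw [row_drag_of_lt _ _ hy, row_drag_of_lt _ _ hy]

theorem dragPerm_mul (τ : Rect n k) (r : ℕ) (w v : Equiv.Perm (Fin k)) (d : ℕ) (hd : d ≤ r) :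
    dragPerm τ r (w * v) d = dragPerm (drag r v τ) r w d * dragPerm τ r v d := by
  induction d with
  | zero => rfl
  | succ d ih =>
    rw [dragPerm, ih (by omega), std_mul, dragPerm, dragPerm, row_drag_of_le _ _ (Nat.sub_le _ _),
      Nat.sub_sub_self (by omega)]

/-- The cocycle identity, applied row by row, takes the place of the braid relations for flips. -/
theorem drag_mul (r : ℕ) (w v : Equiv.Perm (Fin k)) (τ : Rect n k) :
    drag r (w * v) τ = drag r w (drag r v τ) := by
  refine rect_ext fun y => ?_
  rcases le_or_gt y r with hy | hy
  · rw [row_drag_of_le _ _ hy, row_drag_of_le _ _ hy, row_drag_of_le _ _ hy,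
      dragPerm_mul _ _ _ _ _ (Nat.sub_le _ _), act_mul]
  · rw [row_drag_of_lt _ _ hy, row_drag_of_lt _ _ hy, row_drag_of_lt _ _ hy]

theorem dragPerm_one (τ : Rect n k) (r d : ℕ) : dragPerm τ r 1 d = 1 := by
  induction d with
  | zero => rfl
  | succ d ih => rw [dragPerm, ih, std_one]

@[simp] theorem drag_one (r : ℕ) (τ : Rect n k) : drag r 1 τ = τ := by
  refine rect_ext fun y => ?_
  rcases le_or_gt y r with hy | hy
  · rw [row_drag_of_le _ _ hy, dragPerm_one, act_one]
  · rw [row_drag_of_lt _ _ hy]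

/-- Going down from row `r`, the transposition is passed on until a row has equal entries in the two
positions; its standardization there is trivial, and nothing moves below. -/
theorem dragPerm_simple (τ : Rect n k) (r : ℕ) (s : SimpleIdx k) (d : ℕ) (hd : d ≤ r) :
    ((∀ y, r - d < y → y ≤ r → row τ y (posL s) ≠ row τ y (posR s)) →
      dragPerm τ r (simple s) d = simple s) ∧
    (¬ (∀ y, r - d < y → y ≤ r → row τ y (posL s) ≠ row τ y (posR s)) →
      dragPerm τ r (simple s) d = 1) := by
  induction d with
  | zero => exact ⟨fun _ => rfl, fun h => absurd (fun y h1 h2 => by omega) h⟩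
  | succ d ih =>
    obtain ⟨ih1, ih2⟩ := ih (by omega)
    rw [dragPerm]
    constructor
    · intro h
      rw [ih1 fun y h1 h2 => h y (by omega) h2]
      exact std_simple_of_ne (h (r - d) (by omega) (by omega))
    · intro h
      by_cases h' : ∀ y, r - d < y → y ≤ r → row τ y (posL s) ≠ row τ y (posR s)
      · rw [ih1 h']
        refine std_simple_of_eq ?_
        by_contra hne
        refine h fun y h1 h2 => ?_
        rcases (show r - d ≤ y by omega).eq_or_lt with rfl | h3
        · exact hne
        · exact h' y h3 h2
      · rw [ih2 h', std_one]

theorem flip_eq_drag (r : ℕ) (s : SimpleIdx k) (τ : Rect n k) : flip r s τ = drag r (simple s) τ := by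
  funext x
  unfold flip drag
  by_cases hx : (x : ℕ) ≤ r
  · have hrx : r - (r - (x : ℕ)) = x := by omega
    have h := dragPerm_simple τ r s (r - x) (Nat.sub_le _ _)
    rw [hrx] at h
    -- The default value `0` of `Nat.findGreatest` causes no ambiguity: whether or not row `0` has
    -- equal entries, all rows down to the bottom are interchanged.
    have hiff : Nat.findGreatest (fun y => row τ y (posL s) = row τ y (posR s)) r ≤ (x : ℕ) ↔
        ∀ y, (x : ℕ) < y → y ≤ r → row τ y (posL s) ≠ row τ y (posR s) := by
      constructor
      · intro h1 y h2 h3 h4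
        have := Nat.le_findGreatest (P := fun y => row τ y (posL s) = row τ y (posR s)) h3 h4
        omega
      · intro h1
        by_contra h2
        push Not at h2
        have h3 := Nat.findGreatest_of_ne_zero
          (P := fun y => row τ y (posL s) = row τ y (posR s)) (n := r) rfl (by omega)
        exact h1 _ h2 (Nat.findGreatest_le r) h3
    rw [if_pos hx]
    by_cases h' : ∀ y, (x : ℕ) < y → y ≤ r → row τ y (posL s) ≠ row τ y (posR s)
    · rw [if_pos ⟨hiff.2 h', hx⟩, h.1 h']
      simp [simple]
    · rw [if_neg fun h1 => h' (hiff.1 h1.1), h.2 h']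
      rfl
  · rw [if_neg hx, if_neg fun h => hx h.2]

/-- Flips along any word, reduced or not, compose to the drag of the product of the word. -/
theorem flips_eq_drag (r : ℕ) (w : Equiv.Perm (Fin k)) (τ : Rect n k) : flips r w τ = drag r w τ := by
  have h : ∀ l : List (SimpleIdx k), l.foldr (flip r) τ = drag r (l.map simple).prod τ := by
    intro l
    induction l with
    | nil => simp
    | cons s l ih => rw [List.foldr_cons, ih, flip_eq_drag, List.map_cons, List.prod_cons, drag_mul]
  rw [flips, h]
  congr 1
  exact (exists_reducedWord w).choose_spec.1

theorem row_drag_succ {r y : ℕ} (w : Equiv.Perm (Fin k)) (τ : Rect n k) (h : y ≤ r) :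
    row (drag (r + 1) w τ) y = row (drag r (std w (row τ (r + 1))) τ) y := by
  have hd : ∀ d, dragPerm τ (r + 1) w (d + 1) = dragPerm τ r (std w (row τ (r + 1))) d := by
    intro d
    induction d with
    | zero => rfl
    | succ d ih => rw [dragPerm, ih, dragPerm, Nat.add_sub_add_right]
  rw [row_drag_of_le _ _ (Nat.le_succ_of_le h), row_drag_of_le _ _ h, Nat.succ_sub h, hd]

theorem row_drag_congr {r : ℕ} {τ τ' : Rect n k} (h : ∀ y ≤ r, row τ y = row τ' y)
    (w : Equiv.Perm (Fin k)) {y : ℕ} (hy : y ≤ r) : row (drag r w τ) y = row (drag r w τ') y := by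
  rw [row_drag_of_le _ _ hy, row_drag_of_le _ _ hy, dragPerm_congr h, h y hy]

/-- The operators of row `r + 1` act on the rows below as drags of row `r` by `std π` and, by the
cocycle identity, by its inverse, while row `r + 1` itself is moved and moved back. -/
theorem conjFlips_eq_drag (r : ℕ) (π w : Equiv.Perm (Fin k)) (τ : Rect n k) :
    conjFlips r π w τ =
      drag r ((std π (row τ (r + 1)))⁻¹ * w * std π (row τ (r + 1))) τ := by
  rw [conjFlips, flips_eq_drag, flips_eq_drag, flips_eq_drag]
  have hrow : row (drag r w (drag (r + 1) π τ)) (r + 1) = act π (row τ (r + 1)) := by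
    rw [row_drag_of_lt _ _ (Nat.lt_succ_self r), row_drag_self]
  refine rect_ext fun y => ?_
  rcases lt_trichotomy y (r + 1) with hy | rfl | hy
  · have hy := Nat.le_of_lt_succ hy
    rw [row_drag_succ _ _ hy, hrow]
    have h1 : std π⁻¹ (act π (row τ (r + 1))) = (std π (row τ (r + 1)))⁻¹ := by
      rw [eq_inv_iff_mul_eq_one, ← std_mul, inv_mul_cancel, std_one]
    rw [h1, drag_mul, drag_mul]
    refine row_drag_congr (fun y hy => row_drag_congr (fun y hy => row_drag_succ _ _ hy) _ hy) _ hy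
  · rw [row_drag_self, hrow, row_drag_of_lt _ _ (Nat.lt_succ_self r), ← act_mul, inv_mul_cancel,
      act_one]
  · rw [row_drag_of_lt _ _ hy, row_drag_of_lt _ _ (by omega), row_drag_of_lt _ _ hy,
      row_drag_of_lt _ _ (by omega)]

end Drag

/-! ### One step of the construction of the family -/

section Step

variable {n k : ℕ}

theorem label_act {ε : Kind} {a p : Fin k → ℕ} {w : Equiv.Perm (Fin k)} (hw : ∀ i, a (w i) = a i)
    (i : Fin k) : label ε a (act w p) i = label ε a p (w⁻¹ i) :=
  label_comp (w := w⁻¹) (fun j => by rw [← hw (w⁻¹ j)]; simp) i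

/-- The value `z` or `z - 1` that `alpha` gives to block columns is never the lower entry of a
column outside the block. -/
theorem colLabel_eq_of_alpha_eq {ε : Kind} {z u v : ℕ} (h : alpha ε z u = alpha ε z v) :
    colLabel ε z u = colLabel ε z v := by
  cases ε <;> simp only [alpha] at h
  · by_cases h1 : z ≤ u <;> by_cases h2 : z ≤ v <;> simp only [h1, h2, if_true, if_false] at h
    · rw [colLabel_pos (ε := .diamond) h1, colLabel_pos (ε := .diamond) h2]
    · omega
    · omega
    · rw [h]
  · by_cases h1 : u < z <;> by_cases h2 : v < z <;> simp only [h1, h2, if_true, if_false] at h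
    · rw [colLabel_pos (ε := .dagger) h1, colLabel_pos (ε := .dagger) h2]
    · omega
    · omega
    · rw [h]

/-- Rows with the same entries and the same columns outside of the block differ by a permutation of
the block. -/
theorem exists_perm_of_label_eq {ε : Kind} {a p p' : Fin k → ℕ} (hc : SameContent p p')
    (hl : ∀ i, label ε a p i = label ε a p' i) :
    ∃ x : Equiv.Perm (Fin k), act x p = p' ∧ ∀ i, ¬ InBlock ε (a i) (p i) → x i = i := by
  -- Positions outside the block are tagged by themselves, so that a permutation matching `f` and
  -- `g` must fix them.
  let f : Fin k → ℕ ⊕ Fin k := fun i => if InBlock ε (a i) (p i) then Sum.inl (p i) else Sum.inr i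
  let g : Fin k → ℕ ⊕ Fin k := fun i => if InBlock ε (a i) (p i) then Sum.inl (p' i) else Sum.inr i
  have hfg : SameContent f g := by
    refine sameContent_of_card fun y => ?_
    rcases y with c | j
    · have split : ∀ h : Fin k → ℕ, (Finset.univ.filter fun i => h i = c).card =
          (Finset.univ.filter fun i => InBlock ε (a i) (p i) ∧ h i = c).card +
          (Finset.univ.filter fun i => ¬ InBlock ε (a i) (p i) ∧ h i = c).card := by
        intro h
        rw [← Finset.card_filter_add_card_filter_not (s := Finset.univ.filter fun i => h i = c)
          (fun i => InBlock ε (a i) (p i)), Finset.filter_filter, Finset.filter_filter]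
        simp only [and_comm]
      have h1 := hc.card_eq fun y => y = c
      rw [split p, split p'] at h1
      have h2 : (Finset.univ.filter fun i => ¬ InBlock ε (a i) (p i) ∧ p' i = c) =
          Finset.univ.filter fun i => ¬ InBlock ε (a i) (p i) ∧ p i = c := by
        refine Finset.filter_congr fun i _ => and_congr_right fun h => ?_
        rw [(label_eq_iff.1 (hl i)).2 h]
      rw [h2] at h1
      have e : ∀ h : Fin k → ℕ, (Finset.univ.filter fun i =>
          (if InBlock ε (a i) (p i) then (Sum.inl (h i) : ℕ ⊕ Fin k) else Sum.inr i) = Sum.inl c) =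
          Finset.univ.filter fun i => InBlock ε (a i) (p i) ∧ h i = c := by
        intro h
        refine Finset.filter_congr fun i _ => ?_
        by_cases hi : InBlock ε (a i) (p i) <;> simp [hi]
      simp only [f, g]
      rw [e p, e p']
      omega
    · congr 1
      refine Finset.filter_congr fun i _ => ?_
      simp only [f, g]
      by_cases hi : InBlock ε (a i) (p i) <;> simp [hi]
  obtain ⟨x, hx⟩ := hfg
  have hfix : ∀ i, ¬ InBlock ε (a i) (p i) → x i = i := by
    intro i hi
    have := hx i
    simp only [f, g, hi, if_false] at this
    split_ifs at this
    exact (Sum.inr.inj this).symm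
  refine ⟨x⁻¹, ?_, fun i hi => ?_⟩
  · ext i
    simp only [act, inv_inv]
    by_cases hi : InBlock ε (a i) (p i)
    · have := hx i
      simp only [f, g, hi, if_true] at this
      split_ifs at this
      exact (Sum.inl.inj this).symm
    · rw [hfix i hi]
      exact (label_eq_iff.1 (hl i)).2 hi
  · rw [Equiv.Perm.inv_eq_iff_eq, hfix i hi]

/-- The permutations `u` realise all arrangements of the labels inside the neutral blocks, and then
`v` all arrangements of the block entries that keep the labels; together they reach exactly the rows
of the class. -/
theorem mem_familyStep {ε : Kind} {r : ℕ} {τ ρ : Rect n k} :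
    ρ ∈ familyStep ε r τ ↔ ∃ w, SameClass ε (row τ (r + 1)) (row τ r) (act w (row τ r)) ∧
      ρ = drag r w τ := by
  have hsucc : ∀ (π : Equiv.Perm (Fin k)) (τ : Rect n k),
      row (flips (r + 1) π τ) (r + 1) = act (std π (row τ (r + 1))) (row τ (r + 1)) := fun π τ => by
    rw [flips_eq_drag, row_drag_self, act_std]
  have hself : ∀ (π : Equiv.Perm (Fin k)) (τ : Rect n k),
      row (flips (r + 1) π τ) r = act (std π (row τ (r + 1))) (row τ r) := fun π τ => by
    rw [flips_eq_drag, row_drag_succ _ _ le_rfl, row_drag_self]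
  have hd : ∀ y, row (drag r y τ) (r + 1) = row τ (r + 1) := fun y =>
    row_drag_of_lt _ _ (Nat.lt_succ_self r)
  constructor
  · rintro ⟨u, hu, v, hv, rfl⟩
    simp only [symNeutral, Set.mem_ofPred_eq, hsucc, hself] at hu
    rw [deltaNeutral, conjFlips_eq_drag] at hv ⊢
    set ρ₁ := std (piBullet (row τ (r + 1))) (row τ (r + 1)) with hρ₁
    set y := ρ₁⁻¹ * u * ρ₁ with hy
    simp only [symBlock, Set.mem_ofPred_eq, hsucc, hself] at hv
    rw [deltaBlock, conjFlips_eq_drag]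
    rw [hd, row_drag_self] at hv ⊢
    set p₁ := act y (row τ r) with hp₁
    set ρ₂ := std (piBlock ε (row τ (r + 1)) p₁) (row τ (r + 1)) with hρ₂
    set x := ρ₂⁻¹ * v * ρ₂ with hx
    have hay : ∀ i, row τ (r + 1) (y i) = row τ (r + 1) i := fun i => by
      have := hu.1 (ρ₁ i)
      rw [act_apply_apply] at this
      exact this
    refine ⟨x * y, ?_, (drag_mul _ _ _ _).symm⟩
    rw [act_mul, ← hp₁]
    refine SameClass.trans (p' := p₁) ⟨sameContent_act _ _, ⟨y⁻¹, label_act hay⟩⟩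
      ⟨sameContent_act _ _, ?_⟩
    have : label ε (row τ (r + 1)) (act x p₁) = label ε (row τ (r + 1)) p₁ := by
      ext1 i
      rw [label_eq_iff]
      by_cases hi : InBlock ε (row τ (r + 1) i) (p₁ i)
      · have h1 := hv.2 (ρ₂ i)
        rw [act_apply_apply, act_apply_apply] at h1
        have h2 : InBlock ε (row τ (r + 1) i) (act x p₁ i) := h1 hi
        exact ⟨⟨fun _ => hi, fun _ => h2⟩, fun h => absurd h2 h⟩
      · have h1 := hv.1 (ρ₂ i)
        rw [act_apply_apply, act_apply_apply] at h1
        have h2 := h1 hi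
        have h3 : x i = i := by rw [hx]; simp [h2]
        have h4 : act x p₁ i = p₁ i := by
          conv_lhs => rw [← h3]
          exact act_apply_apply _ _ _
        rw [h4]
        exact ⟨Iff.rfl, fun _ => rfl⟩
    rw [this]
    exact SameContent.refl _
  · rintro ⟨w, hw, rfl⟩
    set a := row τ (r + 1) with ha
    set p := row τ r with hp
    obtain ⟨y, hy⟩ := hw.2
    have hay : ∀ i, a (y i) = a i := fun i => (congrArg Prod.fst (hy i)).symm
    set ρ₁ := std (piBullet a) a with hρ₁
    set q : Fin k → ℕ := fun j => alpha ε (act ρ₁ a j) (act ρ₁ p j) with hq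
    -- The conjugate of `y⁻¹` puts the labels where `w` puts them; `u` is a shortest permutation
    -- with the same effect on `q`.
    obtain ⟨u, ⟨hu1, hu2⟩, hmin⟩ := WellFounded.has_min
      (InvImage.wf (fun u : Equiv.Perm (Fin k) => len u) Nat.lt_wfRel.wf)
      {u | (∀ j, act ρ₁ a (u j) = act ρ₁ a j) ∧ act u q = act (ρ₁ * y⁻¹ * ρ₁⁻¹) q}
      ⟨ρ₁ * y⁻¹ * ρ₁⁻¹, fun j => by
        simp only [act, Equiv.Perm.mul_apply]
        rw [← hay]; simp, rfl⟩
    have hu : u ∈ symNeutral ε r τ := by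
      simp only [symNeutral, Set.mem_ofPred_eq, hsucc, hself]
      exact ⟨hu1, fun x h1 h2 => not_lt.1 (hmin x ⟨h1, h2.trans hu2⟩)⟩
    set y' := ρ₁⁻¹ * u * ρ₁ with hy'
    have hay' : ∀ i, a (y' i) = a i := fun i => by
      have := hu1 (ρ₁ i)
      rw [act_apply_apply] at this
      exact this
    have hay'' : ∀ i, a (y'⁻¹ i) = a i := fun i => by rw [← hay']; simp
    set p₁ := act y' p with hp₁
    have hlab : ∀ i, label ε a p₁ i = label ε a (act w p) i := by
      intro i
      rw [hy, ← label_comp hay]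
      refine colLabel_eq_of_alpha_eq ?_
      have h1 := congrFun hu2 (ρ₁ i)
      simp only [act, hq, hp₁, hy', mul_inv_rev, inv_inv, Equiv.Perm.mul_apply] at h1 ⊢
      have h3 := hay'' i
      simp only [hy', mul_inv_rev, inv_inv, Equiv.Perm.mul_apply] at h3
      rw [h3] at h1
      simpa [hay] using h1
    -- After `u` all labels agree with those of the target row, so only block entries remain to be
    -- permuted.
    obtain ⟨x, hx1, hx2⟩ := exists_perm_of_label_eq
      ((sameContent_act y' p).symm.trans (sameContent_act w p)) hlab
    have hτ₁ : deltaNeutral r u τ = drag r y' τ := by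
      rw [deltaNeutral, conjFlips_eq_drag]
    have hr1 : row (deltaNeutral r u τ) (r + 1) = a := by rw [hτ₁, hd]
    have hr2 : row (deltaNeutral r u τ) r = p₁ := by rw [hτ₁, row_drag_self]
    set ρ₂ := std (piBlock ε a p₁) a with hρ₂
    refine ⟨u, hu, ρ₂ * x * ρ₂⁻¹, ?_, ?_⟩
    · simp only [symBlock, Set.mem_ofPred_eq, hsucc, hself, hr1, hr2]
      rw [← hρ₂]
      constructor
      · intro j hj
        have := hx2 (ρ₂⁻¹ j) hj
        rw [Equiv.Perm.mul_apply, Equiv.Perm.mul_apply, this]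
        simp
      · intro j hj
        have h1 := label_eq_iff.1 (hlab (ρ₂⁻¹ j))
        have h2 : InBlock ε (a (ρ₂⁻¹ j)) (act x p₁ (ρ₂⁻¹ j)) := by rw [hx1]; exact h1.1.1 hj
        simpa [act] using h2
    · rw [deltaBlock, conjFlips_eq_drag, hr1, hr2, ← hρ₂, hτ₁, ← drag_mul]
      refine drag_congr ?_
      rw [act_mul, ← hp, ← hp₁]
      have : ρ₂⁻¹ * (ρ₂ * x * ρ₂⁻¹) * ρ₂ = x := by group
      rw [this, hx1]

end Step

/-! ### Reduction to a sorted upper row -/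

section Stable

variable {n k : ℕ}

/-- The permutation keeps the order of positions with equal entries. -/
def Stable (ρ : Equiv.Perm (Fin k)) (a : Fin k → ℕ) : Prop :=
  ∀ i j, a i = a j → i < j → ρ i < ρ j

theorem Stable.lt_iff {ρ : Equiv.Perm (Fin k)} {a : Fin k → ℕ} (h : Stable ρ a) {i j : Fin k}
    (hij : a i = a j) : ρ i < ρ j ↔ i < j := by
  refine ⟨fun h1 => ?_, h i j hij⟩
  rcases lt_trichotomy i j with h2 | rfl | h2
  · exact h2
  · exact absurd h1 (lt_irrefl _)
  · exact absurd (h j i hij.symm h2) (not_lt.2 h1.le)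

theorem stable_std (w : Equiv.Perm (Fin k)) (a : Fin k → ℕ) : Stable (std w a) a :=
  fun _ _ h hij => std_lt_std w h hij

theorem exists_stable_antitone (a : Fin k → ℕ) : ∃ ρ, Stable ρ a ∧ Antitone (act ρ a) := by
  refine ⟨std (piBullet a) a, stable_std _ _, ?_⟩
  rw [act_std]
  intro i j hij
  have := Tuple.monotone_sort (fun i => OrderDual.toDual (a i)) hij
  simpa [act, piBullet, sortPerm] using this

/-- Columns with equal upper entries keep their order, and for different upper entries axiom (1)
makes the contribution independent of the order of the two columns. -/
theorem pairInv_act {S : ℕ → ℕ → ℕ → ℕ → Prop} (hS : IsQuinvQuadrupleSet S)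
    {ρ : Equiv.Perm (Fin k)} {a : Fin k → ℕ} (h : Stable ρ a) (p : Fin k → ℕ) :
    pairInv S (act ρ a) (act ρ p) = pairInv S a p := by
  have key : (pairInv S (act ρ a) (act ρ p) : ℤ) =
      ∑ i, ∑ j, (if ρ i < ρ j then ind (S (a i) (a j) (p i) (p j)) else 0) := by
    rw [pairInv_eq_sum, ← Equiv.sum_comp ρ]
    refine Finset.sum_congr rfl fun i _ => ?_
    rw [← Equiv.sum_comp ρ]
    refine Finset.sum_congr rfl fun j _ => ?_
    simp only [act_apply_apply]
  -- Each sum is doubled by adding its transpose, so that both orders of a pair occur in one term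
  -- and the comparison is termwise.
  have h2 : ∑ i, ∑ j, (if ρ i < ρ j then ind (S (a i) (a j) (p i) (p j)) else 0) +
      ∑ i, ∑ j, (if ρ i < ρ j then ind (S (a i) (a j) (p i) (p j)) else 0) =
      ∑ i, ∑ j, (if i < j then ind (S (a i) (a j) (p i) (p j)) else 0) +
      ∑ i, ∑ j, (if i < j then ind (S (a i) (a j) (p i) (p j)) else 0) := by
    nth_rewrite 2 [Finset.sum_comm]
    nth_rewrite 4 [Finset.sum_comm]
    simp only [← Finset.sum_add_distrib]
    refine Finset.sum_congr rfl fun i _ => Finset.sum_congr rfl fun j _ => ?_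
    by_cases hij : a i = a j
    · simp only [h.lt_iff hij, h.lt_iff hij.symm]
    · rw [ind_congr (hS.swap (a j) (a i) (p j) (p i) (Ne.symm hij))]
      have hne : i ≠ j := fun h => hij (by rw [h])
      rcases lt_or_gt_of_ne hne with h3 | h3 <;>
        rcases lt_or_gt_of_ne (fun h => hne (ρ.injective h) : ρ i ≠ ρ j) with h4 | h4 <;>
        simp [h3, h4, h3.le, h4.le, not_lt.2]
  have h3 := pairInv_eq_sum S a p
  omega

theorem sameContent_act_act (ρ : Equiv.Perm (Fin k)) (a p : Fin k → ℕ) :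
    SameContent (fun i => (a i, p i)) fun i => (act ρ a i, act ρ p i) := ⟨ρ⁻¹, fun _ => rfl⟩

theorem SameClass.act {ε : Kind} {a p p' : Fin k → ℕ} (h : SameClass ε a p p')
    (ρ : Equiv.Perm (Fin k)) : SameClass ε (act ρ a) (act ρ p) (act ρ p') := by
  refine ⟨(sameContent_act ρ p).symm.trans (h.1.trans (sameContent_act ρ p')), ?_⟩
  have e : ∀ p : Fin k → ℕ, SameContent (label ε a p) (label ε (MacTab.act ρ a) (MacTab.act ρ p)) :=
    fun p => ⟨ρ⁻¹, fun i => rfl⟩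
  exact (e p).symm.trans (h.2.trans (e p'))

theorem act_inv_act (ρ : Equiv.Perm (Fin k)) (p : Fin k → ℕ) : act ρ⁻¹ (act ρ p) = p := by
  rw [← act_mul, inv_mul_cancel, act_one]

theorem act_act_inv (ρ : Equiv.Perm (Fin k)) (p : Fin k → ℕ) : act ρ (act ρ⁻¹ p) = p := by
  rw [← act_mul, mul_inv_cancel, act_one]

theorem sameClass_act_iff {ε : Kind} {a p p' : Fin k → ℕ} (ρ : Equiv.Perm (Fin k)) :
    SameClass ε (act ρ a) (act ρ p) (act ρ p') ↔ SameClass ε a p p' := by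
  refine ⟨fun h => ?_, fun h => h.act ρ⟩
  have := h.act ρ⁻¹
  rwa [act_inv_act, act_inv_act, act_inv_act] at this

/-- For different upper entries the condition does not refer to positions; only columns with equal
upper entries need their order. This form is visibly invariant under stable permutations. -/
theorem canonPair_iff {ε : Kind} {a p : Fin k → ℕ} : CanonPair ε a p ↔
    (∀ i j, i < j → a i = a j →
      (p i < a i ∧ p j ≤ p i) ∨ (p i < a i ∧ a i ≤ p j) ∨ (a i ≤ p j ∧ p j ≤ p i)) ∧
    (∀ i j, i < j → a i = a j → InBlock ε (a i) (p i) → InBlock ε (a j) (p j) → p j ≤ p i) ∧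
    (∀ i j, a i < a j → InBlock ε (a i) (p i) → InBlock ε (a j) (p j) → p i ≤ p j) := by
  constructor
  · intro h
    refine ⟨fun i j hij => (h i j hij).1, fun i j hij ha hi hj => ((h i j hij).2 hi hj).1 ha.symm.le,
      fun i j ha hi hj => ?_⟩
    rcases lt_trichotomy i j with hij | rfl | hij
    · exact ((h i j hij).2 hi hj).2 ha
    · exact le_rfl
    · exact ((h j i hij).2 hj hi).1 ha.le
  · rintro ⟨h1, h2, h3⟩ i j hij
    refine ⟨h1 i j hij, fun hi hj => ⟨fun ha => ?_, fun ha => h3 i j ha hi hj⟩⟩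
    rcases ha.eq_or_lt with h | h
    · exact h2 i j hij h.symm hi hj
    · exact h3 j i h hj hi

theorem canonPair_act_iff {ε : Kind} {ρ : Equiv.Perm (Fin k)} {a : Fin k → ℕ} (h : Stable ρ a)
    (p : Fin k → ℕ) : CanonPair ε (act ρ a) (act ρ p) ↔ CanonPair ε a p := by
  rw [canonPair_iff, canonPair_iff]
  have e : ∀ Q : Fin k → Fin k → Prop, (∀ i j, Q i j) ↔ ∀ i j, Q (ρ i) (ρ j) := fun Q =>
    ⟨fun h i j => h _ _, fun h i j => by
      have := h (ρ⁻¹ i) (ρ⁻¹ j)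
      simpa using this⟩
  refine and_congr ?_ (and_congr ?_ ?_)
  · rw [e]
    simp only [act_apply_apply]
    exact forall₂_congr fun i j => ⟨fun h1 h2 h3 => h1 ((h.lt_iff h3).2 h2) h3,
      fun h1 h2 h3 => h1 ((h.lt_iff h3).1 h2) h3⟩
  · rw [e]
    simp only [act_apply_apply]
    exact forall₂_congr fun i j => ⟨fun h1 h2 h3 => h1 ((h.lt_iff h3).2 h2) h3,
      fun h1 h2 h3 => h1 ((h.lt_iff h3).1 h2) h3⟩
  · rw [e]
    simp only [act_apply_apply]

/-- Each class of rows contains exactly one canonical row. -/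
theorem existsUnique_canonPair (ε : Kind) (a p₀ : Fin k → ℕ) :
    ∃! p, SameClass ε a p₀ p ∧ CanonPair ε a p := by
  obtain ⟨ρ, hρ, hanti⟩ := exists_stable_antitone a
  obtain ⟨p, ⟨h1, h2⟩, h3⟩ := existsUnique_canonPair_of_antitone ε hanti (act ρ p₀)
  refine ⟨act ρ⁻¹ p, ⟨?_, ?_⟩, fun q hq => ?_⟩
  · rw [← sameClass_act_iff ρ, act_act_inv]; exact h1
  · rw [← canonPair_act_iff hρ, act_act_inv]; exact h2
  · rw [← h3 (act ρ q) ⟨hq.1.act ρ, (canonPair_act_iff hρ q).2 hq.2⟩, act_inv_act]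

/-- All arguments of the binomials count columns of a given shape, so only the multiset of columns
matters. -/
theorem classProd_congr {K : Type*} [CommSemiring K] (t : K) (ε : Kind) (N : ℕ)
    {a p a' p' : Fin k → ℕ} (h : SameContent (fun i => (a i, p i)) fun i => (a' i, p' i)) :
    classProd t ε N a' p' = classProd t ε N a p := by
  have hc : ∀ Q : ℕ → ℕ → Prop, ∀ [∀ x y, Decidable (Q x y)],
      (Finset.univ.filter fun i => Q (a' i) (p' i)).card =
      (Finset.univ.filter fun i => Q (a i) (p i)).card := by
    intro Q _
    exact h.card_eq fun x => Q x.1 x.2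
  simp only [classProd, blockPos, Finset.filter_filter]
  congr 1
  · refine Finset.prod_congr rfl fun x _ => ?_
    congr 1
    · exact hc fun y z => y * (N + 2) ≤ x ∧ x ≤ code ε N (colLabel ε y z)
    · exact hc fun y z => code ε N (colLabel ε y z) = x
  · refine Finset.prod_congr rfl fun x _ => ?_
    congr 1
    · exact hc fun y z => InBlock ε y z ∧ Between ε y x z
    · exact hc fun y z => InBlock ε y z ∧ z = x

/-- The generating function of a class of rows. -/
theorem sum_rowClass_pairInv {K : Type*} [CommSemiring K] (t : K) {S : ℕ → ℕ → ℕ → ℕ → Prop}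
    (hS : IsQuinvQuadrupleSet S) {ε : Kind} (hE : ExtraOrder S ε) {N : ℕ} {a c : Fin k → ℕ}
    (ha : ∀ i, a i ≤ N) (hcN : ∀ i, c i ≤ N) (hc : CanonPair ε a c) :
    ∑ p ∈ rowClass ε N a c, t ^ pairInv S a p = t ^ pairInv S a c * classProd t ε N a c := by
  obtain ⟨ρ, hρ, hanti⟩ := exists_stable_antitone a
  have hcN' : ∀ i, act ρ c i ≤ N := fun i => hcN _
  rw [← classProd_congr t ε N (sameContent_act_act ρ a c),
    ← sum_rowClass t ε N _ _ hanti (fun i => ha _) hcN', Finset.mul_sum]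
  -- The constant value of `pairInv - excess` is therefore the number of quadruples of the canonical
  -- row.
  have h0 : excess ε N (act ρ a) (act ρ c) = 0 :=
    (excess_eq_zero_iff hanti hcN').2 ((canonPair_act_iff hρ c).2 hc)
  refine Finset.sum_nbij' (act ρ) (act ρ⁻¹) ?_ ?_ ?_ ?_ ?_
  · intro p hp
    rw [mem_rowClass hcN] at hp
    rw [mem_rowClass hcN']
    exact hp.act ρ
  · intro p hp
    rw [mem_rowClass hcN'] at hp
    rw [mem_rowClass hcN, ← sameClass_act_iff ρ, act_act_inv]
    exact hp
  · intro p _; exact act_inv_act ρ p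
  · intro p _; exact act_act_inv ρ p
  · intro p hp
    rw [mem_rowClass hcN] at hp
    have h := pairInv_add_excess hS hE hanti hcN' (hp.act ρ)
    rw [h0, add_zero, pairInv_act hS hρ, pairInv_act hS hρ] at h
    rw [← pow_add, h]

end Stable

/-! ### The family of a canonical rectangular filling -/

section Family

variable {n k : ℕ}

theorem isCanonicalRect_iff {ε : Kind} {σ : Rect n k} :
    IsCanonicalRect ε σ ↔ ∀ r < n, CanonPair ε (row σ (r + 1)) (row σ r) :=
  ⟨fun h r hr => h ⟨r, hr⟩, fun h r => h r r.2⟩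

theorem row_eq_of_mem_familyUpTo {ε : Kind} {σ τ : Rect n k} {m : ℕ} (h : τ ∈ familyUpTo ε σ m)
    {y : ℕ} (hy : m ≤ y) : row τ y = row σ y := by
  induction m generalizing τ with
  | zero => rw [Set.mem_singleton_iff.1 h]
  | succ m ih =>
    simp only [familyUpTo, Set.mem_iUnion] at h
    obtain ⟨τ', h1, h2⟩ := h
    obtain ⟨w, -, rfl⟩ := mem_familyStep.1 h2
    rw [row_drag_of_lt _ _ (by omega), ih h1 (by omega)]

/-- The last step read backwards: classes are symmetric and drags are invertible, so a predecessor
of `τ` is obtained from `τ` by rearranging row `m` within its class. -/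
theorem mem_familyUpTo_succ {ε : Kind} {σ τ : Rect n k} {m : ℕ} :
    τ ∈ familyUpTo ε σ (m + 1) ↔ ∃ w, SameClass ε (row τ (m + 1)) (row τ m) (act w (row τ m)) ∧
      drag m w τ ∈ familyUpTo ε σ m := by
  simp only [familyUpTo, Set.mem_iUnion]
  constructor
  · rintro ⟨τ', h1, h2⟩
    obtain ⟨w, h3, rfl⟩ := mem_familyStep.1 h2
    refine ⟨w⁻¹, ?_, ?_⟩
    · rw [row_drag_self, row_drag_of_lt _ _ (Nat.lt_succ_self m), act_inv_act]
      exact h3.symm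
    · rw [← drag_mul, inv_mul_cancel, drag_one]
      exact h1
  · rintro ⟨w, h1, h2⟩
    refine ⟨_, h2, mem_familyStep.2 ⟨w⁻¹, ?_, ?_⟩⟩
    · rw [row_drag_self, row_drag_of_lt _ _ (Nat.lt_succ_self m), act_inv_act]
      exact h1.symm
    · rw [← drag_mul, inv_mul_cancel, drag_one]

/-- A predecessor of `τ` still has rows `m` and `m + 1` of `σ`. If `σ` is canonical there, row `m`
of the predecessor is the unique canonical row of the class, so the predecessor is determined and
the induction continues below. -/
theorem existsUnique_familyUpTo (ε : Kind) (m : ℕ) (τ : Rect n k) :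
    ∃! σ : Rect n k, (∀ r < m, CanonPair ε (row σ (r + 1)) (row σ r)) ∧ τ ∈ familyUpTo ε σ m := by
  induction m generalizing τ with
  | zero =>
    exact ⟨τ, ⟨fun r hr => by omega, rfl⟩, fun σ hσ => (Set.mem_singleton_iff.1 hσ.2).symm⟩
  | succ m ih =>
    obtain ⟨c, ⟨hc1, hc2⟩, hc3⟩ := existsUnique_canonPair ε (row τ (m + 1)) (row τ m)
    obtain ⟨w, rfl⟩ := exists_act_of_sameContent hc1.1
    obtain ⟨σ, ⟨h1, h2⟩, h3⟩ := ih (drag m w τ)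
    have e1 := row_eq_of_mem_familyUpTo h2 le_rfl
    have e2 := row_eq_of_mem_familyUpTo h2 (Nat.le_succ m)
    rw [row_drag_self] at e1
    rw [row_drag_of_lt _ _ (Nat.lt_succ_self m)] at e2
    refine ⟨σ, ⟨fun r hr => ?_, mem_familyUpTo_succ.2 ⟨w, hc1, h2⟩⟩, fun σ' hσ' => ?_⟩
    · rcases (Nat.le_of_lt_succ hr).eq_or_lt with rfl | hr'
      · rw [← e1, ← e2]; exact hc2
      · exact h1 r hr'
    · obtain ⟨hs1, hs2⟩ := hσ'
      obtain ⟨v, hv1, hv2⟩ := mem_familyUpTo_succ.1 hs2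
      have e1' := row_eq_of_mem_familyUpTo hv2 le_rfl
      have e2' := row_eq_of_mem_familyUpTo hv2 (Nat.le_succ m)
      rw [row_drag_self] at e1'
      rw [row_drag_of_lt _ _ (Nat.lt_succ_self m)] at e2'
      have hv3 : act v (row τ m) = act w (row τ m) := by
        refine hc3 _ ⟨hv1, ?_⟩
        have := hs1 m (Nat.lt_succ_self m)
        rwa [← e1', ← e2'] at this
      refine h3 σ' ⟨fun r hr => hs1 r (by omega), ?_⟩
      rw [← drag_congr hv3]
      exact hv2

/-- The families of the canonical rectangular fillings partition the fillings. -/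
theorem existsUnique_familyRect (ε : Kind) (τ : Rect n k) :
    ∃! σ : Rect n k, IsCanonicalRect ε σ ∧ τ ∈ familyRect ε σ := by
  simp only [isCanonicalRect_iff]
  exact existsUnique_familyUpTo ε n τ

/-- The number of descents between the rows `r + 1` and `r`. -/
def numDescents (τ : Rect n k) (r : ℕ) : ℕ :=
  (Finset.univ.filter fun i => row τ r i < row τ (r + 1) i).card

/-- The fillings have the same row contents and the same numbers of descents in each row. -/
def SameType (σ τ : Rect n k) : Prop :=
  ∀ r, SameContent (row σ r) (row τ r) ∧ numDescents τ r = numDescents σ r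

/-- On two consecutive rows below the row `r`, the operator acts by one stable permutation. -/
theorem exists_row_drag {r y : ℕ} (w : Equiv.Perm (Fin k)) (τ : Rect n k) (h : y < r) :
    ∃ ρ, Stable ρ (row τ (y + 1)) ∧ row (drag r w τ) (y + 1) = act ρ (row τ (y + 1)) ∧
      row (drag r w τ) y = act ρ (row τ y) := by
  have h' : y + 1 ≤ r := h
  refine ⟨std (dragPerm τ r w (r - (y + 1))) (row τ (y + 1)), stable_std _ _, ?_, ?_⟩
  · rw [row_drag_of_le _ _ h', act_std]
  · rw [row_drag_of_le _ _ h.le, show r - y = (r - (y + 1)) + 1 by omega, dragPerm,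
      Nat.sub_sub_self h']

theorem numDescents_drag_of_lt {r y : ℕ} (w : Equiv.Perm (Fin k)) (τ : Rect n k) (h : y < r) :
    numDescents (drag r w τ) y = numDescents τ y := by
  unfold numDescents
  obtain ⟨ρ, -, h1, h2⟩ := exists_row_drag w τ h
  rw [h1, h2]
  exact (sameContent_act_act _ (row τ (y + 1)) (row τ y)).card_eq fun x => x.2 < x.1

theorem SameClass.card_descents {ε : Kind} {a p p' : Fin k → ℕ} (h : SameClass ε a p p') :
    (Finset.univ.filter fun i => p' i < a i).card = (Finset.univ.filter fun i => p i < a i).card := by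
  classical
  have e : ∀ p : Fin k → ℕ, (Finset.univ.filter fun i => p i < a i) =
      Finset.univ.filter fun i => ((label ε a p i).2 = none ↔ ε = .dagger) := by
    intro p
    refine Finset.filter_congr fun i _ => ?_
    have hl : (label ε a p i).2 = none ↔ InBlock ε (a i) (p i) := by
      by_cases hi : InBlock ε (a i) (p i) <;> simp [label, hi]
    rw [hl]
    cases ε <;> simp [InBlock]
  rw [e p, e p']
  exact h.2.card_eq fun L => (L.2 = none ↔ ε = .dagger)

/-- Below row `m` whole pairs of adjacent entries are permuted, and at row `m` the labels tell which
columns are descents. This invariance makes all statistics other than the quadruple count constant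
on a family. -/
theorem sameType_of_mem_familyUpTo {ε : Kind} {σ τ : Rect n k} {m : ℕ}
    (h : τ ∈ familyUpTo ε σ m) : SameType σ τ := by
  induction m generalizing τ with
  | zero =>
    rw [Set.mem_singleton_iff.1 h]
    exact fun r => ⟨SameContent.refl _, rfl⟩
  | succ m ih =>
    obtain ⟨w, h1, h2⟩ := mem_familyUpTo_succ.1 h
    intro r
    obtain ⟨h3, h4⟩ := ih h2 r
    rw [← h4]
    refine ⟨h3.trans ?_, ?_⟩
    · rcases le_or_gt r m with hr | hr
      · rw [row_drag_of_le _ _ hr]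
        exact (sameContent_act _ _).symm
      · rw [row_drag_of_lt _ _ hr]
        exact SameContent.refl _
    · rcases lt_trichotomy r m with hr | rfl | hr
      · rw [numDescents_drag_of_lt _ _ hr]
      · unfold numDescents
        rw [row_drag_self, row_drag_of_lt _ _ (Nat.lt_succ_self r)]
        exact h1.card_descents.symm
      · unfold numDescents
        rw [row_drag_of_lt _ _ hr, row_drag_of_lt _ _ (by omega)]

end Family

/-! ### The generating function of a family -/

section FamilySum

variable {n k : ℕ}

theorem finite_familyUpTo (ε : Kind) (σ : Rect n k) (m : ℕ) : (familyUpTo ε σ m).Finite := by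
  induction m with
  | zero => exact Set.finite_singleton σ
  | succ m ih =>
    refine Set.Finite.biUnion ih fun τ _ => ?_
    refine (Set.finite_range fun w => drag m w τ).subset fun ρ hρ => ?_
    obtain ⟨w, -, rfl⟩ := mem_familyStep.1 hρ
    exact ⟨w, rfl⟩

/-- The number of `S`-quadruples of a rectangular filling. -/
def etaRect (S : ℕ → ℕ → ℕ → ℕ → Prop) (τ : Rect n k) : ℕ :=
  ∑ r ∈ Finset.range n, pairInv S (row τ (r + 1)) (row τ r)

/-- Only the rows `m + 1` and `m` contribute to the change: two adjacent rows below are moved by one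
stable permutation, and rows above not at all. -/
theorem etaRect_drag {S : ℕ → ℕ → ℕ → ℕ → Prop} (hS : IsQuinvQuadrupleSet S) {m : ℕ} (hm : m < n)
    (w : Equiv.Perm (Fin k)) (τ : Rect n k) :
    etaRect S (drag m w τ) + pairInv S (row τ (m + 1)) (row τ m) =
      etaRect S τ + pairInv S (row τ (m + 1)) (act w (row τ m)) := by
  unfold etaRect
  rw [← Finset.add_sum_erase _ _ (Finset.mem_range.2 hm),
    ← Finset.add_sum_erase (a := m) _ (fun r => pairInv S (row τ (r + 1)) (row τ r))
      (Finset.mem_range.2 hm)]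
  have h : ∑ r ∈ (Finset.range n).erase m,
      pairInv S (row (drag m w τ) (r + 1)) (row (drag m w τ) r) =
      ∑ r ∈ (Finset.range n).erase m, pairInv S (row τ (r + 1)) (row τ r) := by
    refine Finset.sum_congr rfl fun r hr => ?_
    rcases lt_or_gt_of_ne (Finset.ne_of_mem_erase hr) with h | h
    · obtain ⟨ρ, h0, h1, h2⟩ := exists_row_drag w τ h
      rw [h1, h2, pairInv_act hS h0]
    · rw [row_drag_of_lt _ _ h, row_drag_of_lt _ _ (by omega)]
  rw [h, row_drag_self, row_drag_of_lt _ _ (Nat.lt_succ_self m)]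
  ring

open scoped Classical in
/-- The filling obtained by rearranging row `m` to `p` and dragging along the rows below. -/
def moveTo (m : ℕ) (τ : Rect n k) (p : Fin k → ℕ) : Rect n k :=
  if h : ∃ w, act w (row τ m) = p then drag m h.choose τ else τ

theorem moveTo_eq {m : ℕ} {τ : Rect n k} {p : Fin k → ℕ} {w : Equiv.Perm (Fin k)}
    (h : act w (row τ m) = p) : moveTo m τ p = drag m w τ := by
  have h' : ∃ w, act w (row τ m) = p := ⟨w, h⟩
  rw [moveTo, dif_pos h']
  exact drag_congr (h'.choose_spec.trans h.symm)

/-- A member of the new family corresponds to a member of the old one together with a row of the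
class of row `m` of `σ`; moving row `m` back to that of `σ` recovers the old member. -/
theorem sum_familyUpTo_succ {K : Type*} [AddCommMonoid K] (ε : Kind) (σ : Rect n k) (m : ℕ) {N : ℕ}
    (hN : ∀ r i, row σ r i ≤ N) (f : Rect n k → K) :
    ∑ τ ∈ (finite_familyUpTo ε σ (m + 1)).toFinset, f τ =
      ∑ τ ∈ (finite_familyUpTo ε σ m).toFinset,
        ∑ p ∈ rowClass ε N (row σ (m + 1)) (row σ m), f (moveTo m τ p) := by
  rw [← Finset.sum_product']
  have key : ∀ τ ∈ familyUpTo ε σ (m + 1), moveTo m τ (row σ m) ∈ familyUpTo ε σ m ∧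
      SameClass ε (row σ (m + 1)) (row σ m) (row τ m) ∧
      moveTo m (moveTo m τ (row σ m)) (row τ m) = τ := by
    intro τ hτ
    obtain ⟨w, h1, h2⟩ := mem_familyUpTo_succ.1 hτ
    have e := row_eq_of_mem_familyUpTo h2 le_rfl
    rw [row_drag_self] at e
    have e2 := row_eq_of_mem_familyUpTo hτ le_rfl
    rw [moveTo_eq e]
    refine ⟨h2, ?_, ?_⟩
    · rw [← e, ← e2]; exact h1.symm
    · rw [moveTo_eq (w := w⁻¹), ← drag_mul, inv_mul_cancel, drag_one]
      rw [row_drag_self, act_inv_act]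
  refine Finset.sum_nbij' (fun τ => (moveTo m τ (row σ m), row τ m)) (fun x => moveTo m x.1 x.2)
    ?_ ?_ ?_ ?_ ?_
  · intro τ hτ
    rw [Set.Finite.mem_toFinset] at hτ
    obtain ⟨h1, h2, -⟩ := key τ hτ
    rw [Finset.mem_product, Set.Finite.mem_toFinset, mem_rowClass (hN m)]
    exact ⟨h1, h2⟩
  · rintro ⟨τ, p⟩ hx
    rw [Finset.mem_product, Set.Finite.mem_toFinset, mem_rowClass (hN m)] at hx
    obtain ⟨h1, h2⟩ := hx
    obtain ⟨w, hw⟩ := exists_act_of_sameContent h2.1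
    have e := row_eq_of_mem_familyUpTo h1 le_rfl
    have e2 := row_eq_of_mem_familyUpTo h1 (Nat.le_succ m)
    rw [← e] at hw h2
    rw [← e2] at h2
    rw [Set.Finite.mem_toFinset]
    simp only [familyUpTo, Set.mem_iUnion]
    rw [moveTo_eq hw]
    exact ⟨τ, h1, mem_familyStep.2 ⟨w, by rw [hw]; exact h2, rfl⟩⟩
  · intro τ hτ
    rw [Set.Finite.mem_toFinset] at hτ
    exact (key τ hτ).2.2
  · rintro ⟨τ, p⟩ hx
    rw [Finset.mem_product, Set.Finite.mem_toFinset, mem_rowClass (hN m)] at hx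
    obtain ⟨h1, h2⟩ := hx
    obtain ⟨w, hw⟩ := exists_act_of_sameContent h2.1
    have e := row_eq_of_mem_familyUpTo h1 le_rfl
    rw [← e] at hw
    dsimp only
    rw [moveTo_eq hw, row_drag_self, hw, moveTo_eq (w := w⁻¹), ← drag_mul, inv_mul_cancel, drag_one]
    rw [row_drag_self, act_inv_act, e]
  · intro τ hτ
    rw [Set.Finite.mem_toFinset] at hτ
    dsimp only
    rw [(key τ hτ).2.2]

theorem sum_familyUpTo {K : Type*} [CommSemiring K] (t : K) {S : ℕ → ℕ → ℕ → ℕ → Prop}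
    (hS : IsQuinvQuadrupleSet S) {ε : Kind} (hE : ExtraOrder S ε) {N : ℕ} {σ : Rect n k}
    (hσ : IsCanonicalRect ε σ) (hN : ∀ r i, row σ r i ≤ N) (m : ℕ) (hm : m ≤ n) :
    ∑ τ ∈ (finite_familyUpTo ε σ m).toFinset, t ^ etaRect S τ =
      t ^ etaRect S σ * ∏ r ∈ Finset.range m, classProd t ε N (row σ (r + 1)) (row σ r) := by
  rw [isCanonicalRect_iff] at hσ
  induction m with
  | zero =>
    have : (finite_familyUpTo ε σ 0).toFinset = {σ} := by
      ext τ; simp [familyUpTo]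
    rw [this]; simp
  | succ m ih =>
    rw [sum_familyUpTo_succ ε σ m hN, Finset.prod_range_succ, ← mul_assoc, ← ih (by omega),
      Finset.sum_mul]
    refine Finset.sum_congr rfl fun τ hτ => ?_
    rw [Set.Finite.mem_toFinset] at hτ
    have e := row_eq_of_mem_familyUpTo hτ le_rfl
    have e2 : row τ (m + 1) = row σ (m + 1) := row_eq_of_mem_familyUpTo hτ (Nat.le_succ m)
    -- All members of the old family have the rows `m` and `m + 1` of `σ`, so this summand can be
    -- split off and the factor of the class is the same for each of them.
    have hle : pairInv S (row σ (m + 1)) (row σ m) ≤ etaRect S τ := by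
      rw [← e, ← e2]
      exact Finset.single_le_sum (f := fun r => pairInv S (row τ (r + 1)) (row τ r))
        (fun _ _ => Nat.zero_le _) (Finset.mem_range.2 (show m < n by omega))
    obtain ⟨E, hE'⟩ := Nat.exists_eq_add_of_le hle
    have h1 : ∀ p ∈ rowClass ε N (row σ (m + 1)) (row σ m),
        t ^ etaRect S (moveTo m τ p) = t ^ E * t ^ pairInv S (row σ (m + 1)) p := by
      intro p hp
      rw [mem_rowClass (hN m)] at hp
      obtain ⟨w, hw⟩ := exists_act_of_sameContent hp.1
      rw [← e] at hw
      rw [moveTo_eq hw, ← pow_add]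
      have := etaRect_drag hS (show m < n by omega) w τ
      rw [hw, e, e2] at this
      congr 1
      omega
    rw [Finset.sum_congr rfl h1, ← Finset.mul_sum,
      sum_rowClass_pairInv t hS hE (hN (m + 1)) (hN m) (hσ m (by omega)), hE', pow_add]
    ring

end FamilySum

/-! ### `t`-binomial coefficients -/

section TBinom

/-- The polynomial has the value `m` at `t = 1`. -/
theorem tInt_ne_zero {m : ℕ} (hm : m ≠ 0) : ∑ i ∈ Finset.range m, tv ^ i ≠ 0 := by
  have h : ∑ i ∈ Finset.range m, tv ^ i =
      algebraMap (MvPolynomial (Fin 2) ℚ) Kqt (∑ i ∈ Finset.range m, MvPolynomial.X 1 ^ i) := by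
    simp [tv, map_sum]
  rw [h]
  refine (map_ne_zero_iff _ (IsFractionRing.injective (MvPolynomial (Fin 2) ℚ) Kqt)).2 fun h0 => ?_
  have := congrArg (MvPolynomial.eval fun _ => (1 : ℚ)) h0
  simp at this
  exact hm this

theorem tFactorial_zero : tFactorial 0 = 1 := by simp [tFactorial]

theorem tFactorial_succ (n : ℕ) :
    tFactorial (n + 1) = tFactorial n * ∑ i ∈ Finset.range (n + 1), tv ^ i := by
  rw [tFactorial, Finset.prod_Icc_succ_top (by omega), tFactorial]

theorem tFactorial_ne_zero (n : ℕ) : tFactorial n ≠ 0 := by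
  induction n with
  | zero => rw [tFactorial_zero]; exact one_ne_zero
  | succ n ih => rw [tFactorial_succ]; exact mul_ne_zero ih (tInt_ne_zero (by omega))

theorem tBinom_add (m c : ℕ) :
    tBinom (c + m) c = tFactorial (c + m) / (tFactorial c * tFactorial m) := by
  rw [tBinom, if_pos (by omega), Nat.add_sub_cancel_left]

theorem gaussBinom_tv (n c : ℕ) : gaussBinom tv n c = tBinom n c := by
  induction n generalizing c with
  | zero =>
    cases c with
    | zero => simp [tBinom, tFactorial_zero]
    | succ c => simp [tBinom]
  | succ n ih =>
    cases c with
    | zero =>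
      have := tFactorial_ne_zero (n + 1)
      simp [tBinom, tFactorial_zero, this]
    | succ c =>
      rcases lt_trichotomy c n with h | rfl | h
      · obtain ⟨m, rfl⟩ : ∃ m, n = c + (m + 1) := ⟨n - c - 1, by omega⟩
        rw [gaussBinom_succ_succ, ih, ih, tBinom_add, show c + (m + 1) = (c + 1) + m by ring,
          tBinom_add, show c + 1 + m + 1 = (c + 1) + (m + 1) by ring, tBinom_add,
          show c + 1 + (m + 1) = (c + 1 + m) + 1 by ring, tFactorial_succ (c + 1 + m),
          tFactorial_succ c, tFactorial_succ m]
        have h1 := tFactorial_ne_zero c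
        have h2 := tFactorial_ne_zero m
        have h3 := tInt_ne_zero (m := c + 1) (by omega)
        have h4 := tInt_ne_zero (m := m + 1) (by omega)
        -- The identity [c+1+m+1] = [c+1] + t^(c+1) [m+1] is what turns the Pascal recursion into
        -- the quotient of factorials.
        have h5 : ∑ i ∈ Finset.range (c + 1 + m + 1), tv ^ i =
            ∑ i ∈ Finset.range (c + 1), tv ^ i +
              tv ^ (c + 1) * ∑ i ∈ Finset.range (m + 1), tv ^ i := by
          rw [show c + 1 + m + 1 = (c + 1) + (m + 1) by ring, Finset.sum_range_add, Finset.mul_sum]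
          simp only [pow_add]
        rw [h5]
        field_simp
      · have := tFactorial_ne_zero (c + 1)
        rw [gaussBinom_self, tBinom, if_pos le_rfl, Nat.sub_self, tFactorial_zero, mul_one,
          div_self this]
      · rw [gaussBinom_eq_zero_of_lt _ (by omega), tBinom, if_neg (by omega)]

/-- A telescoping product of `t`-binomial coefficients. -/
theorem prod_tBinom_telescope (f g : ℕ → ℕ) (M : ℕ) (h : ∀ c < M, f c = g c + f (c + 1)) :
    ∏ c ∈ Finset.range M, tBinom (f c) (g c) =
      tFactorial (f 0) / (tFactorial (f M) * ∏ c ∈ Finset.range M, tFactorial (g c)) := by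
  induction M with
  | zero => simp [tFactorial_ne_zero]
  | succ M ih =>
    rw [Finset.prod_range_succ, ih fun c hc => h c (by omega), Finset.prod_range_succ,
      h M (by omega), tBinom_add]
    have h1 := tFactorial_ne_zero (g M + f (M + 1))
    have h2 := tFactorial_ne_zero (g M)
    have h3 := tFactorial_ne_zero (f (M + 1))
    have h4 : ∏ c ∈ Finset.range M, tFactorial (g c) ≠ 0 :=
      Finset.prod_ne_zero_iff.2 fun c _ => tFactorial_ne_zero _
    field_simp

theorem tBinom_symm {n c m : ℕ} (h : n = c + m) :
    tBinom n m = tFactorial n / (tFactorial m * tFactorial c) := by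
  rw [h, add_comm, tBinom_add]

/-- An increasing telescoping product of `t`-binomial coefficients. -/
theorem prod_Ico_tBinom_telescope (s g : ℕ → ℕ) (l N : ℕ) (hl : l ≤ N)
    (h : ∀ m, l ≤ m → m < N → s (m + 1) = g m + s m) :
    ∏ m ∈ Finset.Ico l N, tBinom (s (m + 1)) (s m) =
      tFactorial (s N) / (tFactorial (s l) * ∏ m ∈ Finset.Ico l N, tFactorial (g m)) := by
  induction N, hl using Nat.le_induction with
  | base => simp [tFactorial_ne_zero]
  | succ N hN ih =>
    rw [Finset.prod_Ico_succ_top hN, Finset.prod_Ico_succ_top hN,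
      ih fun m h1 h2 => h m h1 (by omega), h N hN (by omega), tBinom_symm rfl]
    have h1 := tFactorial_ne_zero (g N + s N)
    have h2 := tFactorial_ne_zero (g N)
    have h3 := tFactorial_ne_zero (s N)
    have h5 := tFactorial_ne_zero (s l)
    have h4 : ∏ m ∈ Finset.Ico l N, tFactorial (g m) ≠ 0 :=
      Finset.prod_ne_zero_iff.2 fun c _ => tFactorial_ne_zero _
    field_simp

end TBinom

/-! ### Column counts -/

section ColCount

variable {k : ℕ}

open scoped Classical in
/-- The number of columns with a given property. -/
def colCount (a p : Fin k → ℕ) (Q : ℕ → ℕ → Prop) : ℕ :=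
  (Finset.univ.filter fun i => Q (a i) (p i)).card

theorem card_eq_colCount {a p : Fin k → ℕ} {Q : ℕ → ℕ → Prop}
    [DecidablePred fun i => Q (a i) (p i)] :
    (Finset.univ.filter fun i => Q (a i) (p i)).card = colCount a p Q := by
  unfold colCount
  congr

theorem colCount_congr {a p : Fin k → ℕ} {Q R : ℕ → ℕ → Prop}
    (h : ∀ i, Q (a i) (p i) ↔ R (a i) (p i)) : colCount a p Q = colCount a p R := by
  classical
  unfold colCount
  congr 1
  ext i
  simp [h i]

theorem colCount_add {a p : Fin k → ℕ} {Q R T : ℕ → ℕ → Prop}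
    (h : ∀ i, T (a i) (p i) ↔ Q (a i) (p i) ∨ R (a i) (p i))
    (hd : ∀ i, Q (a i) (p i) → ¬ R (a i) (p i)) :
    colCount a p T = colCount a p Q + colCount a p R := by
  classical
  unfold colCount
  rw [← Finset.card_union_of_disjoint, ← Finset.filter_or]
  · congr 1
    exact Finset.filter_congr fun i _ => h i
  · rw [Finset.disjoint_filter]
    exact fun i _ => hd i

theorem colCount_eq_zero {a p : Fin k → ℕ} {Q : ℕ → ℕ → Prop} (h : ∀ i, ¬ Q (a i) (p i)) :
    colCount a p Q = 0 := by
  classical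
  unfold colCount
  rw [Finset.card_eq_zero]
  ext i
  simp [h i]

theorem colCount_univ {a p : Fin k → ℕ} {Q : ℕ → ℕ → Prop} (h : ∀ i, Q (a i) (p i)) :
    colCount a p Q = k := by
  classical
  unfold colCount
  simp [h]

theorem tFactorial_colCount_eq_one {a p : Fin k → ℕ} {Q : ℕ → ℕ → Prop}
    (h : ∀ i, ¬ Q (a i) (p i)) : tFactorial (colCount a p Q) = 1 := by
  rw [colCount_eq_zero h, tFactorial_zero]

theorem sum_colCount {a p : Fin k → ℕ} {κ : Type*} (s : Finset κ) (Q : κ → ℕ → ℕ → Prop)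
    (T : ℕ → ℕ → Prop) (h : ∀ i, T (a i) (p i) ↔ ∃ l ∈ s, Q l (a i) (p i))
    (hd : ∀ l ∈ s, ∀ l' ∈ s, ∀ i, Q l (a i) (p i) → Q l' (a i) (p i) → l = l') :
    ∑ l ∈ s, colCount a p (Q l) = colCount a p T := by
  classical
  induction s using Finset.induction_on generalizing T with
  | empty => simp [colCount_eq_zero (Q := T) fun i hi => by simpa using (h i).1 hi]
  | insert l s hl ih =>
    rw [Finset.sum_insert hl, ih (fun x y => ∃ l ∈ s, Q l x y) (fun i => Iff.rfl)
      (fun l h1 l' h2 => hd l (Finset.mem_insert_of_mem h1) l' (Finset.mem_insert_of_mem h2)),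
      ← colCount_add (T := T)]
    · intro i
      rw [h i]
      simp
    · rintro i h1 ⟨l', h2, h3⟩
      have := hd l (Finset.mem_insert_self _ _) l' (Finset.mem_insert_of_mem h2) i h1 h3
      exact hl (this ▸ h2)

/-- The contribution of the entry `x` of the non-descent (`diamond`), resp. descent (`dagger`) block
to the coefficient of two consecutive rows. -/
def blockTerm (ε : Kind) (a p : Fin k → ℕ) (x : ℕ) : Kqt :=
  tFactorial (colCount a p fun y z => Between ε y x z) /
    (tFactorial (colCount a p fun y z => Between ε y x z ∧ z ≠ x) *
      tFactorial (colCount a p fun y z => InBlock ε y z ∧ z = x))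

/-- The contribution of the neutral block of the entry `A` to the coefficient of two consecutive
rows. -/
def neutralTerm (ε : Kind) (M : ℕ) (a p : Fin k → ℕ) (A : ℕ) : Kqt :=
  tFactorial (colCount a p fun y _ => y = A) /
    (tFactorial (colCount a p fun y z => y = A ∧ InBlock ε y z) *
      ∏ B ∈ Finset.range M, tFactorial (colCount a p fun y z => (y = A ∧ ¬ InBlock ε y z) ∧ z = B))

/-- The coefficient of two consecutive rows with entries less than `M`. -/
def rowCoeff (ε : Kind) (M : ℕ) (a p : Fin k → ℕ) : Kqt :=
  (∏ x ∈ Finset.range M, blockTerm ε a p x) * ∏ A ∈ Finset.range M, neutralTerm ε M a p A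

theorem prod_range_mul {K : Type*} [CommMonoid K] (m n : ℕ) (f : ℕ → K) :
    ∏ x ∈ Finset.range (m * n), f x =
      ∏ i ∈ Finset.range m, ∏ j ∈ Finset.range n, f (i * n + j) := by
  induction m with
  | zero => simp
  | succ m ih => rw [Nat.succ_mul, Finset.prod_range_add, ih, Finset.prod_range_succ]

theorem between_iff {ε : Kind} {y x z : ℕ} (h : InBlock ε y z) :
    Between ε y x z ↔ (Between ε y x z ∧ z ≠ x) ∨ (InBlock ε y z ∧ z = x) := by
  cases ε <;> simp only [Between, InBlock] at * <;> omega

theorem inBlock_of_between {ε : Kind} {y x z : ℕ} (h : Between ε y x z) : InBlock ε y z := by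
  cases ε <;> simp only [Between, InBlock] at * <;> omega

theorem colCount_between (ε : Kind) (a p : Fin k → ℕ) (x : ℕ) :
    colCount a p (fun y z => Between ε y x z) =
      colCount a p (fun y z => InBlock ε y z ∧ z = x) +
        colCount a p fun y z => Between ε y x z ∧ z ≠ x := by
  rw [add_comm]
  refine colCount_add (fun i => ?_) fun i h => fun h' => h.2 h'.2
  by_cases h : InBlock ε (a i) (p i)
  · exact between_iff h
  · exact ⟨fun h' => absurd (inBlock_of_between h') h, by
      rintro (h' | h')
      · exact h'.1
      · exact absurd h'.1 h⟩

theorem code_between_iff {ε : Kind} {N A c : ℕ} {L : ℕ × Option ℕ} (hL : ∀ b ∈ L.2, b ≤ N)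
    (hc : c < N + 2) :
    (L.1 * (N + 2) ≤ A * (N + 2) + c ∧ A * (N + 2) + c ≤ code ε N L) ↔
      L.1 = A ∧ c ≤ offset ε N L.2 := by
  have h1 := offset_lt (ε := ε) hL
  rw [code]
  rcases lt_trichotomy L.1 A with h | h | h
  · have := Nat.mul_le_mul_right (N + 2) (Nat.succ_le_of_lt h)
    rw [Nat.succ_mul] at this
    omega
  · rw [h]
    omega
  · have := Nat.mul_le_mul_right (N + 2) (Nat.succ_le_of_lt h)
    rw [Nat.succ_mul] at this
    omega

theorem code_eq_iff {ε : Kind} {N A c : ℕ} {L : ℕ × Option ℕ} (hL : ∀ b ∈ L.2, b ≤ N)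
    (hc : c < N + 2) : code ε N L = A * (N + 2) + c ↔ L.1 = A ∧ offset ε N L.2 = c := by
  have h1 := offset_lt (ε := ε) hL
  rw [code]
  rcases lt_trichotomy L.1 A with h | h | h
  · have := Nat.mul_le_mul_right (N + 2) (Nat.succ_le_of_lt h)
    rw [Nat.succ_mul] at this
    omega
  · rw [h]
    omega
  · have := Nat.mul_le_mul_right (N + 2) (Nat.succ_le_of_lt h)
    rw [Nat.succ_mul] at this
    omega

theorem offset_colLabel_diamond (N y z : ℕ) :
    offset .diamond N (colLabel .diamond y z).2 = if y ≤ z then 0 else z + 1 :=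
  offset_label_diamond (ι := Unit) N (fun _ => y) (fun _ => z) ()

theorem offset_colLabel_dagger (N y z : ℕ) :
    offset .dagger N (colLabel .dagger y z).2 = if z < y then N + 1 else z :=
  offset_label_dagger (ι := Unit) N (fun _ => y) (fun _ => z) ()

/-- One extreme offset (`0` for `diamond`, `N + 1` for `dagger`) belongs to the block columns; the
others enumerate the remaining lower entries. -/
theorem prod_offset (ε : Kind) (N : ℕ) {a p : Fin k → ℕ} (hp : ∀ i, p i ≤ N) (A : ℕ) :
    ∏ c ∈ Finset.range (N + 2), tFactorial (colCount a p fun y z =>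
      y = A ∧ offset ε N (colLabel ε y z).2 = c) =
    tFactorial (colCount a p fun y z => y = A ∧ InBlock ε y z) *
      ∏ B ∈ Finset.range (N + 1),
        tFactorial (colCount a p fun y z => (y = A ∧ ¬ InBlock ε y z) ∧ z = B) := by
  cases ε with
  | diamond =>
    rw [Finset.prod_range_succ', mul_comm]
    congr 1
    · congr 1
      refine colCount_congr fun i => ?_
      rw [offset_colLabel_diamond]
      by_cases h : a i ≤ p i <;> simp [InBlock, h]
    · refine Finset.prod_congr rfl fun B _ => ?_
      congr 1
      refine colCount_congr fun i => ?_
      rw [offset_colLabel_diamond]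
      by_cases h : a i ≤ p i <;> simp [InBlock, h]
  | dagger =>
    rw [Finset.prod_range_succ, mul_comm]
    congr 1
    · congr 1
      refine colCount_congr fun i => ?_
      have := hp i
      rw [offset_colLabel_dagger]
      by_cases h : p i < a i <;> simp [InBlock, h]; omega
    · refine Finset.prod_congr rfl fun B hB => ?_
      have := Finset.mem_range.1 hB
      congr 1
      refine colCount_congr fun i => ?_
      rw [offset_colLabel_dagger]
      by_cases h : p i < a i <;> simp [InBlock, h]; omega

/-- The product over the codes is cut into neutral blocks, and in each of them the binomials
telescope over the offsets to a `t`-multinomial coefficient. -/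
theorem classProd_tv (ε : Kind) {N : ℕ} {a p : Fin k → ℕ} (hp : ∀ i, p i ≤ N) :
    classProd tv ε N a p = rowCoeff ε (N + 1) a p := by
  rw [classProd, rowCoeff, mul_comm]
  congr 1
  · refine Finset.prod_congr rfl fun x _ => ?_
    rw [gaussBinom_tv, blockPos, Finset.filter_filter, Finset.filter_filter,
      card_eq_colCount (Q := fun y z => InBlock ε y z ∧ Between ε y x z),
      card_eq_colCount (Q := fun y z => InBlock ε y z ∧ z = x),
      colCount_congr (R := fun y z => Between ε y x z)
        fun i => ⟨fun h => h.2, fun h => ⟨inBlock_of_between h, h⟩⟩,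
      colCount_between, tBinom_add, blockTerm, colCount_between, mul_comm (tFactorial _)]
  · rw [prod_range_mul]
    refine Finset.prod_congr rfl fun A _ => ?_
    have hlab : ∀ i, ∀ b ∈ (colLabel ε (a i) (p i)).2, b ≤ N := fun i =>
      label_le (ε := ε) (a := a) (hp i)
    have h1 : ∀ c ∈ Finset.range (N + 2), gaussBinom tv
        (Finset.univ.filter fun i => a i * (N + 2) ≤ A * (N + 2) + c ∧
          A * (N + 2) + c ≤ code ε N (label ε a p i)).card
        (Finset.univ.filter fun i => code ε N (label ε a p i) = A * (N + 2) + c).card =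
        tBinom (colCount a p fun y z => y = A ∧ c ≤ offset ε N (colLabel ε y z).2)
          (colCount a p fun y z => y = A ∧ offset ε N (colLabel ε y z).2 = c) := by
      intro c hc
      have hc := Finset.mem_range.1 hc
      rw [gaussBinom_tv]
      congr 1
      · refine (card_eq_colCount (a := a) (p := p) (Q := fun y z => y * (N + 2) ≤ A * (N + 2) + c ∧
          A * (N + 2) + c ≤ code ε N (colLabel ε y z))).trans (colCount_congr fun i => ?_)
        exact code_between_iff (ε := ε) (L := colLabel ε (a i) (p i)) (hlab i) hc
      · refine (card_eq_colCount (a := a) (p := p) (Q := fun y z =>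
          code ε N (colLabel ε y z) = A * (N + 2) + c)).trans (colCount_congr fun i => ?_)
        exact code_eq_iff (L := colLabel ε (a i) (p i)) (hlab i) hc
    rw [Finset.prod_congr rfl h1, prod_tBinom_telescope
      (fun c => colCount a p fun y z => y = A ∧ c ≤ offset ε N (colLabel ε y z).2)
      (fun c => colCount a p fun y z => y = A ∧ offset ε N (colLabel ε y z).2 = c),
      prod_offset ε N hp, neutralTerm, tFactorial_colCount_eq_one (Q := fun y z =>
        y = A ∧ N + 2 ≤ offset ε N (colLabel ε y z).2), one_mul]
    · congr 2
      exact colCount_congr fun i => by simp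
    · intro i h
      have := offset_lt (ε := ε) (hlab i)
      omega
    · intro c _
      refine colCount_add (fun i => ?_) fun i => ?_
      · omega
      · omega

end ColCount

/-! ### The coefficient of two rows: trivial factors and the row of zeros -/

section Coefficients

variable {k : ℕ}

theorem blockTerm_eq_one {ε : Kind} {a p : Fin k → ℕ} {x : ℕ}
    (h : (∀ i, ¬ (Between ε (a i) x (p i) ∧ p i ≠ x)) ∨ ∀ i, InBlock ε (a i) (p i) → p i ≠ x) :
    blockTerm ε a p x = 1 := by
  rw [blockTerm, colCount_between]
  rcases h with h | h
  · rw [colCount_eq_zero (Q := fun y z => Between ε y x z ∧ z ≠ x) h, tFactorial_zero, one_mul,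
      add_zero, div_self (tFactorial_ne_zero _)]
  · rw [colCount_eq_zero (Q := fun y z => InBlock ε y z ∧ z = x) fun i hi => h i hi.1 hi.2,
      tFactorial_zero, mul_one, zero_add, div_self (tFactorial_ne_zero _)]

theorem neutralTerm_eq_one {ε : Kind} {M : ℕ} {a p : Fin k → ℕ} {A : ℕ}
    (h : ∀ i, a i = A → InBlock ε (a i) (p i)) : neutralTerm ε M a p A = 1 := by
  rw [neutralTerm, colCount_congr (Q := fun y z => y = A ∧ InBlock ε y z) (R := fun y _ => y = A)
    fun i => ⟨fun h' => h'.1, fun h' => ⟨h', h i h'⟩⟩, Finset.prod_eq_one, mul_one,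
    div_self (tFactorial_ne_zero _)]
  exact fun B _ => tFactorial_colCount_eq_one fun i hi => hi.1.2 (h i hi.1.1)

theorem rowCoeff_succ {ε : Kind} {M : ℕ} {a p : Fin k → ℕ} (ha : ∀ i, a i < M)
    (hp : ∀ i, p i < M) : rowCoeff ε (M + 1) a p = rowCoeff ε M a p := by
  rw [rowCoeff, rowCoeff, Finset.prod_range_succ, Finset.prod_range_succ,
    blockTerm_eq_one (.inr fun i _ => (hp i).ne),
    neutralTerm_eq_one fun i h => absurd h (ha i).ne, mul_one, mul_one]
  congr 1
  refine Finset.prod_congr rfl fun A _ => ?_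
  rw [neutralTerm, neutralTerm, Finset.prod_range_succ,
    tFactorial_colCount_eq_one (Q := fun y z => (y = A ∧ ¬ InBlock ε y z) ∧ z = M)
      fun i hi => (hp i).ne hi.2, mul_one]

theorem rowCoeff_of_le {ε : Kind} {M M' : ℕ} {a p : Fin k → ℕ} (ha : ∀ i, a i < M)
    (hp : ∀ i, p i < M) (h : M ≤ M') : rowCoeff ε M' a p = rowCoeff ε M a p := by
  induction M', h using Nat.le_induction with
  | base => rfl
  | succ M' h ih =>
    rw [rowCoeff_succ (fun i => (ha i).trans_le h) (fun i => (hp i).trans_le h), ih]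

/-- The product of the `t`-factorials of the multiplicities of the entries. -/
def multProd (M : ℕ) (a : Fin k → ℕ) : Kqt :=
  ∏ x ∈ Finset.range M, tFactorial (colCount a a fun y _ => y = x)

theorem multProd_ne_zero (M : ℕ) (a : Fin k → ℕ) : multProd M a ≠ 0 :=
  Finset.prod_ne_zero_iff.2 fun _ _ => tFactorial_ne_zero _

/-- The coefficient of two consecutive rows, up to the multiplicities of the upper row. -/
def coreCoeff (ε : Kind) (M : ℕ) (a p : Fin k → ℕ) : Kqt :=
  (∏ x ∈ Finset.range M, tFactorial (colCount a p fun y z => Between ε y x z)) /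
    ((∏ x ∈ Finset.range M, tFactorial (colCount a p fun y z => Between ε y x z ∧ z ≠ x)) *
      ((∏ x ∈ Finset.range M, tFactorial (colCount a p fun y z => InBlock ε y z ∧ z = x)) *
        ∏ x ∈ Finset.range M, tFactorial (colCount a p fun y z => y = x ∧ InBlock ε y z)) *
      ∏ A ∈ Finset.range M, ∏ B ∈ Finset.range M,
        tFactorial (colCount a p fun y z => (y = A ∧ ¬ InBlock ε y z) ∧ z = B))

/-- Splits off the one part that is not symmetric under exchanging and complementing the two rows.
-/
theorem rowCoeff_eq_mul_coreCoeff (ε : Kind) (M : ℕ) (a p : Fin k → ℕ) :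
    rowCoeff ε M a p = multProd M a * coreCoeff ε M a p := by
  have h : multProd M a = ∏ x ∈ Finset.range M, tFactorial (colCount a p fun y _ => y = x) := rfl
  simp only [rowCoeff, blockTerm, neutralTerm, h, coreCoeff, Finset.prod_div_distrib,
    Finset.prod_mul_distrib]
  rw [div_mul_div_comm, mul_div_assoc']
  congr 1
  · rw [mul_comm]
  · ring

/-- Below zeros all columns are non-descents and `Between` means `x ≤ z`, so the terms telescope to
the multinomial coefficient of the multiplicities of `p`. -/
theorem prod_blockTerm_zero (M : ℕ) (p : Fin k → ℕ) :
    (∏ x ∈ Finset.range M, blockTerm .diamond (fun _ => 0) p x) * multProd M p *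
      tFactorial (colCount p p fun y _ => M ≤ y) = tFactorial k := by
  induction M with
  | zero =>
    rw [colCount_univ (Q := fun y _ => 0 ≤ y) fun _ => Nat.zero_le _]
    simp [multProd]
  | succ M ih =>
    have h1 : blockTerm .diamond (fun _ => 0) p M =
        tFactorial (colCount p p fun y _ => M ≤ y) /
          (tFactorial (colCount p p fun y _ => M + 1 ≤ y) *
            tFactorial (colCount p p fun y _ => y = M)) := by
      have h (Q R : ℕ → ℕ → Prop) (h : ∀ z, Q 0 z ↔ R z z) :
          tFactorial (colCount (fun _ => 0) p Q) = tFactorial (colCount p p R) :=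
        congrArg _ (colCount_congr (a := p) (p := p) (Q := fun _ z => Q 0 z) fun i => h _)
      rw [blockTerm]
      refine congrArg₂ (· / ·) (h _ _ fun z => ?_)
        (congrArg₂ (· * ·) (h _ _ fun z => ?_) (h _ _ fun z => ?_)) <;>
        simp only [Between, InBlock] <;> omega
    have h2 := tFactorial_ne_zero (colCount p p fun y _ => M + 1 ≤ y)
    have h3 := tFactorial_ne_zero (colCount p p fun y _ => y = M)
    rw [← ih, Finset.prod_range_succ, h1, multProd, Finset.prod_range_succ, multProd]
    field_simp

/-- The top row contributes a multinomial coefficient for both kinds: from the block terms for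
`diamond`, and from the neutral block of `0` for `dagger`. -/
theorem rowCoeff_zero (ε : Kind) {M : ℕ} (hM : 0 < M) {p : Fin k → ℕ} (hpM : ∀ i, p i < M) :
    rowCoeff ε M (fun _ => 0) p * multProd M p = tFactorial k := by
  cases ε with
  | diamond =>
    rw [rowCoeff, Finset.prod_eq_one (f := neutralTerm _ _ _ _)
      fun A _ => neutralTerm_eq_one fun i _ => Nat.zero_le _, mul_one, ← prod_blockTerm_zero M p,
      tFactorial_colCount_eq_one (a := p) (p := p) (Q := fun y _ => M ≤ y)
        fun i => not_le.2 (hpM i), mul_one]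
  | dagger =>
    rw [rowCoeff, Finset.prod_eq_one (f := blockTerm _ _ _)
      fun x _ => blockTerm_eq_one (.inr fun i h => absurd h (Nat.not_lt_zero _)), one_mul,
      Finset.prod_eq_single_of_mem 0 (Finset.mem_range.2 hM)
        fun A _ hA => neutralTerm_eq_one fun i h => absurd h.symm hA, neutralTerm,
      colCount_univ (Q := fun y _ => y = 0) fun _ => rfl,
      tFactorial_colCount_eq_one (Q := fun y z => y = 0 ∧ InBlock .dagger y z)
        fun i h => absurd h.2 (Nat.not_lt_zero _), one_mul]
    have h : ∏ B ∈ Finset.range M, tFactorial (colCount (fun _ => 0) p fun y z =>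
        (y = 0 ∧ ¬ InBlock .dagger y z) ∧ z = B) = multProd M p :=
      Finset.prod_congr rfl fun B _ => congrArg tFactorial
        (colCount_congr (a := p) (p := p) (Q := fun _ z => (0 = 0 ∧ ¬ InBlock .dagger 0 z) ∧ z = B)
          fun i => by simp [InBlock])
    rw [h, div_mul_cancel₀ _ (multProd_ne_zero M p)]

/-! ### Complementing the entries and exchanging two rows -/

section Complement

variable {N : ℕ}

theorem prod_range_compl {K : Type*} [CommMonoid K] (f g : ℕ → K)
    (h : ∀ x ≤ N + 1, f x = g (N + 1 - x)) :
    ∏ x ∈ Finset.range (N + 2), f x = ∏ x ∈ Finset.range (N + 2), g x := by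
  rw [← Finset.prod_range_reflect g]
  exact Finset.prod_congr rfl fun x hx => h x (by have := Finset.mem_range.1 hx; omega)

/-- For half-open intervals: complementing moves the excluded endpoint to the other side, which
shifts the reflection by one and leaves the index `N + 1` over. -/
theorem prod_range_compl_shift {K : Type*} [CommMonoid K] (f g : ℕ → K)
    (h : ∀ x ≤ N, f x = g (N - x)) (hf : f (N + 1) = 1) (hg : g (N + 1) = 1) :
    ∏ x ∈ Finset.range (N + 2), f x = ∏ x ∈ Finset.range (N + 2), g x := by
  rw [Finset.prod_range_succ f, Finset.prod_range_succ g, hf, hg, mul_one, mul_one,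
    ← Finset.prod_range_reflect g]
  exact Finset.prod_congr rfl fun x hx => h x (by have := Finset.mem_range.1 hx; omega)

theorem multProd_compl {a : Fin k → ℕ} (ha : ∀ i, a i ≤ N + 1) :
    multProd (N + 2) (fun i => N + 1 - a i) = multProd (N + 2) a := by
  refine prod_range_compl _ _ fun x hx => congrArg tFactorial ?_
  refine (colCount_congr (a := a) (p := a) (Q := fun y _ => N + 1 - y = x)
    (R := fun y _ => y = N + 1 - x) fun i => ?_)
  have := ha i
  omega

/-- The column `(a, p)` becomes `(N + 1 - p, N + 1 - a)` and stays in or outside the block. Closed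
and open intervals are reflected by `N + 1 - x`, half-open ones by `N - x`; the multiplicities of
upper and of lower entries in the block change places. -/
theorem coreCoeff_compl (ε : Kind) {a p : Fin k → ℕ} (ha : ∀ i, 1 ≤ a i) (haN : ∀ i, a i ≤ N)
    (hp : ∀ i, 1 ≤ p i) (hpN : ∀ i, p i ≤ N) :
    coreCoeff ε (N + 2) (fun i => N + 1 - p i) (fun i => N + 1 - a i) =
      coreCoeff ε (N + 2) a p := by
  have key : ∀ Q R : ℕ → ℕ → Prop, (∀ i, Q (N + 1 - p i) (N + 1 - a i) ↔ R (a i) (p i)) →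
      tFactorial (colCount (fun i => N + 1 - p i) (fun i => N + 1 - a i) Q) =
        tFactorial (colCount a p R) := fun Q R h => congrArg tFactorial
    (colCount_congr (a := a) (p := p) (Q := fun y z => Q (N + 1 - z) (N + 1 - y)) h)
  have hin : ∀ i, InBlock ε (N + 1 - p i) (N + 1 - a i) ↔ InBlock ε (a i) (p i) := fun i => by
    have := ha i; have := haN i; have := hp i; have := hpN i
    cases ε <;> simp only [InBlock] <;> omega
  unfold coreCoeff
  congr 1
  · cases ε with
    | diamond =>
      refine prod_range_compl _ _ fun x hx => key _ _ fun i => ?_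
      have := ha i; have := haN i; have := hp i; have := hpN i
      simp only [Between]
      omega
    | dagger =>
      refine prod_range_compl_shift _ _ (fun x hx => key _ _ fun i => ?_)
        (tFactorial_colCount_eq_one fun i => ?_) (tFactorial_colCount_eq_one fun i => ?_)
      all_goals
        have := ha i; have := haN i; have := hp i; have := hpN i
        simp only [Between]
        omega
  congr 1
  · congr 1
    · cases ε with
      | diamond =>
        refine prod_range_compl_shift _ _ (fun x hx => key _ _ fun i => ?_)
          (tFactorial_colCount_eq_one fun i => ?_) (tFactorial_colCount_eq_one fun i => ?_)
        all_goals
          have := ha i; have := haN i; have := hp i; have := hpN i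
          simp only [Between]
          omega
      | dagger =>
        refine prod_range_compl _ _ fun x hx => key _ _ fun i => ?_
        have := ha i; have := haN i; have := hp i; have := hpN i
        simp only [Between]
        omega
    · rw [mul_comm]
      congr 1
      all_goals
        refine prod_range_compl _ _ fun x hx => key _ _ fun i => ?_
        have := ha i; have := haN i; have := hp i; have := hpN i
        simp only [hin i]
        refine ⟨fun h => ⟨?_, ?_⟩, fun h => ⟨?_, ?_⟩⟩ <;> first | exact h.1 | exact h.2 | omega
  · rw [Finset.prod_comm]
    refine prod_range_compl _ _ fun B hB => prod_range_compl _ _ fun A hA => key _ _ fun i => ?_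
    have := ha i; have := haN i; have := hp i; have := hpN i
    simp only [hin i]
    refine ⟨fun h => ⟨⟨?_, ?_⟩, ?_⟩, fun h => ⟨⟨?_, ?_⟩, ?_⟩⟩ <;>
      first | exact h.1.2 | omega

end Complement

end Coefficients

/-! ### The coefficients `d` in terms of `rowCoeff`, and their duality -/

section RowFactor

variable {k : ℕ}

theorem numCols_eq_colCount {n : ℕ} (τ : Rect n k) (i : ℕ) (P : ℕ → ℕ → Prop)
    [∀ a b, Decidable (P a b)] : numCols τ i P = colCount (row τ (i + 1)) (row τ i) P :=
  card_eq_colCount (a := row τ (i + 1)) (p := row τ i) (Q := P)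

theorem nu_diamond {n : ℕ} (τ : Rect n k) {N i m : ℕ} (hm : m ≤ N) (hN : ∀ c, row τ i c ≤ N) :
    nu .diamond N τ i m = colCount (row τ (i + 1)) (row τ i) fun _ b => N + 1 - m ≤ b := by
  simp only [nu, numCols_eq_colCount]
  refine sum_colCount _ (fun l _ b => b = N + 1 - l) _ (fun c => ?_) ?_
  · have := hN c
    refine ⟨fun h => ⟨N + 1 - row τ i c, Finset.mem_Icc.2 ?_, ?_⟩, ?_⟩
    · omega
    · omega
    · rintro ⟨l, hl, h⟩
      have := Finset.mem_Icc.1 hl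
      omega
  · intro l hl l' hl' c h1 h2
    have := Finset.mem_Icc.1 hl
    have := Finset.mem_Icc.1 hl'
    omega

theorem nu_dagger {n : ℕ} (τ : Rect n k) {N i m : ℕ} (h1 : ∀ c, 1 ≤ row τ i c) :
    nu .dagger N τ i m = colCount (row τ (i + 1)) (row τ i) fun _ b => b ≤ m := by
  simp only [nu, numCols_eq_colCount]
  refine sum_colCount _ (fun l _ b => b = l) _ (fun c => ?_) ?_
  · have := h1 c
    refine ⟨fun h => ⟨row τ i c, Finset.mem_Icc.2 ?_, ?_⟩, ?_⟩
    · omega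
    · omega
    · rintro ⟨l, hl, h⟩
      have := Finset.mem_Icc.1 hl
      omega
  · intro l hl l' hl' c h1 h2
    omega

theorem sNum_diamond {n : ℕ} (τ : Rect n k) {N i h m : ℕ} (h1 : 1 ≤ h) (hhm : h ≤ m) (hm : m ≤ N) :
    sNum .diamond N τ i h m = colCount (row τ (i + 1)) (row τ i) fun a b =>
      a = N + 1 - h ∧ (a ≤ b ∨ N + 1 - m ≤ b) := by
  simp only [sNum, numCols_eq_colCount]
  rw [sum_colCount _ (fun l a b => a = N + 1 - h ∧ b < a ∧ b = N + 1 - l)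
    fun a b => a = N + 1 - h ∧ b < a ∧ N + 1 - m ≤ b]
  · refine (colCount_add (fun c => ?_) fun c => ?_).symm <;> omega
  · intro c
    refine ⟨fun h' => ⟨N + 1 - row τ i c, Finset.mem_Ioc.2 ?_, ?_⟩, ?_⟩
    · omega
    · omega
    · rintro ⟨l, hl, h⟩
      have := Finset.mem_Ioc.1 hl
      omega
  · intro l hl l' hl' c h1 h2
    have := Finset.mem_Ioc.1 hl
    have := Finset.mem_Ioc.1 hl'
    omega

theorem sNum_dagger {n : ℕ} (τ : Rect n k) {N i h m : ℕ} :
    sNum .dagger N τ i h m = colCount (row τ (i + 1)) (row τ i) fun a b =>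
      a = h + 1 ∧ (b < a ∨ b ≤ m) := by
  simp only [sNum, numCols_eq_colCount]
  rw [sum_colCount _ (fun l a b => a = h + 1 ∧ a ≤ b ∧ b = l)
    fun a b => a = h + 1 ∧ a ≤ b ∧ b ≤ m]
  · refine (colCount_add (fun c => ?_) fun c => ?_).symm <;> omega
  · intro c
    refine ⟨fun h' => ⟨row τ i c, Finset.mem_Ioc.2 ?_, ?_⟩, ?_⟩
    · omega
    · omega
    · rintro ⟨l, hl, h⟩
      have := Finset.mem_Ioc.1 hl
      omega
  · intro l hl l' hl' c h1 h2
    omega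

/-- The numbers `s^h` with `h ≤ m` exhaust the columns counted by `ν` with upper entry at least `N +
1 - m`: non-descents among these have lower entry at least `N + 1 - m'` in any case. -/
theorem sub_sum_sNum_diamond {n : ℕ} (τ : Rect n k) {N i m m' : ℕ} (hm : m ≤ m')
    (hm1 : m' ≤ m + 1) (hm' : m' ≤ N) (hN : ∀ c, row τ i c ≤ N)
    (hN' : ∀ c, row τ (i + 1) c ≤ N) :
    nu .diamond N τ i m' - ∑ h ∈ Finset.Icc 1 m, sNum .diamond N τ i h m' =
      colCount (row τ (i + 1)) (row τ i) fun a b => a ≤ N - m ∧ N + 1 - m' ≤ b := by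
  have h1 : ∑ h ∈ Finset.Icc 1 m, sNum .diamond N τ i h m' =
      colCount (row τ (i + 1)) (row τ i) fun a b => N + 1 - m ≤ a ∧ N + 1 - m' ≤ b := by
    rw [Finset.sum_congr rfl fun h hh => sNum_diamond τ (Finset.mem_Icc.1 hh).1
      ((Finset.mem_Icc.1 hh).2.trans hm) hm']
    refine sum_colCount _ (fun h a b => a = N + 1 - h ∧ (a ≤ b ∨ N + 1 - m' ≤ b)) _ (fun c => ?_) ?_
    · have := hN c
      have := hN' c
      refine ⟨fun h => ⟨N + 1 - row τ (i + 1) c, Finset.mem_Icc.2 ?_, ?_⟩, ?_⟩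
      · omega
      · omega
      · rintro ⟨l, hl, h⟩
        have := Finset.mem_Icc.1 hl
        omega
    · intro l hl l' hl' c h1 h2
      have := Finset.mem_Icc.1 hl
      have := Finset.mem_Icc.1 hl'
      omega
  rw [h1, nu_diamond τ hm' hN, colCount_add
    (Q := fun a b => a ≤ N - m ∧ N + 1 - m' ≤ b) (R := fun a b => N + 1 - m ≤ a ∧ N + 1 - m' ≤ b),
    Nat.add_sub_cancel]
  · intro c
    omega
  · intro c
    omega

/-- The sum of the `s^h` accounts for the upper entries from `1` to `m + 1`. The upper entry `0`,
which occurs above the top row, belongs to no `s^h` and stays. -/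
theorem sub_sum_sNum_dagger {n : ℕ} (τ : Rect n k) {N i m m' : ℕ} (hm : m ≤ m')
    (hm1 : m' ≤ m + 1) (h1 : ∀ c, 1 ≤ row τ i c) :
    nu .dagger N τ i m' - ∑ h ∈ Finset.Icc 0 m, sNum .dagger N τ i h m' =
      colCount (row τ (i + 1)) (row τ i) fun a b => (a = 0 ∨ m + 1 < a) ∧ b ≤ m' := by
  have h2 : ∑ h ∈ Finset.Icc 0 m, sNum .dagger N τ i h m' =
      colCount (row τ (i + 1)) (row τ i) fun a b => (1 ≤ a ∧ a ≤ m + 1) ∧ b ≤ m' := by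
    rw [Finset.sum_congr rfl fun h _ => sNum_dagger τ]
    refine sum_colCount _ (fun h a b => a = h + 1 ∧ (b < a ∨ b ≤ m')) _ (fun c => ?_) ?_
    · refine ⟨fun h => ⟨row τ (i + 1) c - 1, Finset.mem_Icc.2 ?_, ?_⟩, ?_⟩
      · omega
      · omega
      · rintro ⟨l, hl, h⟩
        have := Finset.mem_Icc.1 hl
        omega
    · intro l hl l' hl' c h1 h2
      omega
  rw [h2, nu_dagger τ h1, colCount_add
    (Q := fun a b => (a = 0 ∨ m + 1 < a) ∧ b ≤ m') (R := fun a b => (1 ≤ a ∧ a ≤ m + 1) ∧ b ≤ m'),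
    Nat.add_sub_cancel]
  · intro c
    omega
  · intro c
    omega

theorem prod_Ico_prod_Icc_comm {K : Type*} [CommMonoid K] (l N : ℕ) (f : ℕ → ℕ → K) :
    ∏ m ∈ Finset.Ico l N, ∏ h ∈ Finset.Icc l m, f h m =
      ∏ h ∈ Finset.Ico l N, ∏ m ∈ Finset.Ico h N, f h m :=
  Finset.prod_comm' fun m h => by
    simp only [Finset.mem_Ico, Finset.mem_Icc]
    omega

theorem prod_range_eq_prod_Ico {K : Type*} [CommMonoid K] {l M : ℕ} (hl : l ≤ M) (f : ℕ → K)
    (h : ∀ x < l, f x = 1) : ∏ x ∈ Finset.range M, f x = ∏ x ∈ Finset.Ico l M, f x := by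
  rw [Finset.range_eq_Ico, ← Finset.prod_Ico_consecutive f (Nat.zero_le l) hl,
    Finset.prod_eq_one fun x hx => h x (Finset.mem_Ico.1 hx).2, one_mul]

/-- For fixed `h` the binomials telescope in `m` to the multinomial coefficient of the neutral block
of `A = N + 1 - h`. -/
theorem prod_sNum_diamond {n : ℕ} (τ : Rect n k) {N i : ℕ} (h1 : ∀ c, 1 ≤ row τ i c)
    (hN : ∀ c, row τ i c ≤ N) :
    ∏ m ∈ Finset.Ico 1 N, ∏ h ∈ Finset.Icc 1 m,
        tBinom (sNum .diamond N τ i h (m + 1)) (sNum .diamond N τ i h m) =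
      ∏ A ∈ Finset.range (N + 1),
        neutralTerm .diamond (N + 1) (row τ (i + 1)) (row τ i) A := by
  rw [prod_Ico_prod_Icc_comm]
  rcases Nat.eq_zero_or_pos N with rfl | hpos
  · rw [Finset.prod_range_one, neutralTerm_eq_one]
    · simp
    · intro c h
      simp only [InBlock]
      omega
  -- Lower entries are positive, so upper entries `0` and `1` only occur in non-descents and give
  -- trivial factors.
  rw [prod_range_eq_prod_Ico (l := 2) (by omega)]
  · refine Finset.prod_nbij' (fun h => N + 1 - h) (fun A => N + 1 - A) ?_ ?_ ?_ ?_ ?_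
    · intro h hh
      rw [Finset.mem_Ico] at *
      omega
    · intro h hh
      rw [Finset.mem_Ico] at *
      omega
    · intro h hh
      rw [Finset.mem_Ico] at *
      omega
    · intro h hh
      rw [Finset.mem_Ico] at *
      omega
    · intro h hh
      rw [Finset.mem_Ico] at hh
      rw [prod_Ico_tBinom_telescope (fun m => sNum .diamond N τ i h m)
        (fun m => colCount (row τ (i + 1)) (row τ i) fun a b =>
          (a = N + 1 - h ∧ ¬ InBlock .diamond a b) ∧ b = N - m) h N (by omega), neutralTerm,
        sNum_diamond τ hh.1 hh.2.le le_rfl, sNum_diamond τ hh.1 le_rfl hh.2.le]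
      · refine congrArg₂ (· / ·) (congrArg _ (colCount_congr fun c => ?_)) (congrArg₂ (· * ·)
          (congrArg _ (colCount_congr fun c => ?_)) ?_)
        · have := h1 c
          omega
        · simp only [InBlock]
          omega
        · symm
          -- In the neutral block of `N + 1 - h`, descents have lower entries from `1` to `N - h`.
          rw [← Finset.prod_subset (s₁ := Finset.Ico 1 (N + 1 - h))]
          · refine Finset.prod_nbij' (fun B => N - B) (fun m => N - m) ?_ ?_ ?_ ?_ ?_
            · intro h hh
              rw [Finset.mem_Ico] at *
              omega
            · intro h hh
              rw [Finset.mem_Ico] at *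
              omega
            · intro h hh
              rw [Finset.mem_Ico] at *
              omega
            · intro h hh
              rw [Finset.mem_Ico] at *
              omega
            · intro B hB
              rw [Finset.mem_Ico] at hB
              rw [Nat.sub_sub_self (by omega)]
          · intro B hB
            rw [Finset.mem_Ico] at hB
            rw [Finset.mem_range]
            omega
          · intro B hB hB'
            rw [Finset.mem_Ico] at hB'
            refine tFactorial_colCount_eq_one fun c => ?_
            have := h1 c
            simp only [InBlock]
            omega
      · intro m hm hmN
        rw [sNum_diamond τ hh.1 (by omega) (by omega), sNum_diamond τ hh.1 hm hmN.le]
        refine colCount_add (fun c => ?_) fun c => ?_ <;> simp only [InBlock] <;> omega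
  · intro x hx
    refine neutralTerm_eq_one fun c h => ?_
    have := h1 c
    simp only [InBlock]
    omega

theorem prod_sNum_dagger {n : ℕ} (τ : Rect n k) {N i : ℕ} (hN : ∀ c, row τ i c ≤ N) :
    ∏ m ∈ Finset.Ico 0 N, ∏ h ∈ Finset.Icc 0 m,
        tBinom (sNum .dagger N τ i h (m + 1)) (sNum .dagger N τ i h m) =
      ∏ A ∈ Finset.range N,
        neutralTerm .dagger (N + 1) (row τ (i + 1)) (row τ i) (A + 1) := by
  rw [prod_Ico_prod_Icc_comm, ← Finset.range_eq_Ico]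
  refine Finset.prod_congr rfl fun h hh => ?_
  rw [Finset.mem_range] at hh
  rw [prod_Ico_tBinom_telescope (fun m => sNum .dagger N τ i h m)
    (fun m => colCount (row τ (i + 1)) (row τ i) fun a b =>
      (a = h + 1 ∧ ¬ InBlock .dagger a b) ∧ b = m + 1) h N hh.le, neutralTerm,
    sNum_dagger τ, sNum_dagger τ]
  · refine congrArg₂ (· / ·) (congrArg _ (colCount_congr fun c => ?_)) (congrArg₂ (· * ·)
      (congrArg _ (colCount_congr fun c => ?_)) ?_)
    · have := hN c
      omega
    · simp only [InBlock]
      omega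
    · rw [prod_range_eq_prod_Ico (l := h + 1) (by omega),
        Finset.prod_Ico_add' (fun B => tFactorial (colCount (row τ (i + 1)) (row τ i) fun y z =>
          (y = h + 1 ∧ ¬ InBlock .dagger y z) ∧ z = B)) h N 1]
      intro x hx
      refine tFactorial_colCount_eq_one fun c => ?_
      simp only [InBlock]
      omega
  · intro m hm hmN
    rw [sNum_dagger τ, sNum_dagger τ]
    refine colCount_add (fun c => ?_) fun c => ?_ <;> simp only [InBlock] <;> omega

theorem tBinom_colCount {a p : Fin k → ℕ} {ε : Kind} {x : ℕ} :
    tBinom (colCount a p fun y z => Between ε y x z)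
      (colCount a p fun y z => Between ε y x z ∧ z ≠ x) = blockTerm ε a p x := by
  rw [tBinom_symm (colCount_between ε a p x), blockTerm]

/-- The first binomial for `m` is the block term of `x = N - m`; the remaining block terms, for `x =
0` and `x = N`, are trivial. -/
theorem rowFactor_diamond {n : ℕ} (τ : Rect n k) {N i : ℕ} (h1 : ∀ c, 1 ≤ row τ i c)
    (hN : ∀ c, row τ i c ≤ N) (hN' : ∀ c, row τ (i + 1) c ≤ N) :
    ∏ m ∈ Finset.Ico 1 N,
      (tBinom (nu .diamond N τ i (m + 1) - ∑ h ∈ Finset.Icc 1 m, sNum .diamond N τ i h (m + 1))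
          (nu .diamond N τ i m - ∑ h ∈ Finset.Icc 1 m, sNum .diamond N τ i h m) *
        ∏ h ∈ Finset.Icc 1 m, tBinom (sNum .diamond N τ i h (m + 1)) (sNum .diamond N τ i h m)) =
      rowCoeff .diamond (N + 1) (row τ (i + 1)) (row τ i) := by
  rw [Finset.prod_mul_distrib, prod_sNum_diamond τ h1 hN, rowCoeff]
  congr 1
  rw [Finset.prod_range_succ, blockTerm_eq_one, mul_one]
  · rcases Nat.eq_zero_or_pos N with rfl | hpos
    · simp
    rw [prod_range_eq_prod_Ico (l := 1) hpos]
    · refine Finset.prod_nbij' (fun m => N - m) (fun x => N - x) ?_ ?_ ?_ ?_ ?_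
      · intro h hh
        rw [Finset.mem_Ico] at *
        omega
      · intro h hh
        rw [Finset.mem_Ico] at *
        omega
      · intro h hh
        rw [Finset.mem_Ico] at *
        omega
      · intro h hh
        rw [Finset.mem_Ico] at *
        omega
      · intro m hm
        rw [Finset.mem_Ico] at hm
        rw [sub_sum_sNum_diamond τ (Nat.le_succ m) le_rfl hm.2 hN hN',
          sub_sum_sNum_diamond τ le_rfl (Nat.le_succ m) hm.2.le hN hN', ← tBinom_colCount]
        refine congrArg₂ tBinom (colCount_congr fun c => ?_) (colCount_congr fun c => ?_) <;>
          simp only [Between] <;> omega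
    · intro x hx
      refine blockTerm_eq_one (.inr fun c _ => ?_)
      have := h1 c
      omega
  · refine .inl fun c => ?_
    have := hN c
    simp only [Between]
    omega

/-- With a positive upper row the factors match one by one. Below the zeros the first binomials of
`d` no longer are block terms; they telescope to the multinomial coefficient that `rowCoeff` has as
the neutral term of `0`. -/
theorem rowFactor_dagger {n : ℕ} (τ : Rect n k) {N i : ℕ} (h1 : ∀ c, 1 ≤ row τ i c)
    (hN : ∀ c, row τ i c ≤ N)
    (h0 : (∀ c, 1 ≤ row τ (i + 1) c) ∨ row τ (i + 1) = fun _ => 0) :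
    ∏ m ∈ Finset.Ico 0 N,
      (tBinom (nu .dagger N τ i (m + 1) - ∑ h ∈ Finset.Icc 0 m, sNum .dagger N τ i h (m + 1))
          (nu .dagger N τ i m - ∑ h ∈ Finset.Icc 0 m, sNum .dagger N τ i h m) *
        ∏ h ∈ Finset.Icc 0 m, tBinom (sNum .dagger N τ i h (m + 1)) (sNum .dagger N τ i h m)) =
      rowCoeff .dagger (N + 1) (row τ (i + 1)) (row τ i) := by
  rw [Finset.prod_mul_distrib, prod_sNum_dagger τ hN]
  rcases h0 with h0 | h0
  · rw [rowCoeff, Finset.prod_range_succ' (neutralTerm _ _ _ _),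
      neutralTerm_eq_one (A := 0) fun c h => absurd h (by have := h0 c; omega), mul_one,
      Finset.prod_range_succ', blockTerm_eq_one, mul_one, ← Finset.range_eq_Ico]
    · congr 1
      refine Finset.prod_congr rfl fun m hm => ?_
      rw [sub_sum_sNum_dagger τ (Nat.le_succ m) le_rfl h1,
          sub_sum_sNum_dagger τ le_rfl (Nat.le_succ m) h1, ← tBinom_colCount]
      refine congrArg₂ tBinom (colCount_congr fun c => ?_) (colCount_congr fun c => ?_)
      all_goals
        have := h0 c
        simp only [Between]
        omega
    · refine .inr fun c _ => ?_
      have := h1 c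
      omega
  · have h2 := rowCoeff_zero .dagger N.succ_pos fun c => Nat.lt_succ_of_le (hN c)
    rw [Finset.prod_eq_one (f := fun A => neutralTerm _ _ _ _ (A + 1)), mul_one, h0,
      ← mul_left_inj' (multProd_ne_zero (N + 1) (row τ i)), h2]
    · rw [Finset.prod_congr rfl fun m _ => by
        rw [sub_sum_sNum_dagger τ (Nat.le_succ m) le_rfl h1,
          sub_sum_sNum_dagger τ le_rfl (Nat.le_succ m) h1],
        Finset.prod_congr (g := fun m => tBinom (colCount (row τ i) (row τ i) fun _ b => b ≤ m + 1)
          (colCount (row τ i) (row τ i) fun _ b => b ≤ m)) rfl,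
        prod_Ico_tBinom_telescope (fun m => colCount (row τ i) (row τ i) fun _ b => b ≤ m)
          (fun m => colCount (row τ i) (row τ i) fun b _ => b = m + 1) 0 N (Nat.zero_le _),
        colCount_univ (Q := fun _ b => b ≤ N) hN, tFactorial_colCount_eq_one (Q := fun _ b => b ≤ 0),
        one_mul, multProd, Finset.prod_range_succ', tFactorial_colCount_eq_one
        (Q := fun b _ => b = 0), mul_one, ← Finset.range_eq_Ico, div_mul_cancel₀]
      · exact Finset.prod_ne_zero_iff.2 fun _ _ => tFactorial_ne_zero _
      · intro c
        have := h1 c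
        omega
      · intro c
        have := h1 c
        omega
      · intro m _ _
        refine colCount_add (fun c => ?_) fun c => ?_ <;> omega
      · intro m _
        rw [h0]
        refine congrArg₂ tBinom (colCount_congr (a := row τ i) (p := row τ i)
          (Q := fun _ b => (0 = 0 ∨ m + 1 < 0) ∧ b ≤ m + 1) fun c => ?_)
          (colCount_congr (a := row τ i) (p := row τ i)
          (Q := fun _ b => (0 = 0 ∨ m + 1 < 0) ∧ b ≤ m) fun c => ?_) <;> omega
    · intro A _
      exact neutralTerm_eq_one fun c h => absurd h (by simp [h0])

theorem row_pos {n : ℕ} (τ : Rect n k) {i : ℕ} (hi : i < n) (c : Fin k) : 1 ≤ row τ i c := by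
  rw [row, dif_pos hi]
  exact (τ _ c).pos

theorem row_top {n : ℕ} (τ : Rect n k) {i : ℕ} (hi : n ≤ i) : row τ i = fun _ => 0 :=
  funext fun _ => dif_neg (by omega)

theorem dRect_eq (ε : Kind) {n : ℕ} (τ : Rect n k) {N : ℕ} (hN : ∀ i c, row τ i c ≤ N) :
    dRect ε N τ = ∏ i ∈ Finset.range n, rowCoeff ε (N + 1) (row τ (i + 1)) (row τ i) := by
  refine Finset.prod_congr rfl fun i hi => ?_
  have hi := Finset.mem_range.1 hi
  cases ε with
  | diamond => exact rowFactor_diamond τ (row_pos τ hi) (hN i) (hN (i + 1))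
  | dagger =>
    refine rowFactor_dagger τ (row_pos τ hi) (hN i) ?_
    by_cases h : i + 1 < n
    · exact .inl (row_pos τ h)
    · exact .inr (row_top τ (by omega))

/-- Needed because the largest entry of `σ'` is smaller than that of `σ` if `1` does not occur in
`σ`. -/
theorem dRect_of_le (ε : Kind) {n : ℕ} (τ : Rect n k) {N N' : ℕ} (hN : ∀ i c, row τ i c ≤ N)
    (h : N ≤ N') : dRect ε N' τ = dRect ε N τ := by
  rw [dRect_eq ε τ hN, dRect_eq ε τ fun i c => (hN i c).trans h]
  exact Finset.prod_congr rfl fun i _ => rowCoeff_of_le (fun c => Nat.lt_succ_of_le (hN _ c))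
    (fun c => Nat.lt_succ_of_le (hN _ c)) (by omega)

/-- Complementary fillings turned upside down have the same coefficients. -/
theorem dRect_dual (ε : Kind) {n : ℕ} (τ τ' : Rect n k) {N : ℕ} (hN : ∀ i c, row τ i c ≤ N)
    (h : ∀ i < n, ∀ c, row τ' i c = N + 1 - row τ (n - 1 - i) c) :
    dRect ε N τ' = dRect ε N τ := by
  rcases n with _ | m
  · simp [dRect]
  have hN' : ∀ i c, row τ' i c ≤ N := by
    intro i c
    by_cases hi : i < m + 1
    · have := row_pos τ (i := m + 1 - 1 - i) (by omega) c
      rw [h i hi c]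
      omega
    · rw [row_top τ' (by omega)]
      exact Nat.zero_le _
  have hrow : ∀ i < m + 1, row τ' i = fun c => N + 1 - row τ (m - i) c := fun i hi => funext (h i hi)
  have hV : ∀ i < m + 1, multProd (N + 2) (row τ' i) = multProd (N + 2) (row τ (m - i)) := by
    intro i hi
    rw [hrow i hi, multProd_compl fun c => (hN _ c).trans (Nat.le_succ N)]
  have hC : ∏ i ∈ Finset.range m, coreCoeff ε (N + 2) (row τ' (i + 1)) (row τ' i) =
      ∏ i ∈ Finset.range m, coreCoeff ε (N + 2) (row τ (i + 1)) (row τ i) := by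
    rw [← Finset.prod_range_reflect fun i => coreCoeff ε (N + 2) (row τ (i + 1)) (row τ i)]
    refine Finset.prod_congr rfl fun i hi => ?_
    have hi := Finset.mem_range.1 hi
    rw [hrow i (by omega), hrow (i + 1) (by omega), show m - 1 - i + 1 = m - i by omega,
      show m - 1 - i = m - (i + 1) by omega]
    exact coreCoeff_compl ε (row_pos τ (by omega)) (hN _) (row_pos τ (by omega)) (hN _)
  -- The top row contributes `tFactorial k` divided by its own multiplicities. These cancel in the
  -- product over the rows `1, …, m`, and only the interior rows remain, whose set is stable under
  -- the flip. Passing to `N + 1` gives the products the range `N + 2` of the complement lemmas.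
  have hT : ∀ ρ : Rect (m + 1) k, (∀ i c, row ρ i c ≤ N) → dRect ε N ρ *
      multProd (N + 2) (row ρ m) = (∏ i ∈ Finset.range m, multProd (N + 2) (row ρ (i + 1))) *
        (∏ i ∈ Finset.range m, coreCoeff ε (N + 2) (row ρ (i + 1)) (row ρ i)) * tFactorial k := by
    intro ρ hρ
    rw [← dRect_of_le ε ρ hρ (Nat.le_succ N), dRect_eq ε ρ fun i c => (hρ i c).trans (Nat.le_succ N),
      Finset.prod_range_succ, row_top ρ le_rfl, mul_assoc,
      rowCoeff_zero ε (Nat.succ_pos _) fun c => Nat.lt_succ_of_le ((hρ m c).trans (Nat.le_succ N)),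
      ← Finset.prod_mul_distrib]
    congr 1
    exact Finset.prod_congr rfl fun i _ => rowCoeff_eq_mul_coreCoeff _ _ _ _
  have h1 := hT τ hN
  have h2 := hT τ' hN'
  rw [hC, hV m (by omega), Nat.sub_self] at h2
  have h3 : ∏ i ∈ Finset.range m, multProd (N + 2) (row τ' (i + 1)) =
      ∏ i ∈ Finset.range m, multProd (N + 2) (row τ i) := by
    rw [← Finset.prod_range_reflect fun i => multProd (N + 2) (row τ i)]
    refine Finset.prod_congr rfl fun i hi => ?_
    have hi := Finset.mem_range.1 hi
    rw [hV (i + 1) (by omega), show m - 1 - i = m - (i + 1) by omega]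
  have h4 : (∏ i ∈ Finset.range m, multProd (N + 2) (row τ (i + 1))) * multProd (N + 2) (row τ 0) =
      (∏ i ∈ Finset.range m, multProd (N + 2) (row τ i)) * multProd (N + 2) (row τ m) := by
    rw [← Finset.prod_range_succ' fun i => multProd (N + 2) (row τ i), Finset.prod_range_succ]
  rw [h3] at h2
  have hm := multProd_ne_zero (N + 2) (row τ m)
  have h0 := multProd_ne_zero (N + 2) (row τ 0)
  refine mul_right_cancel₀ (mul_ne_zero h0 hm) ?_
  rw [← mul_assoc, h2]
  calc _ = (∏ i ∈ Finset.range m, multProd (N + 2) (row τ i)) * multProd (N + 2) (row τ m) *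
        (∏ i ∈ Finset.range m, coreCoeff ε (N + 2) (row τ (i + 1)) (row τ i)) * tFactorial k := by
        ring
    _ = _ := by
      rw [← h4]
      linear_combination (-multProd (N + 2) (row τ 0)) * h1

end RowFactor

/-! ### Decomposition of a diagram into rectangles -/

section Diagram

variable {μ : YoungDiagram}

theorem rowLen_eq_zero_of_le {h : ℕ} (hh : μ.colLen 0 ≤ h) : μ.rowLen h = 0 := by
  by_contra h0
  have := YoungDiagram.mem_iff_lt_colLen.1 (YoungDiagram.mem_iff_lt_rowLen.2 (Nat.pos_of_ne_zero h0))
  omega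

theorem colLen_rowLen_add {h : ℕ} (c : Fin (width μ (h + 1))) :
    μ.colLen (μ.rowLen (h + 1) + c) = h + 1 := by
  have hc : (c : ℕ) < μ.rowLen h - μ.rowLen (h + 1) := c.2
  have h1 : (h, μ.rowLen (h + 1) + (c : ℕ)) ∈ μ := YoungDiagram.mem_iff_lt_rowLen.2 (by omega)
  have h2 : (h + 1, μ.rowLen (h + 1) + (c : ℕ)) ∉ μ := fun h' => by
    have := YoungDiagram.mem_iff_lt_rowLen.1 h'
    omega
  rw [YoungDiagram.mem_iff_lt_colLen] at h1 h2
  omega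

theorem exists_block_of_mem {r j : ℕ} (hx : (r, j) ∈ μ) :
    ∃ h < μ.colLen 0, r < h + 1 ∧ ∃ c : Fin (width μ (h + 1)), j = μ.rowLen (h + 1) + c := by
  have h1 := YoungDiagram.mem_iff_lt_colLen.1 hx
  have h2 := μ.colLen_anti 0 j (Nat.zero_le _)
  refine ⟨μ.colLen j - 1, by omega, by omega, ⟨j - μ.rowLen (μ.colLen j), ?_⟩, ?_⟩
  all_goals
    have h3 : (μ.colLen j - 1, j) ∈ μ := YoungDiagram.mem_iff_lt_colLen.2 (by omega)
    have h4 : (μ.colLen j, j) ∉ μ := fun h => by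
      have := YoungDiagram.mem_iff_lt_colLen.1 h
      omega
    rw [YoungDiagram.mem_iff_lt_rowLen] at h3 h4
    simp only [width, Nat.sub_add_cancel (show 1 ≤ μ.colLen j by omega)]
    omega

theorem block_index_unique {h h' : ℕ} {c : Fin (width μ (h + 1))} {c' : Fin (width μ (h' + 1))}
    (e : μ.rowLen (h + 1) + (c : ℕ) = μ.rowLen (h' + 1) + c') : h = h' := by
  have h1 := colLen_rowLen_add c
  rw [e, colLen_rowLen_add c'] at h1
  omega

theorem lt_of_index_of_lt {h h' : ℕ} {c : Fin (width μ (h + 1))} {c' : Fin (width μ (h' + 1))}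
    (e : h' < h) : μ.rowLen (h + 1) + (c : ℕ) < μ.rowLen (h' + 1) + c' := by
  by_contra hlt
  have h1 := μ.colLen_anti _ _ (not_lt.1 hlt)
  rw [colLen_rowLen_add, colLen_rowLen_add] at h1
  omega

/-- Boxes are listed by the height of their column, then row and column; the index `h` stands for
height `h + 1`, as columns are not empty. -/
theorem sum_cells {K : Type*} [AddCommMonoid K] (f : ℕ → ℕ → K) :
    ∑ x ∈ μ.cells, f x.1 x.2 = ∑ h ∈ Finset.range (μ.colLen 0), ∑ r ∈ Finset.range (h + 1),
      ∑ c : Fin (width μ (h + 1)), f r (μ.rowLen (h + 1) + c) := by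
  simp only [Finset.sum_sigma']
  symm
  refine Finset.sum_bij (fun x _ => (x.2.1, μ.rowLen (x.1 + 1) + x.2.2)) ?_ ?_ ?_ fun _ _ => rfl
  · rintro ⟨h, r, c⟩ hx
    simp only [Finset.mem_sigma, Finset.mem_range] at hx
    exact (YoungDiagram.mem_cells _).2 (block_mem ⟨r, hx.2.1⟩ c)
  · rintro ⟨h, r, c⟩ hx ⟨h', r', c'⟩ hx' e
    obtain ⟨rfl, e⟩ := Prod.mk.inj e
    obtain rfl := block_index_unique e
    obtain rfl := Fin.ext (Nat.add_left_cancel e)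
    rfl
  · rintro ⟨r, j⟩ hx
    obtain ⟨h, hh, hr, c, rfl⟩ := exists_block_of_mem ((YoungDiagram.mem_cells _).1 hx)
    exact ⟨⟨h, r, c⟩, by simp [hh, hr], rfl⟩

theorem mem_rowPairs {p : (ℕ × ℕ) × (ℕ × ℕ)} (hp : p ∈ rowPairs μ) : p.2.1 = p.1.1 :=
  (Finset.mem_filter.1 hp).2.1.symm

theorem card_rowPairs (P : ℕ → ℕ → ℕ → Prop) [∀ r j j', Decidable (P r j j')] :
    ((rowPairs μ).filter fun p => P p.1.1 p.1.2 p.2.2).card =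
      ∑ h ∈ Finset.range (μ.colLen 0), ∑ r ∈ Finset.range (h + 1),
        ∑ c : Fin (width μ (h + 1)), ∑ h' ∈ Finset.range (μ.colLen 0),
          ∑ c' : Fin (width μ (h' + 1)),
            if r ≤ h' ∧ μ.rowLen (h + 1) + c < μ.rowLen (h' + 1) + c' ∧
              P r (μ.rowLen (h + 1) + c) (μ.rowLen (h' + 1) + c') then 1 else 0 := by
  rw [rowPairs, Finset.filter_filter, Finset.card_filter, Finset.sum_product]
  rw [sum_cells fun r j => ∑ y ∈ μ.cells, if (r = y.1 ∧ j < y.2) ∧ P r j y.2 then 1 else 0]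
  refine Finset.sum_congr rfl fun h _ => Finset.sum_congr rfl fun r _ =>
    Finset.sum_congr rfl fun c _ => ?_
  rw [sum_cells fun r' j => if (r = r' ∧ μ.rowLen (h + 1) + (c : ℕ) < j) ∧
    P r (μ.rowLen (h + 1) + c) j then 1 else 0]
  refine Finset.sum_congr rfl fun h' _ => ?_
  rw [Finset.sum_comm]
  refine Finset.sum_congr rfl fun c' _ => ?_
  by_cases hr : r ≤ h'
  · rw [Finset.sum_eq_single_of_mem r (Finset.mem_range.2 (Nat.lt_succ_of_le hr))
      fun r' _ hr' => if_neg fun h => hr' h.1.1.symm]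
    simp [hr]
  · rw [if_neg fun h => hr h.1]
    refine Finset.sum_eq_zero fun r' hr' => if_neg fun h => hr ?_
    have := Finset.mem_range.1 hr'
    omega

theorem card_rowPairs_same (P : ℕ → ℕ → ℕ → Prop) [∀ r j j', Decidable (P r j j')] :
    ((rowPairs μ).filter fun p => μ.colLen p.1.2 = μ.colLen p.2.2 ∧ P p.1.1 p.1.2 p.2.2).card =
      ∑ h ∈ Finset.range (μ.colLen 0), ∑ r ∈ Finset.range (h + 1),
        ∑ c : Fin (width μ (h + 1)), ∑ c' : Fin (width μ (h + 1)),
          if c < c' ∧ P r (μ.rowLen (h + 1) + c) (μ.rowLen (h + 1) + c') then 1 else 0 := by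
  rw [card_rowPairs fun r j j' => μ.colLen j = μ.colLen j' ∧ P r j j']
  refine Finset.sum_congr rfl fun h hh => Finset.sum_congr rfl fun r hr =>
    Finset.sum_congr rfl fun c _ => ?_
  rw [Finset.sum_eq_single_of_mem h hh]
  · refine Finset.sum_congr rfl fun c' _ => ?_
    have := Finset.mem_range.1 hr
    simp only [colLen_rowLen_add, true_and, Nat.add_lt_add_iff_left, Fin.val_fin_lt,
      show r ≤ h by omega]
  · intro h' _ hne
    refine Finset.sum_eq_zero fun c' _ => if_neg fun h1 => hne ?_
    have := h1.2.2.1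
    rw [colLen_rowLen_add, colLen_rowLen_add] at this
    omega

theorem card_rowPairs_longer (P : ℕ → ℕ → ℕ → Prop) [∀ r j j', Decidable (P r j j')] :
    ((rowPairs μ).filter fun p => μ.colLen p.2.2 < μ.colLen p.1.2 ∧ P p.1.1 p.1.2 p.2.2).card =
      ∑ h ∈ Finset.range (μ.colLen 0), ∑ r ∈ Finset.range (h + 1),
        ∑ h' ∈ (Finset.range (μ.colLen 0)).filter fun h' => r ≤ h' ∧ h' < h,
          ∑ c : Fin (width μ (h + 1)), ∑ c' : Fin (width μ (h' + 1)),
            if P r (μ.rowLen (h + 1) + c) (μ.rowLen (h' + 1) + c') then 1 else 0 := by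
  rw [card_rowPairs fun r j j' => μ.colLen j' < μ.colLen j ∧ P r j j']
  refine Finset.sum_congr rfl fun h hh => Finset.sum_congr rfl fun r hr => ?_
  rw [Finset.sum_comm, Finset.sum_filter]
  refine Finset.sum_congr rfl fun h' _ => ?_
  by_cases h1 : r ≤ h' ∧ h' < h
  · rw [if_pos h1]
    refine Finset.sum_congr rfl fun c _ => Finset.sum_congr rfl fun c' _ => ?_
    simp only [colLen_rowLen_add, h1.1, lt_of_index_of_lt h1.2, Nat.add_lt_add_iff_right, h1.2,
      true_and]
  · rw [if_neg h1]
    refine Finset.sum_eq_zero fun c _ => Finset.sum_eq_zero fun c' _ => if_neg fun h2 => h1 ⟨h2.1, ?_⟩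
    have := h2.2.2.1
    rw [colLen_rowLen_add, colLen_rowLen_add] at this
    omega

theorem entry_block (τ : Filling μ) {h : ℕ} (r : ℕ) (c : Fin (width μ (h + 1))) :
    entry τ r (μ.rowLen (h + 1) + c) = row (block τ (h + 1)) r c := by
  have h1 : (r, μ.rowLen (h + 1) + (c : ℕ)) ∈ μ ↔ r < h + 1 := by
    rw [YoungDiagram.mem_iff_lt_colLen, colLen_rowLen_add]
  by_cases hr : r < h + 1
  · rw [entry, dif_pos (h1.2 hr), row, dif_pos hr, block]
  · rw [entry, dif_neg (fun h' => hr (h1.1 h')), row, dif_neg hr]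

theorem etaS_eq_sum (S : ℕ → ℕ → ℕ → ℕ → Prop) (τ : Filling μ) :
    etaS S τ = ∑ h ∈ Finset.range (μ.colLen 0), etaRect S (block τ (h + 1)) := by
  classical
  rw [etaS, Finset.filter_congr (q := fun p : (ℕ × ℕ) × (ℕ × ℕ) =>
    μ.colLen p.1.2 = μ.colLen p.2.2 ∧ S (entry τ (p.1.1 + 1) p.1.2) (entry τ (p.1.1 + 1) p.2.2)
      (entry τ p.1.1 p.1.2) (entry τ p.1.1 p.2.2)) fun p hp => by rw [mem_rowPairs hp],
    card_rowPairs_same fun r j j' => S (entry τ (r + 1) j) (entry τ (r + 1) j') (entry τ r j)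
      (entry τ r j')]
  refine Finset.sum_congr rfl fun h _ => Finset.sum_congr rfl fun r _ => ?_
  rw [pairInv, Finset.card_filter, ← Finset.univ_product_univ, Finset.sum_product]
  simp only [entry_block]

/-- A descent in row `r + 1` of a column of height `h + 1` has weight `h - r`, so only the numbers
of descents matter. -/
theorem maj_eq_sum (τ : Filling μ) :
    maj τ = ∑ h ∈ Finset.range (μ.colLen 0), ∑ r ∈ Finset.range h,
      numDescents (block τ (h + 1)) r * (h - r) := by
  rw [maj, Finset.sum_filter, sum_cells fun r j => if 1 ≤ r ∧ entry τ (r - 1) j < entry τ r j then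
    leg μ (r, j) + 1 else 0]
  refine Finset.sum_congr rfl fun h _ => ?_
  rw [Finset.sum_range_succ']
  simp only [show ¬ (1 ≤ 0) by decide, false_and, if_false, Finset.sum_const_zero, add_zero]
  refine Finset.sum_congr rfl fun r hr => ?_
  have := Finset.mem_range.1 hr
  simp only [entry_block, leg, colLen_rowLen_add, Nat.add_sub_cancel]
  rw [numDescents, Finset.card_filter, Finset.sum_mul]
  refine Finset.sum_congr rfl fun c _ => ?_
  rw [ite_mul, one_mul, zero_mul]
  refine if_congr (by simp) (by omega) rfl

end Diagram

/-! ### Statistics that are constant on a family -/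

section Triples

/-- Separates a triple into comparisons of two entries: two between different rectangles, and the
descent of the column itself. -/
theorem ind_isInvTriple {α : Type*} [LinearOrder α] (a b c : α) :
    ind (IsInvTriple a b c) = ind (c < a) + ind (b < c) - ind (b < a) := by
  unfold ind IsInvTriple
  split_ifs <;> first | rfl | (exfalso; grind)

theorem sum_ind {ι : Type*} (s : Finset ι) (P : ι → Prop) [DecidablePred P] :
    ∑ i ∈ s, ind (P i) = (s.filter P).card := by
  rw [Finset.card_filter]
  push_cast
  exact Finset.sum_congr rfl fun i _ => by unfold ind; congr

/-- After the separation, the comparisons with `x` depend on the row contents only, and the last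
term is the number of descents. -/
theorem sum_isInvTriple_congr {α : Type*} [LinearOrder α] {ι κ : Type*} [Fintype ι] [Fintype κ]
    {a b a' b' : ι → α} {x x' : κ → α} (ha : SameContent a a') (hb : SameContent b b')
    (hx : SameContent x x')
    (hd : (Finset.univ.filter fun i => b' i < a' i).card = (Finset.univ.filter fun i => b i < a i).card)
    [∀ i j, Decidable (IsInvTriple (a i) (b i) (x j))]
    [∀ i j, Decidable (IsInvTriple (a' i) (b' i) (x' j))] :
    (∑ i, ∑ j, if IsInvTriple (a' i) (b' i) (x' j) then 1 else 0) =
      ∑ i, ∑ j, if IsInvTriple (a i) (b i) (x j) then 1 else 0 := by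
  have key : ∀ (a b : ι → α) (x : κ → α) [∀ i j, Decidable (IsInvTriple (a i) (b i) (x j))],
      ((∑ i, ∑ j, if IsInvTriple (a i) (b i) (x j) then 1 else 0 : ℕ) : ℤ) =
        ∑ i, ∑ j, ind (x j < a i) + ∑ i, ∑ j, ind (b i < x j) -
          Fintype.card κ * (Finset.univ.filter fun i => b i < a i).card := by
    intro a b x _
    rw [← sum_ind, Finset.mul_sum, ← Finset.sum_add_distrib, ← Finset.sum_sub_distrib]
    push_cast
    refine Finset.sum_congr rfl fun i _ => ?_
    rw [← Finset.sum_add_distrib, ← Finset.card_univ, ← nsmul_eq_mul, ← Finset.sum_const,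
      ← Finset.sum_sub_distrib]
    refine Finset.sum_congr rfl fun j _ => ?_
    rw [← ind_isInvTriple]
    unfold ind
    congr
  have h := key a b x
  have h' := key a' b' x'
  zify
  push_cast at h h'
  rw [h, h', hd, ha.sum_eq fun y => ∑ j, ind (x' j < y), hb.sum_eq fun y => ∑ j, ind (y < x' j)]
  have h1 : ∀ y, ∑ j, ind (x' j < y) = ∑ j, ind (x j < y) := fun y => hx.sum_eq fun z => ind (z < y)
  have h2 : ∀ y, ∑ j, ind (y < x' j) = ∑ j, ind (y < x j) := fun y => hx.sum_eq fun z => ind (y < z)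
  simp only [h1, h2]

theorem quinvTriples_congr {μ : YoungDiagram} {σ τ : Filling μ}
    (h : ∀ i, SameType (block σ (i + 1)) (block τ (i + 1))) : quinvTriples τ = quinvTriples σ := by
  classical
  have key : ∀ τ : Filling μ, quinvTriples τ =
      ∑ h ∈ Finset.range (μ.colLen 0), ∑ r ∈ Finset.range (h + 1),
        ∑ h' ∈ (Finset.range (μ.colLen 0)).filter fun h' => r ≤ h' ∧ h' < h,
          ∑ c : Fin (width μ (h + 1)), ∑ c' : Fin (width μ (h' + 1)),
            if IsInvTriple (row (block τ (h + 1)) (r + 1) c) (row (block τ (h + 1)) r c)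
              (row (block τ (h' + 1)) r c') then 1 else 0 := by
    intro τ
    rw [quinvTriples, Finset.filter_congr (q := fun p : (ℕ × ℕ) × (ℕ × ℕ) =>
      μ.colLen p.2.2 < μ.colLen p.1.2 ∧ IsInvTriple (entry τ (p.1.1 + 1) p.1.2)
        (entry τ p.1.1 p.1.2) (entry τ p.1.1 p.2.2)) fun p hp => by rw [mem_rowPairs hp],
      card_rowPairs_longer fun r j j' => IsInvTriple (entry τ (r + 1) j) (entry τ r j)
        (entry τ r j')]
    simp only [entry_block]
  rw [key, key]
  refine Finset.sum_congr rfl fun i _ => Finset.sum_congr rfl fun r _ =>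
    Finset.sum_congr rfl fun i' _ => ?_
  exact sum_isInvTriple_congr (h i (r + 1)).1 (h i r).1 (h i' r).1 (h i r).2

theorem invTriples_congr {μ : YoungDiagram} {σ τ : Filling μ}
    (h : ∀ i, SameType (block σ (i + 1)) (block τ (i + 1))) : invTriples τ = invTriples σ := by
  classical
  have key : ∀ τ : Filling μ, invTriples τ =
      ∑ h ∈ Finset.range (μ.colLen 0), ∑ r ∈ Finset.range (h + 1),
        ∑ h' ∈ (Finset.range (μ.colLen 0)).filter fun h' => r ≤ h' ∧ h' < h,
          ∑ c : Fin (width μ (h + 1)), ∑ c' : Fin (width μ (h' + 1)),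
            if IsInvTriple (row (block τ (h + 1)) r c : ℕ∞)
              (if r = 0 then ⊤ else (row (block τ (h + 1)) (r - 1) c : ℕ∞))
              (row (block τ (h' + 1)) r c' : ℕ∞) then 1 else 0 := by
    intro τ
    rw [invTriples, Finset.filter_congr (q := fun p : (ℕ × ℕ) × (ℕ × ℕ) =>
      μ.colLen p.2.2 < μ.colLen p.1.2 ∧ IsInvTriple (entry τ p.1.1 p.1.2 : ℕ∞)
        (below τ (p.1.1, p.1.2)) (entry τ p.1.1 p.2.2 : ℕ∞)) fun p hp => by rw [mem_rowPairs hp],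
      card_rowPairs_longer fun r j j' => IsInvTriple (entry τ r j : ℕ∞) (below τ (r, j))
        (entry τ r j' : ℕ∞)]
    simp only [entry_block, below]
  rw [key, key]
  refine Finset.sum_congr rfl fun i _ => Finset.sum_congr rfl fun r _ =>
    Finset.sum_congr rfl fun i' _ => ?_
  refine sum_isInvTriple_congr ((h i r).1.comp fun y => (y : ℕ∞)) ?_
    ((h i' r).1.comp fun y => (y : ℕ∞)) ?_
  · by_cases hr : r = 0
    · simp only [hr, if_true]
      exact SameContent.refl _
    · simp only [hr, if_false]
      exact (h i (r - 1)).1.comp fun y => (y : ℕ∞)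
  · by_cases hr : r = 0
    · simp [hr]
    · have := (h i (r - 1)).2
      simp only [numDescents, Nat.sub_add_cancel (Nat.pos_of_ne_zero hr)] at this
      simpa [hr] using this

theorem maj_congr {μ : YoungDiagram} {σ τ : Filling μ}
    (h : ∀ i, SameType (block σ (i + 1)) (block τ (i + 1))) : maj τ = maj σ := by
  rw [maj_eq_sum, maj_eq_sum]
  exact Finset.sum_congr rfl fun i _ => Finset.sum_congr rfl fun r _ => by rw [(h i r).2]

end Triples

/-! ### The filling `σ'` -/

section Prime

variable {μ : YoungDiagram}

theorem row_block_le (σ : Filling μ) (h r : ℕ) (c : Fin (width μ (h + 1))) :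
    row (block σ (h + 1)) r c ≤ maxEntry σ := by
  by_cases hr : r < h + 1
  · rw [← entry_block]
    exact Finset.le_sup (f := fun x : ℕ × ℕ => entry σ x.1 x.2)
      ((YoungDiagram.mem_cells _).2 (block_mem ⟨r, hr⟩ c))
  · rw [row_top _ (not_lt.1 hr)]
    exact Nat.zero_le _

theorem maxEntry_le_iff (σ : Filling μ) (N : ℕ) :
    maxEntry σ ≤ N ↔ ∀ h r c, row (block σ (h + 1)) r c ≤ N := by
  refine ⟨fun hN h r c => (row_block_le σ h r c).trans hN, fun hN => Finset.sup_le ?_⟩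
  rintro ⟨r, j⟩ hx
  obtain ⟨h, -, -, c, rfl⟩ := exists_block_of_mem ((YoungDiagram.mem_cells _).1 hx)
  rw [entry_block]
  exact hN h r c

theorem maxEntry_congr {σ τ : Filling μ}
    (h : ∀ i, SameType (block σ (i + 1)) (block τ (i + 1))) : maxEntry τ = maxEntry σ := by
  refine le_antisymm ((maxEntry_le_iff _ _).2 fun i r c => ?_)
    ((maxEntry_le_iff _ _).2 fun i r c => ?_)
  · obtain ⟨w, hw⟩ := (h i r).1
    rw [hw]
    exact row_block_le _ _ _ _
  · obtain ⟨w, hw⟩ := (h i r).1.symm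
    rw [hw]
    exact row_block_le _ _ _ _

theorem row_block_prime (σ : Filling μ) {h r : ℕ} (hr : r < h + 1) (c : Fin (width μ (h + 1))) :
    row (block (prime σ) (h + 1)) r c = maxEntry σ + 1 - row (block σ (h + 1)) (h + 1 - 1 - r) c := by
  have h1 := row_block_le σ h (h + 1 - 1 - r) c
  rw [row, dif_pos (by omega)] at h1
  rw [row, dif_pos hr, row, dif_pos (by omega), block, prime, PNat.sub_coe, if_pos]
  · simp only [colLen_rowLen_add]
    rfl
  · rw [← PNat.coe_lt_coe]
    simp only [colLen_rowLen_add]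
    exact Nat.lt_succ_of_le h1

theorem maxEntry_prime_le (σ : Filling μ) : maxEntry (prime σ) ≤ maxEntry σ := by
  refine (maxEntry_le_iff _ _).2 fun h r c => ?_
  by_cases hr : r < h + 1
  · have := row_pos (block σ (h + 1)) (i := h + 1 - 1 - r) (by omega) c
    rw [row_block_prime σ hr]
    omega
  · rw [row_top _ (not_lt.1 hr)]
    exact Nat.zero_le _

/-- Fillings of the same type have the same largest entry, hence are complemented in the same way.
Complementing and flipping together carry descents to descents. -/
theorem sameType_prime {σ τ : Filling μ} (h : ∀ i, SameType (block σ (i + 1)) (block τ (i + 1)))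
    (i : ℕ) : SameType (block (prime σ) (i + 1)) (block (prime τ) (i + 1)) := by
  have hN := maxEntry_congr h
  have key : ∀ (ρ : Filling μ) (r : ℕ), numDescents (block (prime ρ) (i + 1)) r =
      if r < i then numDescents (block ρ (i + 1)) (i - 1 - r) else 0 := by
    intro ρ r
    unfold numDescents
    split_ifs with hr
    · congr 1
      refine Finset.filter_congr fun c _ => ?_
      rw [row_block_prime ρ (by omega), row_block_prime ρ (by omega),
        show i + 1 - 1 - r = i - 1 - r + 1 by omega, show i + 1 - 1 - (r + 1) = i - 1 - r by omega]
      have := row_block_le ρ i (i - 1 - r) c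
      have := row_block_le ρ i (i - 1 - r + 1) c
      omega
    · rw [Finset.card_eq_zero, Finset.filter_false_of_mem]
      intro c _
      rw [row_top _ (show i + 1 ≤ r + 1 by omega)]
      exact Nat.not_lt_zero _
  intro r
  constructor
  · by_cases hr : r < i + 1
    · have h1 : ∀ ρ : Filling μ, row (block (prime ρ) (i + 1)) r = fun c =>
        maxEntry ρ + 1 - row (block ρ (i + 1)) (i + 1 - 1 - r) c :=
        fun ρ => funext fun c => row_block_prime ρ hr c
      rw [h1, h1, hN]
      exact (h i _).1.comp fun y => maxEntry σ + 1 - y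
    · rw [row_top _ (not_lt.1 hr), row_top _ (not_lt.1 hr)]
      exact SameContent.refl _
  · rw [key, key, (h i _).2]

theorem dCoeff_eq_prod (ε : Kind) (σ : Filling μ) :
    dCoeff ε σ = ∏ h ∈ Finset.range (μ.colLen 0), dRect ε (maxEntry σ) (block σ (h + 1)) := by
  rw [dCoeff, Finset.range_eq_Ico,
    Finset.prod_Ico_add' (fun h => dRect ε (maxEntry σ) (block σ h)) 0 (μ.colLen 0) 1]
  rfl

theorem dCoeff_prime (ε : Kind) (σ : Filling μ) : dCoeff ε (prime σ) = dCoeff ε σ := by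
  rw [dCoeff_eq_prod, dCoeff_eq_prod]
  refine Finset.prod_congr rfl fun h _ => ?_
  rw [← dRect_of_le ε _ (row_block_le _ h) (maxEntry_prime_le σ)]
  exact dRect_dual ε _ _ (row_block_le σ h) fun r hr c => row_block_prime σ hr c

end Prime

/-! ### Gluing rectangles -/

section Glue

variable {μ : YoungDiagram}

/-- The rectangles of a filling. -/
def blocks (τ : Filling μ) (i : Fin (μ.colLen 0)) : Rect (i + 1) (width μ (i + 1)) :=
  block τ (i + 1)

open scoped Classical in
/-- The filling with given rectangles. -/
def glue (ρ : (i : Fin (μ.colLen 0)) → Rect (i + 1) (width μ (i + 1))) : Filling μ := fun x =>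
  if H : ∃ (i : Fin (μ.colLen 0)) (r : Fin (i + 1)) (c : Fin (width μ (i + 1))),
      x.1 = ((r : ℕ), μ.rowLen (i + 1) + (c : ℕ)) then
    ρ H.choose H.choose_spec.choose H.choose_spec.choose_spec.choose
  else 1

theorem blocks_injective : Function.Injective (blocks (μ := μ)) := by
  intro σ τ h
  funext x
  obtain ⟨⟨r, j⟩, hx⟩ := x
  obtain ⟨i, hi, hr, c, rfl⟩ := exists_block_of_mem hx
  exact congrFun (congrFun (congrFun h ⟨i, hi⟩) ⟨r, hr⟩) c

theorem blocks_surjective : Function.Surjective (blocks (μ := μ)) := by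
  intro ρ
  refine ⟨glue ρ, ?_⟩
  funext i r c
  have H : ∃ (i' : Fin (μ.colLen 0)) (r' : Fin (i' + 1)) (c' : Fin (width μ (i' + 1))),
      ((r : ℕ), μ.rowLen (i + 1) + (c : ℕ)) = ((r' : ℕ), μ.rowLen (i' + 1) + (c' : ℕ)) :=
    ⟨i, r, c, rfl⟩
  have key : ∀ (i' : Fin (μ.colLen 0)) (r' : Fin (i' + 1)) (c' : Fin (width μ (i' + 1))),
      ((r : ℕ), μ.rowLen (i + 1) + (c : ℕ)) = ((r' : ℕ), μ.rowLen (i' + 1) + (c' : ℕ)) →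
        ρ i' r' c' = ρ i r c := by
    intro i' r' c' e
    obtain ⟨e1, e2⟩ := Prod.mk.inj e
    obtain rfl := Fin.ext (block_index_unique e2)
    obtain rfl := Fin.ext e1
    obtain rfl := Fin.ext (Nat.add_left_cancel e2)
    rfl
  exact (dif_pos H).trans (key _ _ _ H.choose_spec.choose_spec.choose_spec)

/-- Fillings as families of rectangles. -/
def blocksEquiv (μ : YoungDiagram) :
    Filling μ ≃ ((i : Fin (μ.colLen 0)) → Rect (i + 1) (width μ (i + 1))) :=
  Equiv.ofBijective blocks ⟨blocks_injective, blocks_surjective⟩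

/-- Canonicity and membership in a family are required for all heights `h`. Height `0` and heights
above that of the diagram give empty rectangles, where nothing has to be chosen. -/
theorem subsingleton_rect {h : ℕ} (hh : ∀ i < μ.colLen 0, h ≠ i + 1) :
    Subsingleton (Rect h (width μ h)) := by
  rcases h with _ | i
  · exact inferInstanceAs (Subsingleton (Fin 0 → _))
  · have h1 : ¬ i < μ.colLen 0 := fun h => hh i h rfl
    have h2 : width μ (i + 1) = 0 := by
      rw [width, Nat.add_sub_cancel, rowLen_eq_zero_of_le (not_lt.1 h1), Nat.zero_sub]
    refine ⟨fun ρ ρ' => funext fun _ => funext fun c => absurd c.2 (by omega)⟩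

theorem forall_block_iff (P : ∀ h, Rect h (width μ h) → Prop)
    (hP : ∀ h, Subsingleton (Rect h (width μ h)) → ∃ ρ, P h ρ) (τ : Filling μ) :
    (∀ h, P h (block τ h)) ↔ ∀ i : Fin (μ.colLen 0), P (i + 1) (blocks τ i) := by
  refine ⟨fun h i => h _, fun h i => ?_⟩
  by_cases hi : ∀ i' < μ.colLen 0, i ≠ i' + 1
  · have := subsingleton_rect hi
    obtain ⟨ρ, hρ⟩ := hP i this
    rwa [Subsingleton.elim (block τ i) ρ]
  · push Not at hi
    obtain ⟨i', hi', rfl⟩ := hi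
    exact h ⟨i', hi'⟩

theorem isCanonical_iff (ε : Kind) (σ : Filling μ) :
    IsCanonical ε σ ↔ ∀ i, IsCanonicalRect ε (blocks σ i) :=
  forall_block_iff (fun _ ρ => IsCanonicalRect ε ρ) (fun h _ => by
    obtain ⟨ρ, hρ, -⟩ := existsUnique_familyRect ε (fun _ _ => 1 : Rect h (width μ h))
    exact ⟨ρ, hρ.1⟩) σ

theorem mem_family_iff (ε : Kind) (σ τ : Filling μ) :
    τ ∈ family ε σ ↔ ∀ i, blocks τ i ∈ familyRect ε (blocks σ i) :=
  forall_block_iff (fun h ρ => ρ ∈ familyRect ε (block σ h)) (fun h hs => by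
    obtain ⟨ρ, hρ, -⟩ := existsUnique_familyRect ε (block σ h)
    refine ⟨block σ h, ?_⟩
    convert hρ.2) τ

theorem existsUnique_family (ε : Kind) (τ : Filling μ) :
    ∃! σ, IsCanonical ε σ ∧ τ ∈ family ε σ := by
  choose ρ hρ hu using fun i => existsUnique_familyRect ε (blocks τ i)
  obtain ⟨σ, rfl⟩ := blocks_surjective ρ
  refine ⟨σ, ⟨(isCanonical_iff ε σ).2 fun i => (hρ i).1,
    (mem_family_iff ε σ τ).2 fun i => (hρ i).2⟩, fun σ' hσ' => blocks_injective (funext fun i => ?_)⟩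
  exact hu i _ ⟨(isCanonical_iff ε σ').1 hσ'.1 i, (mem_family_iff ε σ' τ).1 hσ'.2 i⟩

theorem sameType_of_mem_family {ε : Kind} {σ τ : Filling μ} (h : τ ∈ family ε σ) (i : ℕ) :
    SameType (block σ (i + 1)) (block τ (i + 1)) :=
  sameType_of_mem_familyUpTo (h (i + 1))

/-- The members of the family of a filling. -/
def familyFinset (ε : Kind) (σ : Filling μ) : Finset (Filling μ) :=
  (Fintype.piFinset fun i => (finite_familyUpTo ε (blocks σ i) (i + 1)).toFinset).map
    (blocksEquiv μ).symm.toEmbedding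

theorem coe_familyFinset (ε : Kind) (σ : Filling μ) :
    (familyFinset ε σ : Set (Filling μ)) = family ε σ := by
  ext τ
  rw [mem_family_iff, Finset.mem_coe, familyFinset, Finset.mem_map_equiv]
  simp only [Fintype.mem_piFinset, Set.Finite.mem_toFinset, Equiv.symm_symm]
  rfl

/-- A family is the product of the families of the rectangles and `etaS` is additive, so the sum
factors over the rectangles. -/
theorem sum_familyFinset {S : ℕ → ℕ → ℕ → ℕ → Prop} (hS : IsQuinvQuadrupleSet S) {ε : Kind}
    (hE : ExtraOrder S ε) {σ : Filling μ} (hσ : IsCanonical ε σ) :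
    ∑ τ ∈ familyFinset ε σ, tv ^ etaS S τ = tv ^ etaS S σ * dCoeff ε σ := by
  have h1 : ∀ τ : Filling μ, tv ^ etaS S τ = ∏ i, tv ^ etaRect S (blocks τ i) := fun τ => by
    rw [etaS_eq_sum, Finset.prod_pow_eq_pow_sum, ← Fin.sum_univ_eq_sum_range]
    rfl
  have h2 : dCoeff ε σ = ∏ i : Fin (μ.colLen 0), dRect ε (maxEntry σ) (blocks σ i) := by
    rw [dCoeff_eq_prod, ← Fin.prod_univ_eq_prod_range]
    rfl
  rw [familyFinset, Finset.sum_map, h1 σ, h2, ← Finset.prod_mul_distrib]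
  simp only [h1]
  have h3 : ∀ ρ, blocks ((blocksEquiv μ).symm.toEmbedding ρ) = ρ := fun ρ =>
    (blocksEquiv μ).apply_symm_apply ρ
  simp only [h3]
  rw [← Finset.prod_univ_sum (fun i => (finite_familyUpTo ε (blocks σ i) (i + 1)).toFinset)
    fun i ρ => tv ^ etaRect S ρ]
  refine Finset.prod_congr rfl fun i _ => ?_
  rw [sum_familyUpTo tv hS hE ((isCanonical_iff ε σ).1 hσ i) (row_block_le σ i) (i + 1) le_rfl,
    dRect_eq ε (blocks σ i) (row_block_le σ i)]
  congr 1
  exact Finset.prod_congr rfl fun r _ => classProd_tv ε (row_block_le σ i r)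

/-- In both identities only `etaS` varies over the family, so both reduce to `sum_familyFinset`; the
second one then needs `dCoeff_prime`. -/
theorem family_identities {S : ℕ → ℕ → ℕ → ℕ → Prop} (hS : IsQuinvQuadrupleSet S) {ε : Kind}
    (hE : ExtraOrder S ε) {σ : Filling μ} (hσ : IsCanonical ε σ) :
    (family ε σ).Finite ∧
      ∑ᶠ τ ∈ family ε σ, qv ^ maj τ * tv ^ eta S τ =
        qv ^ maj σ * tv ^ eta S σ * dCoeff ε σ ∧
      ∑ᶠ τ ∈ family ε σ, qv ^ maj (prime τ) * tv ^ etaStarPrime S τ =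
        qv ^ maj (prime σ) * tv ^ etaStarPrime S σ * dCoeff ε (prime σ) := by
  have hmem : ∀ τ ∈ familyFinset ε σ, ∀ i, SameType (block σ (i + 1)) (block τ (i + 1)) :=
    fun τ hτ => sameType_of_mem_family (by rwa [← coe_familyFinset, Finset.mem_coe])
  have hsum := sum_familyFinset hS hE hσ
  rw [← coe_familyFinset]
  refine ⟨Finset.finite_toSet _, ?_, ?_⟩
  · rw [finsum_mem_coe_finset, Finset.sum_congr rfl fun τ hτ => by
      rw [eta, maj_congr (hmem τ hτ), quinvTriples_congr (hmem τ hτ), pow_add,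
        mul_left_comm], ← Finset.sum_mul, hsum, eta, pow_add]
    ring
  · rw [finsum_mem_coe_finset, Finset.sum_congr rfl fun τ hτ => by
      rw [etaStarPrime, maj_congr (sameType_prime (hmem τ hτ)),
        invTriples_congr (sameType_prime (hmem τ hτ)), pow_add,
        mul_left_comm], ← Finset.sum_mul, hsum, etaStarPrime, pow_add, dCoeff_prime]
    ring

end Glue

end MacTab

end

theorem theorem7p1 (μ : YoungDiagram) :
    (∀ ε : MacTab.Kind,
      (⋃ σ ∈ {σ : MacTab.Filling μ | MacTab.IsCanonical ε σ}, MacTab.family ε σ) = Set.univ ∧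
      {σ : MacTab.Filling μ | MacTab.IsCanonical ε σ}.PairwiseDisjoint (MacTab.family ε)) ∧
    (∀ S : ℕ → ℕ → ℕ → ℕ → Prop, MacTab.IsQuinvQuadrupleSet S →
      (∀ z w u v : ℕ, w < z → z ≤ u → u < v → S z w u v) →
      ∀ σ : MacTab.Filling μ, MacTab.IsCanonical .diamond σ →
        (MacTab.family .diamond σ).Finite ∧
        ∑ᶠ τ ∈ MacTab.family .diamond σ,
            MacTab.qv ^ MacTab.maj τ * MacTab.tv ^ MacTab.eta S τ =
          MacTab.qv ^ MacTab.maj σ * MacTab.tv ^ MacTab.eta S σ * MacTab.dCoeff .diamond σ ∧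
        ∑ᶠ τ ∈ MacTab.family .diamond σ,
            MacTab.qv ^ MacTab.maj (MacTab.prime τ) * MacTab.tv ^ MacTab.etaStarPrime S τ =
          MacTab.qv ^ MacTab.maj (MacTab.prime σ) * MacTab.tv ^ MacTab.etaStarPrime S σ *
            MacTab.dCoeff .diamond (MacTab.prime σ)) ∧
    (∀ S : ℕ → ℕ → ℕ → ℕ → Prop, MacTab.IsQuinvQuadrupleSet S →
      (∀ z w u v : ℕ, u < v → v < w → w < z → S z w u v) →
      ∀ σ : MacTab.Filling μ, MacTab.IsCanonical .dagger σ →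
        (MacTab.family .dagger σ).Finite ∧
        ∑ᶠ τ ∈ MacTab.family .dagger σ,
            MacTab.qv ^ MacTab.maj τ * MacTab.tv ^ MacTab.eta S τ =
          MacTab.qv ^ MacTab.maj σ * MacTab.tv ^ MacTab.eta S σ * MacTab.dCoeff .dagger σ ∧
        ∑ᶠ τ ∈ MacTab.family .dagger σ,
            MacTab.qv ^ MacTab.maj (MacTab.prime τ) * MacTab.tv ^ MacTab.etaStarPrime S τ =
          MacTab.qv ^ MacTab.maj (MacTab.prime σ) * MacTab.tv ^ MacTab.etaStarPrime S σ *
            MacTab.dCoeff .dagger (MacTab.prime σ)) := by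
  refine ⟨fun ε => ⟨?_, ?_⟩, ?_, ?_⟩
  · refine Set.eq_univ_of_forall fun τ => ?_
    obtain ⟨σ, hσ, -⟩ := MacTab.existsUnique_family ε τ
    exact Set.mem_biUnion hσ.1 hσ.2
  · intro σ hσ σ' hσ' hne
    refine Set.disjoint_left.2 fun τ h h' => hne ?_
    exact (MacTab.existsUnique_family ε τ).unique ⟨hσ, h⟩ ⟨hσ', h'⟩
  · exact fun S hS hE σ hσ => MacTab.family_identities (ε := .diamond) hS hE hσ
  · exact fun S hS hE σ hσ => MacTab.family_identities (ε := .dagger) hS hE hσ
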